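/- Notation. Let $n\in\mathbb N$, $a\in(-1,1)$. Points of $\mathbb R^{n+1}_+=\mathbb R^n\times(0,\infty)$ are $X=(x,y)$; $\mathbb S_r^+=\mathbb R^{n+1}_+\times(-r^2,0]$, $S_1=\mathbb R^n\times(-1,0]$, $|(X,t)|=\sqrt{|X|^2+|t|}$, $\nabla=\nabla_X$, $\partial_y^aU(x,0,t)=\lim_{y\to0^+}y^aU_y(x,y,t)$, $ZU=\langle X,\nabla U\rangle+2tU_t$, and for $t<0$ $$\overline{\mathscr G}_a(X,t)=\frac{(4\pi)^{-n/2}}{2^a\Gamma(\frac{a+1}2)}\,|t|^{-\frac{n+a+1}2}e^{-\frac{|X|^2}{4|t|}} .$$ For $F\in L^\infty(\mathbb S_1^+)$, the class $\mathfrak S_F(\mathbb S_1^+)$ consists of all functions $U$ on $\mathbb S_1^+$, continuous up to $\{y=0\}$, such that: (1) $U$ has bounded support; (2) $\nabla_xU,\ y^aU_y\in H^{\alpha,\alpha/2}(\mathbb S_1^+)$ (parabolic Hölder space) for some $\alpha\in(0,1]$; (3) $U_t\in L^\infty(\mathbb S_1^+)$; (4) $y^a|\nabla U_{x_i}|^2$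 $(1\le i\le n)$ and $y^{-a}\big((y^aU_y)_y\big)^2$ are in $L^1(\mathbb S_1^+)$; (5) $\partial_t(y^aU)-\operatorname{div}_X(y^a\nabla U)=y^aF$ in $\mathbb S_1^+$ in the sense of distributions, and $\min\{U(x,0,t),-\partial_y^aU(x,0,t)\}=0$ on $S_1$; (6) $(0,0)\in\partial\{(x,t)\in S_1: U(x,0,t)=0,\ \partial_y^aU(x,0,t)=0\}$. Put $$H(U,r)=\frac1{r^2}\int_{\mathbb S_r^+}U^2\,\overline{\mathscr G}_a\,y^a\,dX\,dt,\qquad D(U,r)=\frac1{r^2}\int_{\mathbb S_r^+}|t|\,|\nabla U|^2\,\overline{\mathscr G}_a\,y^a\,dX\,dt,$$ $$\mathscr W_\kappa(U,r)=r^{-2\kappa}\Big\{D(U,r)-\frac\kappa2H(U,r)\Big\}.$$ Theorem (Weiss type monotonicity formula in Gaussian space). Let $n\in\mathbb N$, $a\in(-1,1)$, $\ell\ge2$ and $C_\ell$ be given. There is a constant $C'>0$, depending only on $n,a,\ell,C_\ell$, with the following property. Let $F\in L^\infty(\mathbb S_1^+)$ satisfy $|F(X,t)|\le C_\ell|(X,t)|^{\ell-2}$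 for a.e. $(X,t)\in\mathbb S_1^+$, let $U\in\mathfrak S_F(\mathbb S_1^+)$, let $\kappa\in(0,\ell)$ and let $\sigma\in(0,1)$ be such that $\kappa\le\ell-1+\sigma$. Then for every $r\in(0,1)$ the integrals below and those defining $H(U,r)$, $D(U,r)$ converge, $\mathscr W_\kappa(U,\cdot)$ is differentiable at $r$, and $$\mathscr W_\kappa'(U,r)\ \ge\ \frac1{r^{2\kappa+3}}\int_{\mathbb S_r^+}\big(ZU-\kappa U+|t|F\big)^2\,\overline{\mathscr G}_a\,y^a\,dX\,dt\;-\;C'r^{1-2\sigma}.$$ In particular, with $C=\frac{C'}{2-2\sigma}$, the function $r\mapsto\mathscr W_\kappa(U,r)+C\,r^{2-2\sigma}$ is nondecreasing on $(0,1)$, and therefore the limit $\mathscr W_\kappa(U,0^+)=\lim_{r\to0^+}\mathscr W_\kappa(U,r)$ exists in $[-\infty,\infty)$. -/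

import Mathlib

open MeasureTheory Set Filter Topology
open scoped ContDiff

namespace ThinObstacle

/-- Space-time points `((x, y), t)`, where `x ∈ ℝⁿ`, `y ∈ ℝ` is the extension variable and `t` is
time.  Lebesgue measure is the product measure.  (The norm of this product type is never used;
Euclidean lengths are written out.) -/
abbrev SpaceTime (n : ℕ) : Type := (EuclideanSpace ℝ (Fin n) × ℝ) × ℝ

/-- The half strip `𝕊_r⁺ = {y > 0, -r² < t ≤ 0}`. -/
def strip (n : ℕ) (r : ℝ) : Set (SpaceTime n) :=
  {p | 0 < p.1.2 ∧ -r ^ 2 < p.2 ∧ p.2 ≤ 0}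

/-- The strip `{y ≥ 0, -1 < t ≤ 0}`, that is `𝕊_1⁺` together with the thin set `y = 0`. -/
def stripWithThin (n : ℕ) : Set (SpaceTime n) :=
  {p | 0 ≤ p.1.2 ∧ -1 < p.2 ∧ p.2 ≤ 0}

/-- The open strip `{y > 0, -1 < t < 0}`, the interior of `𝕊_1⁺`. -/
def openStrip (n : ℕ) : Set (SpaceTime n) :=
  {p | 0 < p.1.2 ∧ -1 < p.2 ∧ p.2 < 0}

/-- `|X|² = |x|² + y²`. -/
noncomputable def normSqX {n : ℕ} (X : EuclideanSpace ℝ (Fin n) × ℝ) : ℝ := ‖X.1‖ ^ 2 + X.2 ^ 2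

/-- The parabolic pseudo-distance from the origin `|(X, t)| = √(|X|² + |t|)`. -/
noncomputable def parNorm {n : ℕ} (p : SpaceTime n) : ℝ := Real.sqrt (normSqX p.1 + |p.2|)

/-- The gradient in the variable `x`. -/
noncomputable def gradx {n : ℕ} (U : SpaceTime n → ℝ) (p : SpaceTime n) :
    EuclideanSpace ℝ (Fin n) :=
  gradient (fun x => U ((x, p.1.2), p.2)) p.1.1

/-- The partial derivative in `y`. -/
noncomputable def dy {n : ℕ} (U : SpaceTime n → ℝ) (p : SpaceTime n) : ℝ :=
  deriv (fun y => U ((p.1.1, y), p.2)) p.1.2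

/-- The partial derivative in `t`. -/
noncomputable def dt {n : ℕ} (U : SpaceTime n → ℝ) (p : SpaceTime n) : ℝ :=
  deriv (fun t => U (p.1, t)) p.2

/-- `|∇U|² = |∇ₓU|² + U_y²`. -/
noncomputable def normSqGrad {n : ℕ} (U : SpaceTime n → ℝ) (p : SpaceTime n) : ℝ :=
  ‖gradx U p‖ ^ 2 + dy U p ^ 2

/-- The generator of the parabolic dilations, `ZU = ⟨X, ∇U⟩ + 2 t U_t`. -/
noncomputable def Zfield {n : ℕ} (U : SpaceTime n → ℝ) (p : SpaceTime n) : ℝ :=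
  inner ℝ p.1.1 (gradx U p) + p.1.2 * dy U p + 2 * p.2 * dt U p

/-- The Gaussian `𝒢̄_a(X, t) = 𝒢_a(X, |t|)`, `t < 0`. -/
noncomputable def gaussian {n : ℕ} (a : ℝ) (p : SpaceTime n) : ℝ :=
  (4 * Real.pi) ^ (-(n : ℝ) / 2) / (2 ^ a * Real.Gamma ((a + 1) / 2))
    * |p.2| ^ (-((n : ℝ) + a + 1) / 2) * Real.exp (-(normSqX p.1) / (4 * |p.2|))

/-- The function `y^a U_y`. -/
noncomputable def weightedDy {n : ℕ} (a : ℝ) (U : SpaceTime n → ℝ) (p : SpaceTime n) : ℝ :=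
  p.1.2 ^ a * dy U p

/-- The weighted normal derivative `∂_y^a U(x, 0, t) = lim_{y → 0⁺} y^a U_y(x, y, t)`
on the thin set. -/
noncomputable def conormal {n : ℕ} (a : ℝ) (U : SpaceTime n → ℝ)
    (x : EuclideanSpace ℝ (Fin n)) (t : ℝ) : ℝ :=
  limUnder (𝓝[>] (0 : ℝ)) (fun y => weightedDy a U ((x, y), t))

/-- Smooth test functions with compact support in the open strip. -/
def IsTest {n : ℕ} (φ : SpaceTime n → ℝ) : Prop :=
  ContDiff ℝ ∞ φ ∧ HasCompactSupport φ ∧ tsupport φ ⊆ openStrip n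

/-- `g` is the distributional derivative of `f` in the direction `v` in the open strip. -/
def HasWeakPartial {n : ℕ} (v : SpaceTime n) (f g : SpaceTime n → ℝ) : Prop :=
  LocallyIntegrableOn f (openStrip n) ∧ LocallyIntegrableOn g (openStrip n) ∧
    ∀ φ : SpaceTime n → ℝ, IsTest φ →
      ∫ p in openStrip n, f p * fderiv ℝ φ p v = - ∫ p in openStrip n, g p * φ p

/-- The coordinate direction of `x_j`. -/
noncomputable def ex {n : ℕ} (j : Fin n) : SpaceTime n := ((EuclideanSpace.single j 1, 0), 0)

/-- The coordinate direction of `y`. -/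
def ey (n : ℕ) : SpaceTime n := ((0, 1), 0)

/-- The coordinate direction of `t`. -/
def et (n : ℕ) : SpaceTime n := ((0, 0), 1)

/-- Membership in the parabolic Hölder space `H^{α, α/2}(𝕊_1⁺)`, `0 < α ≤ 1`. -/
def ParHolder {n : ℕ} {V : Type*} [NormedAddCommGroup V] (α : ℝ) (f : SpaceTime n → V) : Prop :=
  ∃ M : ℝ, (∀ p ∈ strip n 1, ‖f p‖ ≤ M) ∧
    ∀ p ∈ strip n 1, ∀ q ∈ strip n 1,
      ‖f p - f q‖ ≤ M * (Real.sqrt (normSqX (p.1 - q.1)) ^ α + |p.2 - q.2| ^ (α / 2))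

/-- The equation `∂_t (y^a U) - div_X (y^a ∇_X U) = y^a F` in the half strip, in the sense of
distributions. -/
def SolvesEquation {n : ℕ} (a : ℝ) (F U : SpaceTime n → ℝ) : Prop :=
  ∀ φ : SpaceTime n → ℝ, IsTest φ →
    ∫ p in openStrip n, p.1.2 ^ a *
        (-(U p * dt φ p) + inner ℝ (gradx U p) (gradx φ p) + dy U p * dy φ p)
      = ∫ p in openStrip n, p.1.2 ^ a * F p * φ p

/-- The extended free boundary
`Γ_*(U) = ∂ {(x, t) ∈ S_1 | U(x, 0, t) = 0, ∂_y^a U(x, 0, t) = 0}`, `S_1 = ℝⁿ × (-1, 0]`. -/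
def extFreeBoundary {n : ℕ} (a : ℝ) (U : SpaceTime n → ℝ) :
    Set (EuclideanSpace ℝ (Fin n) × ℝ) :=
  frontier {q | -1 < q.2 ∧ q.2 ≤ 0 ∧ U ((q.1, 0), q.2) = 0 ∧ conormal a U q.1 q.2 = 0}

/-- The class `𝔖_F(𝕊_1⁺)` of solutions of the Signorini problem in the half strip. `U` is taken to
be the representative which is continuous up to the thin set `y = 0`, where it has its traces. -/
structure IsSolution {n : ℕ} (a : ℝ) (F U : SpaceTime n → ℝ) : Prop where
  continuousOn : ContinuousOn U (stripWithThin n)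
  bounded_support : ∃ R : ℝ, ∀ p ∈ stripWithThin n, R < normSqX p.1 → U p = 0
  /-- The first derivatives in `x` and `y` exist in the strip ... -/
  differentiable_x : ∀ p ∈ strip n 1, DifferentiableAt ℝ (fun x => U ((x, p.1.2), p.2)) p.1.1
  differentiable_y : ∀ p ∈ strip n 1, DifferentiableAt ℝ (fun y => U ((p.1.1, y), p.2)) p.1.2
  /-- ... and `∇ₓU, y^a U_y ∈ H^{α, α/2}(𝕊_1⁺)` for some `α > 0`. -/
  holder : ∃ α : ℝ, 0 < α ∧ α ≤ 1 ∧ ParHolder α (gradx U) ∧ ParHolder α (weightedDy a U)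
  /-- `U_t ∈ L^∞(𝕊_1⁺)`, where `U_t` is the distributional derivative. -/
  time_deriv : HasWeakPartial (et n) U (dt U) ∧ MemLp (dt U) ⊤ (volume.restrict (strip n 1))
  /-- `y^a |∇U_{x_i}|² ∈ L¹(𝕊_1⁺)`, with distributional second derivatives. -/
  second_x : ∀ i : Fin n, ∃ (g : Fin n → SpaceTime n → ℝ) (h : SpaceTime n → ℝ),
    (∀ j, HasWeakPartial (ex j) (fun p => gradx U p i) (g j)) ∧
    HasWeakPartial (ey n) (fun p => gradx U p i) h ∧
    IntegrableOn (fun p => p.1.2 ^ a * ((∑ j, g j p ^ 2) + h p ^ 2)) (strip n 1)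
  /-- `y^{-a} ((y^a U_y)_y)² ∈ L¹(𝕊_1⁺)`. -/
  second_y : ∃ h : SpaceTime n → ℝ, HasWeakPartial (ey n) (weightedDy a U) h ∧
    IntegrableOn (fun p => p.1.2 ^ (-a) * h p ^ 2) (strip n 1)
  equation : SolvesEquation a F U
  signorini : ∀ (x : EuclideanSpace ℝ (Fin n)) (t : ℝ), -1 < t → t ≤ 0 →
    min (U ((x, 0), t)) (-conormal a U x t) = 0
  origin_mem : (0, 0) ∈ extFreeBoundary a U

/-- The integrand `U² 𝒢̄_a y^a` of the height. -/
noncomputable def heightIntegrand {n : ℕ} (a : ℝ) (U : SpaceTime n → ℝ) (p : SpaceTime n) : ℝ :=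
  U p ^ 2 * gaussian a p * p.1.2 ^ a

/-- The integrand `|t| |∇U|² 𝒢̄_a y^a` of the energy. -/
noncomputable def energyIntegrand {n : ℕ} (a : ℝ) (U : SpaceTime n → ℝ) (p : SpaceTime n) : ℝ :=
  |p.2| * normSqGrad U p * gaussian a p * p.1.2 ^ a

/-- The integrand `(ZU - κU + |t| F)² 𝒢̄_a y^a`. -/
noncomputable def weissIntegrand {n : ℕ} (a κ : ℝ) (F U : SpaceTime n → ℝ) (p : SpaceTime n) : ℝ :=
  (Zfield U p - κ * U p + |p.2| * F p) ^ 2 * gaussian a p * p.1.2 ^ a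

/-- The height `H(U, r)`. -/
noncomputable def height {n : ℕ} (a : ℝ) (U : SpaceTime n → ℝ) (r : ℝ) : ℝ :=
  1 / r ^ 2 * ∫ p in strip n r, heightIntegrand a U p

/-- The energy `D(U, r)`. -/
noncomputable def energy {n : ℕ} (a : ℝ) (U : SpaceTime n → ℝ) (r : ℝ) : ℝ :=
  1 / r ^ 2 * ∫ p in strip n r, energyIntegrand a U p

/-- The parabolic `κ`-Weiss functional `r^{-2κ} (D(U, r) - (κ / 2) H(U, r))`. -/
noncomputable def weiss {n : ℕ} (a κ : ℝ) (U : SpaceTime n → ℝ) (r : ℝ) : ℝ :=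
  r ^ (-(2 * κ)) * (energy a U r - κ / 2 * height a U r)

end ThinObstacle

namespace ThinObstacle

/-! ### Affine changes of variables -/

/-! The formula is obtained by differentiating along the parabolic dilations `dil l : (X, t) ↦ (lX,
l²t)`. They map the strip of size `r` to that of size `lr` and scale the measure `𝒢̄_a y^a dX dt` by
`l²`. Hence, with `U_l = U ∘ dil l`, the height and energy of `U` at scale `lr` are `r⁻²` times the
integrals of `U_l²` and `|t||∇U_l|²` over the fixed strip of size `r`, and it suffices to
differentiate in `l` at `l = 1`, where `U_l` has derivative `ZU`.

The height gives `∫ 2 U ZU`. For the energy one writes `|∇U_l|² - |∇U|² = ∇U·∇(U_l - U) + ∇U_l·∇(U_l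
- U)` and scales the second term back by `l⁻¹`, so that in both terms the gradient of `U` itself is
tested. No derivative of `∇U` is formed. Since `∇(|t|𝒢̄_a) = -½ 𝒢̄_a X`, the equation tested with
`|t|𝒢̄_a ψ` reads `∫ |t| ∇U·∇ψ = ∫ S ψ - (thin term)` against the Gaussian weight, where `S = ½ ZU +
|t|F` (`integral_gaussForm`). The thin term pairs `ψ` with the conormal derivative of `U`. For `ψ =
U` it vanishes by complementarity. For `ψ = U_l - U` it is `o(l - 1)`: where the conormal derivative
is nonzero it remains so at nearby dilated points, so `U` vanishes at all of them
(`tendsto_thinTerm_div`). Thus the energy has derivative `2 ∫ S ZU` (`hasDerivAt_dilEnergy`) and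
equals `∫ S U`.

Substituting these and completing the square gives an exact identity (`hasDerivAt_weiss`): `𝒲'` is
`r^(-2κ-3)` times `∫ (ZU - κU + |t|F)² - ∫ (|t|F)²`. The growth of `F` and scaling bound the last
integral by `K r^(2ℓ+2)` (`exists_setIntegral_sq_le`), and `κ ≤ ℓ - 1 + σ` turns this into the error
`r^(1-2σ)`.

The difference quotients are controlled by dominated convergence. A bounded weak time derivative
makes `U` Lipschitz in time (`lipschitz_time_of_weak`), hence Lipschitz along dilations up to the
thin set (`exists_dil_lipschitz`) and differentiable along them almost everywhere
(`ae_hasDerivAt_dil`). -/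

instance instIsAddHaarMeasureSpace (n : ℕ) :
    Measure.IsAddHaarMeasure (volume : Measure (EuclideanSpace ℝ (Fin n) × ℝ)) :=
  inferInstanceAs (Measure.IsAddHaarMeasure
    ((volume : Measure (EuclideanSpace ℝ (Fin n))).prod (volume : Measure ℝ)))

instance instIsAddHaarMeasureSpaceTime (n : ℕ) :
    Measure.IsAddHaarMeasure (volume : Measure (SpaceTime n)) :=
  inferInstanceAs (Measure.IsAddHaarMeasure
    ((volume : Measure (EuclideanSpace ℝ (Fin n) × ℝ)).prod (volume : Measure ℝ)))

/-- The affine map `((x, y), t) ↦ ((α x, β y + δ), τ t)`. -/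
def aff {n : ℕ} (α β δ τ : ℝ) (p : SpaceTime n) : SpaceTime n :=
  ((α • p.1.1, β * p.1.2 + δ), τ * p.2)

theorem continuous_aff {n : ℕ} (α β δ τ : ℝ) : Continuous (aff (n := n) α β δ τ) := by
  unfold aff; fun_prop

/-- `aff` as a homeomorphism. -/
noncomputable def affHomeo {n : ℕ} {α β τ : ℝ} (δ : ℝ) (hα : α ≠ 0) (hβ : β ≠ 0) (hτ : τ ≠ 0) :
    SpaceTime n ≃ₜ SpaceTime n where
  toFun := aff α β δ τ
  invFun := aff α⁻¹ β⁻¹ (-β⁻¹ * δ) τ⁻¹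
  left_inv p := by
    refine Prod.ext (Prod.ext ?_ ?_) ?_ <;> simp [aff, smul_smul, hα, hτ]
    field_simp; ring
  right_inv p := by
    refine Prod.ext (Prod.ext ?_ ?_) ?_ <;> simp [aff, smul_smul, hα, hτ]
    field_simp; ring
  continuous_toFun := continuous_aff _ _ _ _
  continuous_invFun := continuous_aff _ _ _ _

theorem measurableEmbedding_aff {n : ℕ} {α β τ : ℝ} (δ : ℝ) (hα : α ≠ 0) (hβ : β ≠ 0)
    (hτ : τ ≠ 0) : MeasurableEmbedding (aff (n := n) α β δ τ) :=
  (affHomeo δ hα hβ hτ).measurableEmbedding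

theorem map_aff_volume {n : ℕ} {α β τ : ℝ} (δ : ℝ) (hα : 0 < α) (hβ : 0 < β) (hτ : 0 < τ) :
    Measure.map (aff (n := n) α β δ τ) volume
      = ENNReal.ofReal ((α ^ n * β * τ)⁻¹) • volume := by
  have hx : Measure.map (fun x : EuclideanSpace ℝ (Fin n) => α • x) volume
      = ENNReal.ofReal ((α ^ n)⁻¹) • volume := by
    rw [Measure.map_addHaar_smul _ hα.ne', finrank_euclideanSpace_fin, abs_of_pos (by positivity)]
  have hy : Measure.map (fun y : ℝ => β * y + δ) volume = ENNReal.ofReal β⁻¹ • volume := by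
    have : (fun y : ℝ => β * y + δ) = (fun y => y + δ) ∘ (fun y => β * y) := rfl
    rw [this, ← Measure.map_map (by fun_prop) (by fun_prop), Real.map_volume_mul_left hβ.ne',
      Measure.map_smul, map_add_right_eq_self, abs_of_pos (by positivity)]
  have ht : Measure.map (fun t : ℝ => τ * t) volume = ENNReal.ofReal τ⁻¹ • volume := by
    rw [Real.map_volume_mul_left hτ.ne', abs_of_pos (by positivity)]
  have hX : Measure.map (Prod.map (fun x : EuclideanSpace ℝ (Fin n) => α • x)
      (fun y : ℝ => β * y + δ)) volume = ENNReal.ofReal ((α ^ n * β)⁻¹) • volume := by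
    rw [Measure.volume_eq_prod, ← Measure.map_prod_map _ _ (by fun_prop) (by fun_prop), hx, hy,
      Measure.prod_smul_left, Measure.prod_smul_right, smul_smul,
      ← ENNReal.ofReal_mul (by positivity), mul_inv]
  have : aff (n := n) α β δ τ = Prod.map (Prod.map (fun x : EuclideanSpace ℝ (Fin n) => α • x)
      (fun y : ℝ => β * y + δ)) (fun t : ℝ => τ * t) := rfl
  rw [this, Measure.volume_eq_prod, ← Measure.map_prod_map _ _ (by fun_prop) (by fun_prop), hX, ht,
      Measure.prod_smul_left, Measure.prod_smul_right, smul_smul,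
      ← ENNReal.ofReal_mul (by positivity), mul_inv (α ^ n * β) τ]

theorem integral_comp_aff {n : ℕ} {α β τ : ℝ} (δ : ℝ) (hα : 0 < α) (hβ : 0 < β) (hτ : 0 < τ)
    (f : SpaceTime n → ℝ) :
    ∫ p, f p = (α ^ n * β * τ) * ∫ p, f (aff α β δ τ p) := by
  rw [← (measurableEmbedding_aff δ hα.ne' hβ.ne' hτ.ne').integral_map f, map_aff_volume δ hα hβ hτ,
    integral_smul_measure, ENNReal.toReal_ofReal (by positivity), smul_eq_mul, ← mul_assoc,
    mul_inv_cancel₀ (by positivity), one_mul]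

theorem quasiMeasurePreserving_aff {n : ℕ} {α β τ : ℝ} (δ : ℝ) (hα : 0 < α) (hβ : 0 < β)
    (hτ : 0 < τ) : Measure.QuasiMeasurePreserving (aff (n := n) α β δ τ) volume volume := by
  refine ⟨(continuous_aff _ _ _ _).measurable, ?_⟩
  rw [map_aff_volume δ hα hβ hτ]
  exact Measure.smul_absolutelyContinuous

/-- The parabolic dilation. -/
def dil {n : ℕ} (l : ℝ) : SpaceTime n → SpaceTime n := aff l l 0 (l ^ 2)

theorem dil_apply {n : ℕ} (l : ℝ) (p : SpaceTime n) :
    dil l p = ((l • p.1.1, l * p.1.2), l ^ 2 * p.2) := by simp [dil, aff]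

theorem continuous_dil {n : ℕ} (l : ℝ) : Continuous (dil (n := n) l) := continuous_aff _ _ _ _

theorem dil_inv_dil {n : ℕ} {l : ℝ} (hl : 0 < l) (p : SpaceTime n) : dil l⁻¹ (dil l p) = p := by
  simp only [dil_apply, smul_smul]
  refine Prod.ext (Prod.ext ?_ ?_) ?_ <;> simp <;> field_simp; simp

theorem measurableSet_strip (n : ℕ) (r : ℝ) : MeasurableSet (strip n r) := by
  unfold strip; measurability

theorem dil_mem_strip {n : ℕ} {l r : ℝ} (hl : 0 < l) {p : SpaceTime n} :
    dil l p ∈ strip n (l * r) ↔ p ∈ strip n r := by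
  have h2 : 0 < l ^ 2 := by positivity
  simp only [strip, dil_apply, mem_ofPred_eq]
  rw [mul_pow]
  constructor
  · rintro ⟨h1, h3, h4⟩
    exact ⟨pos_of_mul_pos_right h1 hl.le, by nlinarith, by nlinarith⟩
  · rintro ⟨h1, h3, h4⟩
    exact ⟨by positivity, by nlinarith, by nlinarith⟩

theorem normSqX_dil {n : ℕ} (l : ℝ) (p : SpaceTime n) :
    normSqX (dil l p).1 = l ^ 2 * normSqX p.1 := by
  simp only [normSqX, dil_apply, norm_smul, Real.norm_eq_abs, mul_pow, sq_abs]; ring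

/-- The exponent is the parabolic homogeneous dimension: `n` from `x`, one from `y` and two from
`t`. -/
theorem setIntegral_strip_dil {n : ℕ} {l : ℝ} (hl : 0 < l) (r : ℝ) (f : SpaceTime n → ℝ) :
    ∫ p in strip n (l * r), f p = l ^ (n + 3) * ∫ p in strip n r, f (dil l p) := by
  rw [← integral_indicator (measurableSet_strip _ _), ← integral_indicator (measurableSet_strip _ _),
    integral_comp_aff 0 hl hl (pow_pos hl 2)]
  congr 1
  · ring
  · congr 1; ext p
    change indicator _ _ (dil l p) = _
    by_cases h : p ∈ strip n r
    · rw [indicator_of_mem h, indicator_of_mem ((dil_mem_strip hl).2 h)]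
    · rw [indicator_of_notMem h, indicator_of_notMem (fun h' => h ((dil_mem_strip hl).1 h'))]

/-! ### Gaussian weights -/

/-- The density `𝒢̄_a y^a`. -/
noncomputable def weight {n : ℕ} (a : ℝ) (p : SpaceTime n) : ℝ := gaussian a p * p.1.2 ^ a

/-- The constant of the Gaussian. -/
noncomputable def gaussConst (n : ℕ) (a : ℝ) : ℝ :=
  (4 * Real.pi) ^ (-(n : ℝ) / 2) / (2 ^ a * Real.Gamma ((a + 1) / 2))

theorem gaussConst_pos (n : ℕ) {a : ℝ} (ha : -1 < a) : 0 < gaussConst n a := by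
  have := Real.Gamma_pos_of_pos (s := (a + 1) / 2) (by linarith)
  unfold gaussConst; positivity

theorem gaussian_eq {n : ℕ} (a : ℝ) (p : SpaceTime n) :
    gaussian a p = gaussConst n a * |p.2| ^ (-((n : ℝ) + a + 1) / 2)
      * Real.exp (-(normSqX p.1) / (4 * |p.2|)) := rfl

theorem gaussian_nonneg {n : ℕ} {a : ℝ} (ha : -1 < a) (p : SpaceTime n) : 0 ≤ gaussian a p := by
  have := gaussConst_pos n ha
  rw [gaussian_eq]; positivity

theorem weight_nonneg {n : ℕ} {a : ℝ} (ha : -1 < a) {p : SpaceTime n} (hp : 0 < p.1.2) :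
    0 ≤ weight a p := by
  have := gaussian_nonneg ha p
  unfold weight; positivity

/-- Gaussian profile with power weights in `t` and `y`. -/
noncomputable def profile {n : ℕ} (m e b : ℝ) (p : SpaceTime n) : ℝ :=
  |p.2| ^ m * p.1.2 ^ e * Real.exp (-(b * normSqX p.1) / |p.2|)

theorem measurable_profile {n : ℕ} (m e b : ℝ) : Measurable (profile (n := n) m e b) := by
  unfold profile normSqX; fun_prop

theorem weight_eq_profile {n : ℕ} (a : ℝ) (p : SpaceTime n) :
    weight a p = gaussConst n a * profile (-((n : ℝ) + a + 1) / 2) a (1 / 4) p := by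
  unfold weight profile; rw [gaussian_eq]
  have : -(normSqX p.1) / (4 * |p.2|) = -(1 / 4 * normSqX p.1) / |p.2| := by
    rw [div_mul_eq_div_div]; ring
  rw [this]; ring

theorem measurable_weight {n : ℕ} (a : ℝ) : Measurable (weight (n := n) a) := by
  have : weight (n := n) a = fun p => gaussConst n a * profile (-((n : ℝ) + a + 1) / 2) a (1 / 4) p :=
    funext (weight_eq_profile a)
  rw [this]; exact (measurable_profile _ _ _).const_mul _

/-- Fubini with time outermost. At fixed `t` the Gaussian integral in `x` contributes `|t|^(n/2)`
and the one in `y` contributes `|t|^((e+1)/2)`, so the condition `hm` is exactly integrability at `t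
= 0` of the remaining power of `|t|`. -/
theorem integrableOn_profile {n : ℕ} {m e b : ℝ} (he : -1 < e) (hb : 0 < b)
    (hm : -1 < m + (n + e + 1) / 2) (r : ℝ) :
    IntegrableOn (profile (n := n) m e b) (strip n r) := by
  have hset : strip n r = ((univ : Set (EuclideanSpace ℝ (Fin n))) ×ˢ Ioi (0 : ℝ)) ×ˢ
      Ioc (-r ^ 2) 0 := by
    ext p; simp [strip]
  have hae : strip n r =ᵐ[volume] ((univ : Set (EuclideanSpace ℝ (Fin n))) ×ˢ Ioi (0 : ℝ)) ×ˢ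
      Ioo (-r ^ 2) 0 := by
    rw [hset, Measure.volume_eq_prod]
    exact Measure.set_prod_ae_eq (ae_eq_refl _) Ioo_ae_eq_Ioc.symm
  rw [integrableOn_congr_set_ae hae, IntegrableOn, Measure.volume_eq_prod, ← Measure.prod_restrict,
    Measure.volume_eq_prod, ← Measure.prod_restrict, Measure.restrict_univ]
  rw [integrable_prod_iff' (measurable_profile _ _ _).aestronglyMeasurable]
  have hx : ∀ s : ℝ, 0 < s → Integrable (fun x : EuclideanSpace ℝ (Fin n) =>
      Real.exp (-(b / s) * ‖x‖ ^ 2)) := by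
    intro s hs
    have h := (GaussianFourier.integrable_cexp_neg_mul_sq_norm_add (V := EuclideanSpace ℝ (Fin n))
      (b := ((b / s : ℝ) : ℂ)) (by simpa using by positivity) 0 0).norm
    refine h.congr (ae_of_all _ fun x => ?_)
    simp only [Complex.norm_exp]
    congr 1
    simp [← Complex.ofReal_pow,]
  have hy : ∀ s : ℝ, 0 < s → IntegrableOn (fun y : ℝ =>
      y ^ e * Real.exp (-(b / s) * y ^ (2 : ℝ))) (Ioi 0) := fun s hs =>
    integrableOn_rpow_mul_exp_neg_mul_rpow he (by norm_num) (by positivity)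
  have hprof : ∀ (X : EuclideanSpace ℝ (Fin n) × ℝ) (t : ℝ),
      profile m e b (X, t) = |t| ^ m * (Real.exp (-(b / |t|) * ‖X.1‖ ^ 2) *
        (X.2 ^ e * Real.exp (-(b / |t|) * X.2 ^ (2 : ℝ)))) := by
    intro X t
    simp only [profile, normSqX]
    rw [mul_left_comm (Real.exp _), ← Real.exp_add, ← mul_assoc, Real.rpow_two]
    congr 2; ring
  constructor
  · filter_upwards [ae_restrict_mem measurableSet_Ioo] with t ht
    have ht : 0 < |t| := abs_pos.2 ht.2.ne
    simp only [hprof]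
    exact ((hx _ ht).mul_prod (hy _ ht)).const_mul _
  · have hint : ∀ t ∈ Ioo (-r ^ 2) 0, ∫ X, ‖profile (n := n) m e b (X, t)‖
        ∂((volume : Measure (EuclideanSpace ℝ (Fin n))).prod (volume.restrict (Ioi 0)))
        = ((Real.pi / b) ^ ((n : ℝ) / 2) * (b ^ (-(e + 1) / 2) * (1 / 2) * Real.Gamma ((e + 1) / 2)))
          * (-t) ^ (m + (n + e + 1) / 2) := by
      intro t ht
      have ht' : |t| = -t := abs_of_neg ht.2
      have ht0 : 0 < -t := by linarith [ht.2]
      have : ∀ᵐ X ∂((volume : Measure (EuclideanSpace ℝ (Fin n))).prod (volume.restrict (Ioi 0))),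
          ‖profile (n := n) m e b (X, t)‖ = profile (n := n) m e b (X, t) := by
        have hpos : ∀ᵐ X ∂((volume : Measure (EuclideanSpace ℝ (Fin n))).prod
            ((volume : Measure ℝ).restrict (Ioi 0))), 0 < X.2 :=
          Measure.quasiMeasurePreserving_snd.ae (ae_restrict_mem measurableSet_Ioi)
        filter_upwards [hpos] with X hX
        refine Real.norm_of_nonneg ?_
        unfold profile; positivity
      rw [integral_congr_ae this]
      simp only [hprof]
      rw [integral_const_mul, integral_prod_mul
        (fun x : EuclideanSpace ℝ (Fin n) => Real.exp (-(b / |t|) * ‖x‖ ^ 2))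
        (fun y : ℝ => y ^ e * Real.exp (-(b / |t|) * y ^ (2 : ℝ))), ht',
        GaussianFourier.integral_rexp_neg_mul_sq_norm (by positivity), finrank_euclideanSpace_fin,
        integral_rpow_mul_exp_neg_mul_rpow (by norm_num) he (by positivity)]
      have h1 : Real.pi / (b / -t) = (Real.pi / b) * (-t) := by field_simp
      rw [h1, Real.mul_rpow (by positivity) ht0.le, Real.div_rpow hb.le ht0.le,
        Real.rpow_add ht0]
      have h2 : (-t) ^ (-(e + 1) / 2) = ((-t) ^ ((e + 1) / 2))⁻¹ := by
        rw [neg_div, Real.rpow_neg ht0.le]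
      have h3 : (-t) ^ (((n : ℝ) + e + 1) / 2)
          = (-t) ^ ((n : ℝ) / 2) * (-t) ^ ((e + 1) / 2) := by
        rw [← Real.rpow_add ht0]; congr 1; ring
      rw [h2, h3]
      field_simp
    have hbase : IntegrableOn (fun t : ℝ => (-t) ^ (m + (n + e + 1) / 2)) (Ioo (-r ^ 2) 0) := by
      have h := (intervalIntegral.intervalIntegrable_rpow' (a := 0) (b := r ^ 2) hm)
      have h' := (IntervalIntegrable.iff_comp_neg (by simp)).1 h
      rw [neg_zero] at h'
      have h'' := h'.symm
      rw [intervalIntegrable_iff_integrableOn_Ioo_of_le (by nlinarith [sq_nonneg r])] at h''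
      exact h''
    exact (integrableOn_congr_fun hint measurableSet_Ioo).2 (hbase.const_mul _)

theorem integrableOn_weight {n : ℕ} {a : ℝ} (ha : -1 < a) (r : ℝ) :
    IntegrableOn (weight (n := n) a) (strip n r) := by
  have : weight (n := n) a = fun p => gaussConst n a * profile (-((n : ℝ) + a + 1) / 2) a (1 / 4) p :=
    funext (weight_eq_profile a)
  rw [this]
  exact (integrableOn_profile ha (by norm_num) (by ring_nf; norm_num) r).const_mul _

theorem profile_dil {n : ℕ} (m e b : ℝ) {l : ℝ} (hl : 0 < l) {p : SpaceTime n} (hp : 0 < p.1.2) :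
    profile m e b (dil l p) = l ^ (2 * m + e) * profile m e b p := by
  unfold profile
  rw [normSqX_dil]
  simp only [dil_apply]
  rw [abs_mul, abs_of_pos (pow_pos hl 2), Real.mul_rpow (by positivity) (by positivity),
    Real.mul_rpow hl.le hp.le, ← Real.rpow_natCast, ← Real.rpow_mul hl.le, Real.rpow_add hl]
  have : -(b * (l ^ ((2 : ℕ) : ℝ) * normSqX p.1)) / (l ^ ((2 : ℕ) : ℝ) * |p.2|)
      = -(b * normSqX p.1) / |p.2| := by
    have : l ^ ((2 : ℕ) : ℝ) ≠ 0 := by positivity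
    rw [mul_left_comm, ← mul_neg, mul_div_mul_left _ _ this]
  rw [this]; push_cast; ring

/-- The powers of `a` coming from `𝒢̄_a` and from `y^a` cancel, so the weight is homogeneous of
degree `-(n + 1)`. Against the Jacobian `l^(n+3)` this leaves the factor `l²`, which is what the
normalization `1 / r²` of height and energy compensates. -/
theorem weight_dil {n : ℕ} (a : ℝ) {l : ℝ} (hl : 0 < l) {p : SpaceTime n} (hp : 0 < p.1.2) :
    l ^ (n + 1) * weight a (dil l p) = weight a p := by
  rw [weight_eq_profile, weight_eq_profile, profile_dil _ _ _ hl hp]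
  have : l ^ (2 * (-((n : ℝ) + a + 1) / 2) + a) = (l ^ (n + 1))⁻¹ := by
    rw [← Real.rpow_natCast, ← Real.rpow_neg hl.le]; congr 1; push_cast; ring
  rw [this]; field_simp

theorem setIntegral_weight_dil {n : ℕ} (a : ℝ) {l : ℝ} (hl : 0 < l) (r : ℝ) (f : SpaceTime n → ℝ) :
    ∫ p in strip n (l * r), f p * weight a p
      = l ^ 2 * ∫ p in strip n r, f (dil l p) * weight a p := by
  rw [setIntegral_strip_dil hl, ← integral_const_mul, ← integral_const_mul]
  refine setIntegral_congr_fun (measurableSet_strip _ _) fun p hp => ?_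
  rw [← weight_dil a hl hp.1]; ring

theorem setIntegral_profile {n : ℕ} (m e b : ℝ) {r : ℝ} (hr : 0 < r) :
    ∫ p in strip n r, profile m e b p
      = r ^ (2 * m + e + n + 3) * ∫ p in strip n 1, profile m e b p := by
  have h := setIntegral_strip_dil hr 1 (profile (n := n) m e b)
  rw [mul_one] at h
  rw [h, ← integral_const_mul, ← integral_const_mul]
  refine setIntegral_congr_fun (measurableSet_strip _ _) fun p hp => ?_
  rw [profile_dil _ _ _ hr hp.1, ← mul_assoc, ← Real.rpow_natCast, ← Real.rpow_add hr]
  congr 2; push_cast; ring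

/-! ### Partial derivatives along coordinate subspaces and mollification -/

/-- The inclusion of the `x`-space in space-time. -/
noncomputable def inclx (n : ℕ) : EuclideanSpace ℝ (Fin n) →L[ℝ] SpaceTime n :=
  (ContinuousLinearMap.inl ℝ _ ℝ).comp (ContinuousLinearMap.inl ℝ _ ℝ)

/-- The inclusion of the `y`-axis in space-time. -/
noncomputable def incly (n : ℕ) : ℝ →L[ℝ] SpaceTime n :=
  (ContinuousLinearMap.inl ℝ _ ℝ).comp (ContinuousLinearMap.inr ℝ _ ℝ)

@[simp] theorem inclx_apply {n : ℕ} (v : EuclideanSpace ℝ (Fin n)) : inclx n v = ((v, 0), 0) := rfl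
@[simp] theorem incly_apply {n : ℕ} (v : ℝ) : incly n v = ((0, v), 0) := rfl

/-- A derivative along translations `p + ι v` is the form that commutes with convolution. It treats
the `x` and `y` directions by one argument and then returns to `gradx` and `dy`. -/
theorem hasFDerivAt_inclx_iff {n : ℕ} {f : SpaceTime n → ℝ} {p : SpaceTime n}
    {v : EuclideanSpace ℝ (Fin n)} :
    HasFDerivAt (fun x => f (p + inclx n x)) (InnerProductSpace.toDual ℝ _ v) 0 ↔
      HasGradientAt (fun x => f ((x, p.1.2), p.2)) v p.1.1 := by
  rw [hasGradientAt_iff_hasFDerivAt]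
  have : (fun x => f (p + inclx n x)) = fun x => (fun x => f ((x, p.1.2), p.2)) (p.1.1 + x) := by
    ext x; congr 1; refine Prod.ext (Prod.ext ?_ ?_) ?_ <;> simp
  rw [this, hasFDerivAt_comp_add_left (f := fun x => f ((x, p.1.2), p.2)), add_zero]

theorem hasFDerivAt_incly_iff {n : ℕ} {f : SpaceTime n → ℝ} {p : SpaceTime n} {v : ℝ} :
    HasFDerivAt (fun x => f (p + incly n x)) (InnerProductSpace.toDual ℝ _ v) 0 ↔
      HasDerivAt (fun y => f ((p.1.1, y), p.2)) v p.1.2 := by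
  have hg : HasDerivAt (fun y => f ((p.1.1, y), p.2)) v p.1.2 ↔
      HasGradientAt (fun y => f ((p.1.1, y), p.2)) v p.1.2 :=
    ⟨fun h => by simpa using h.hasGradientAt, fun h => by simpa using h.hasDerivAt⟩
  rw [hg, hasGradientAt_iff_hasFDerivAt]
  have : (fun x => f (p + incly n x)) = fun x => (fun y => f ((p.1.1, y), p.2)) (p.1.2 + x) := by
    ext x; congr 1; refine Prod.ext (Prod.ext ?_ ?_) ?_ <;> simp
  rw [this, hasFDerivAt_comp_add_left (f := fun y => f ((p.1.1, y), p.2)), add_zero]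

instance instIsNegInvariantSpaceTime (n : ℕ) :
    Measure.IsNegInvariant (volume : Measure (SpaceTime n)) := by
  refine ⟨?_⟩
  have h := Measure.map_addHaar_smul (volume : Measure (SpaceTime n)) (r := -1) (by norm_num)
  simp only [neg_smul, one_smul, abs_inv, abs_pow, abs_neg, abs_one, one_pow, inv_one,
    ENNReal.ofReal_one] at h
  exact h

/-- Mollification of `f` by the normalized bump `b`. -/
noncomputable def mollify {n : ℕ} {V : Type*} [NormedAddCommGroup V] [NormedSpace ℝ V]
    (b : ContDiffBump (0 : SpaceTime n)) (f : SpaceTime n → V) : SpaceTime n → V :=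
  convolution (b.normed volume) f (ContinuousLinearMap.lsmul ℝ ℝ) volume

section
variable {n : ℕ} {V : Type*} [NormedAddCommGroup V] [NormedSpace ℝ V]

theorem mollify_apply (b : ContDiffBump (0 : SpaceTime n)) (f : SpaceTime n → V)
    (p : SpaceTime n) : mollify b f p = ∫ q, b.normed volume q • f (p - q) := rfl

theorem norm_mollify_le (b : ContDiffBump (0 : SpaceTime n)) {f : SpaceTime n → V} {C : ℝ}
    (hC : ∀ q, ‖f q‖ ≤ C) (p : SpaceTime n) : ‖mollify b f p‖ ≤ C := by
  rw [mollify_apply]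
  calc ‖∫ q, b.normed volume q • f (p - q)‖ ≤ ∫ q, b.normed volume q * C := by
        refine norm_integral_le_of_norm_le (b.integrable_normed.mul_const C) (ae_of_all _ fun q => ?_)
        rw [norm_smul, Real.norm_of_nonneg (b.nonneg_normed q)]
        exact mul_le_mul_of_nonneg_left (hC _) (b.nonneg_normed q)
    _ = C := by rw [integral_mul_const, b.integral_normed, one_mul]

theorem mollify_eq_zero (b : ContDiffBump (0 : SpaceTime n)) {f : SpaceTime n → V}
    {S : Set (SpaceTime n)} (hf : ∀ q ∉ S, f q = 0) {δ : ℝ} (hb : b.rOut ≤ δ) {p : SpaceTime n}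
    (hp : p ∉ Metric.cthickening δ S) : mollify b f p = 0 := by
  rw [mollify_apply]
  refine integral_eq_zero_of_ae (ae_of_all _ fun q => ?_)
  by_cases hq : p - q ∈ S
  · have : q ∉ Metric.ball (0 : SpaceTime n) b.rOut := by
      intro h
      apply hp
      refine Metric.mem_cthickening_of_dist_le p (p - q) δ S hq ?_
      have h' : ‖q‖ < b.rOut := by simpa using h
      rw [dist_eq_norm]; simp only [sub_sub_cancel]; linarith
    have h0 : b.normed volume q = 0 := by
      rw [← b.support_normed_eq (μ := volume)] at this
      simpa using this
    simp [h0]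
  · simp [hf _ hq]

theorem tendsto_mollify [CompleteSpace V] {b : ℕ → ContDiffBump (0 : SpaceTime n)}
    (hb : Tendsto (fun k => (b k).rOut) atTop (𝓝 0)) {f : SpaceTime n → V} (hf : Continuous f)
    (p : SpaceTime n) : Tendsto (fun k => mollify (b k) f p) atTop (𝓝 (f p)) :=
  ContDiffBump.convolution_tendsto_right_of_continuous hb hf p

theorem contDiff_mollify (b : ContDiffBump (0 : SpaceTime n)) {f : SpaceTime n → V}
    (hf : LocallyIntegrable f) : ContDiff ℝ ∞ (mollify b f) :=
  b.hasCompactSupport_normed.contDiff_convolution_left _ b.contDiff_normed hf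

/-- Differentiation under the integral with the derivative falling on `f`, along the range of `ι`
only. Nothing is required of `f` in the remaining directions, which matters because the test
functions used later need not be differentiable in time. -/
theorem hasFDerivAt_mollify {E : Type*} [NormedAddCommGroup E] [NormedSpace ℝ E]
    [CompleteSpace V] (ι : E →L[ℝ] SpaceTime n) (b : ContDiffBump (0 : SpaceTime n)) {f : SpaceTime n → V}
    {D : SpaceTime n → E →L[ℝ] V} (hf : Continuous f)
    (hD : Continuous D) (hDc : HasCompactSupport D)
    (h : ∀ p, HasFDerivAt (fun v => f (p + ι v)) (D p) 0) (p : SpaceTime n) :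
    HasFDerivAt (fun v => mollify b f (p + ι v)) (mollify b D p) 0 := by
  have : SecondCountableTopologyEither (SpaceTime n) (E →L[ℝ] V) :=
    secondCountableTopologyEither_of_left _ _
  obtain ⟨C, hC⟩ := hDc.exists_bound_of_continuous hD
  simp only [mollify_apply]
  have key := hasFDerivAt_integral_of_dominated_of_fderiv_le (𝕜 := ℝ) (μ := (volume : Measure (SpaceTime n)))
    (F := fun (v : E) q => b.normed volume q • f (p + ι v - q))
    (F' := fun v q => b.normed volume q • D (p + ι v - q)) (x₀ := 0) (s := univ)
    (bound := fun q => b.normed volume q * C) univ_mem ?_ ?_ ?_ ?_ ?_ ?_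
  · simpa using key
  · refine Eventually.of_forall fun v => ?_
    exact (b.continuous_normed.smul (by fun_prop)).aestronglyMeasurable
  · refine Continuous.integrable_of_hasCompactSupport (b.continuous_normed.smul (by fun_prop)) ?_
    exact b.hasCompactSupport_normed.smul_right
  · exact (b.continuous_normed.smul (by fun_prop)).aestronglyMeasurable
  · refine ae_of_all _ fun q v _ => ?_
    rw [norm_smul, Real.norm_of_nonneg (b.nonneg_normed q)]
    exact mul_le_mul_of_nonneg_left (hC _) (b.nonneg_normed q)
  · exact b.integrable_normed.mul_const C
  · refine ae_of_all _ fun q v _ => ?_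
    refine HasFDerivAt.const_smul ?_ _
    have h1 := h (p + ι v - q)
    have h2 : (fun w => f (p + ι v - q + ι w)) = fun w => (fun w => f (p + ι w - q)) (v + w) := by
      ext w; congr 1; rw [map_add]; abel
    rw [h2, hasFDerivAt_comp_add_left (f := fun w => f (p + ι w - q)), add_zero] at h1
    exact h1

end

theorem eq_zero_of_notMem_tsupport {n : ℕ} {E : Type*} [NormedAddCommGroup E] [NormedSpace ℝ E]
    (ι : E →L[ℝ] SpaceTime n) {f : SpaceTime n → ℝ} {D : E →L[ℝ] ℝ} {p : SpaceTime n}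
    (h : HasFDerivAt (fun v => f (p + ι v)) D 0) (hp : p ∉ tsupport f) : D = 0 := by
  have h1 : f =ᶠ[𝓝 p] 0 := notMem_tsupport_iff_eventuallyEq.1 hp
  have h2 : Tendsto (fun v => p + ι v) (𝓝 0) (𝓝 p) := by
    have : Continuous fun v => p + ι v := by fun_prop
    simpa using this.tendsto 0
  have h3 : (fun v => f (p + ι v)) =ᶠ[𝓝 0] fun _ => 0 := h2.eventually h1
  exact h.unique ((hasFDerivAt_const (0 : ℝ) (0 : E)).congr_of_eventuallyEq h3)

/-! ### The weak formulation for test functions of class `C¹` in space -/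

theorem isOpen_openStrip (n : ℕ) : IsOpen (openStrip n) := by
  have h1 : IsOpen {p : SpaceTime n | 0 < p.1.2} := isOpen_lt continuous_const (by fun_prop)
  have h2 : IsOpen {p : SpaceTime n | -1 < p.2} := isOpen_lt continuous_const (by fun_prop)
  have h3 : IsOpen {p : SpaceTime n | p.2 < 0} := isOpen_lt (by fun_prop) continuous_const
  exact h1.inter (h2.inter h3)

theorem openStrip_subset_strip (n : ℕ) : openStrip n ⊆ strip n 1 := fun p hp =>
  ⟨hp.1, by simpa using hp.2.1, hp.2.2.le⟩

theorem strip_subset_stripWithThin (n : ℕ) : strip n 1 ⊆ stripWithThin n := fun p hp =>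
  ⟨hp.1.le, by simpa using hp.2.1, hp.2.2⟩

theorem normSqX_nonneg {n : ℕ} (X : EuclideanSpace ℝ (Fin n) × ℝ) : 0 ≤ normSqX X := by
  unfold normSqX; positivity

theorem continuous_normSqX {n : ℕ} : Continuous (normSqX (n := n)) := by
  unfold normSqX; fun_prop

theorem ParHolder.continuousOn {n : ℕ} {V : Type*} [NormedAddCommGroup V] {α : ℝ} (hα : 0 < α)
    {f : SpaceTime n → V} (hf : ParHolder α f) : ContinuousOn f (strip n 1) := by
  obtain ⟨M, -, hM⟩ := hf
  intro p hp
  rw [ContinuousWithinAt, tendsto_iff_norm_sub_tendsto_zero]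
  have hcont : Continuous fun q : SpaceTime n =>
      M * (Real.sqrt (normSqX (q.1 - p.1)) ^ α + |q.2 - p.2| ^ (α / 2)) := by
    have h1 : Continuous fun q : SpaceTime n => Real.sqrt (normSqX (q.1 - p.1)) :=
      Real.continuous_sqrt.comp (continuous_normSqX.comp (by fun_prop))
    have h2 : Continuous fun q : SpaceTime n => |q.2 - p.2| := by fun_prop
    exact continuous_const.mul ((h1.rpow_const fun _ => Or.inr hα.le).add
      (h2.rpow_const fun _ => Or.inr (by positivity)))
  have h0 := hcont.tendsto p
  have hz : M * (Real.sqrt (normSqX (p.1 - p.1)) ^ α + |p.2 - p.2| ^ (α / 2)) = 0 := by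
    simp [normSqX, Real.zero_rpow hα.ne', Real.zero_rpow (show α / 2 ≠ 0 by positivity)]
  rw [hz] at h0
  refine squeeze_zero' (Eventually.of_forall fun _ => norm_nonneg _) ?_
    (h0.mono_left nhdsWithin_le_nhds)
  filter_upwards [self_mem_nhdsWithin] with q hq using hM q hq p hp

theorem continuousOn_rpow_y {n : ℕ} (a : ℝ) :
    ContinuousOn (fun p : SpaceTime n => p.1.2 ^ a) {p | 0 < p.1.2} := fun p hp =>
  ((by fun_prop : Continuous fun p : SpaceTime n => p.1.2).continuousAt.rpow_const
    (Or.inl (ne_of_gt hp))).continuousWithinAt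

/-- Integrability of functions supported in a set where they are integrable. -/
theorem integrableOn_of_eq_zero {n : ℕ} {f : SpaceTime n → ℝ} {K : Set (SpaceTime n)}
    (hf : IntegrableOn f K) (h0 : ∀ p ∉ K, f p = 0) (S : Set (SpaceTime n)) :
    IntegrableOn f S := by
  have : Integrable f := by
    rw [← integrableOn_iff_integrable_of_support_subset (s := K)]
    · exact hf
    · intro p hp
      by_contra h
      exact hp (h0 p h)
  exact this.integrableOn

section
variable {n : ℕ} {a : ℝ} {F U : SpaceTime n → ℝ}

theorem IsSolution.continuousOn_gradx (hU : IsSolution a F U) :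
    ContinuousOn (gradx U) (strip n 1) := by
  obtain ⟨α, h0, -, h, -⟩ := hU.holder
  exact h.continuousOn h0

theorem IsSolution.continuousOn_weightedDy (hU : IsSolution a F U) :
    ContinuousOn (weightedDy a U) (strip n 1) := by
  obtain ⟨α, h0, -, -, h⟩ := hU.holder
  exact h.continuousOn h0

theorem IsSolution.continuousOn_dy (hU : IsSolution a F U) : ContinuousOn (dy U) (strip n 1) := by
  have h : ContinuousOn (fun p : SpaceTime n => p.1.2 ^ (-a) * weightedDy a U p) (strip n 1) :=
    ((continuousOn_rpow_y (-a)).mono fun p hp => hp.1).mul hU.continuousOn_weightedDy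
  refine h.congr fun p hp => ?_
  have := hp.1
  simp only [weightedDy]
  rw [← mul_assoc, ← Real.rpow_add this]; simp

theorem IsSolution.hasGradientAt (hU : IsSolution a F U) {p : SpaceTime n} (hp : p ∈ strip n 1) :
    HasGradientAt (fun x => U ((x, p.1.2), p.2)) (gradx U p) p.1.1 :=
  (hU.differentiable_x p hp).hasGradientAt

theorem IsSolution.hasDerivAt_y (hU : IsSolution a F U) {p : SpaceTime n} (hp : p ∈ strip n 1) :
    HasDerivAt (fun y => U ((p.1.1, y), p.2)) (dy U p) p.1.2 :=
  (hU.differentiable_y p hp).hasDerivAt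

theorem dt_eq_fderiv {φ : SpaceTime n → ℝ} (hφ : Differentiable ℝ φ) (p : SpaceTime n) :
    dt φ p = fderiv ℝ φ p (et n) := by
  have h : HasDerivAt (fun t : ℝ => ((p.1, t) : SpaceTime n)) (et n) p.2 := by
    have := (hasDerivAt_const p.2 p.1).prodMk (hasDerivAt_id p.2)
    exact this
  exact ((hφ p).hasFDerivAt.comp_hasDerivAt p.2 h).deriv

theorem hasFDerivAt_incl_of_differentiable {E : Type*} [NormedAddCommGroup E] [NormedSpace ℝ E]
    (ι : E →L[ℝ] SpaceTime n) {φ : SpaceTime n → ℝ} (hφ : Differentiable ℝ φ) (p : SpaceTime n) :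
    HasFDerivAt (fun v => φ (p + ι v)) ((fderiv ℝ φ p).comp ι) 0 := by
  have h : HasFDerivAt (fun v => p + ι v) ι 0 := ι.hasFDerivAt.const_add p
  have h2 : HasFDerivAt φ (fderiv ℝ φ p) (p + ι 0) := by simpa using (hφ p).hasFDerivAt
  exact h2.comp (0 : E) h

theorem toDual_gradx {φ : SpaceTime n → ℝ} (hφ : Differentiable ℝ φ) (p : SpaceTime n) :
    gradx φ p = (InnerProductSpace.toDual ℝ _).symm ((fderiv ℝ φ p).comp (inclx n)) := by
  have h := hasFDerivAt_incl_of_differentiable (inclx n) hφ p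
  rw [← (InnerProductSpace.toDual ℝ _).apply_symm_apply ((fderiv ℝ φ p).comp (inclx n)),
    hasFDerivAt_inclx_iff] at h
  exact h.gradient

theorem dy_eq_fderiv {φ : SpaceTime n → ℝ} (hφ : Differentiable ℝ φ) (p : SpaceTime n) :
    dy φ p = (InnerProductSpace.toDual ℝ _).symm ((fderiv ℝ φ p).comp (incly n)) := by
  have h := hasFDerivAt_incl_of_differentiable (incly n) hφ p
  rw [← (InnerProductSpace.toDual ℝ _).apply_symm_apply ((fderiv ℝ φ p).comp (incly n)),
    hasFDerivAt_incly_iff] at h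
  exact h.deriv

/-- Multiplication of a test function by `y^a` gives a test function. -/
theorem IsTest.rpow_mul (a : ℝ) {φ : SpaceTime n → ℝ} (hφ : IsTest φ) :
    IsTest (fun p => p.1.2 ^ a * φ p) := by
  obtain ⟨h1, h2, h3⟩ := hφ
  have hsub : tsupport (fun p : SpaceTime n => p.1.2 ^ a * φ p) ⊆ tsupport φ :=
    closure_mono (Function.support_mul_subset_right _ _)
  refine ⟨?_, h2.mul_left, hsub.trans h3⟩
  rw [contDiff_iff_contDiffAt]
  intro p
  by_cases hp : p ∈ tsupport φ
  · have hy : 0 < p.1.2 := (h3 hp).1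
    have hyc : ContDiffAt ℝ ∞ (fun p : SpaceTime n => p.1.2) p := by fun_prop
    exact (hyc.rpow_const_of_ne hy.ne').mul h1.contDiffAt
  · have : (fun p : SpaceTime n => p.1.2 ^ a * φ p) =ᶠ[𝓝 p] fun _ => 0 := by
      filter_upwards [notMem_tsupport_iff_eventuallyEq.1 hp] with q hq
      simp only [hq, Pi.zero_apply, mul_zero]
    exact contDiffAt_const.congr_of_eventuallyEq this

theorem dt_rpow_mul (a : ℝ) (φ : SpaceTime n → ℝ) (p : SpaceTime n) :
    dt (fun p => p.1.2 ^ a * φ p) p = p.1.2 ^ a * dt φ p := by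
  simp only [dt, deriv_const_mul_field]

theorem memLp_top_integrableOn {f : SpaceTime n → ℝ}
    (hf : MemLp f ⊤ (volume.restrict (strip n 1))) {K : Set (SpaceTime n)} (hK : IsCompact K)
    (hKs : K ⊆ strip n 1) : IntegrableOn f K := by
  have : IsFiniteMeasure ((volume : Measure (SpaceTime n)).restrict K) :=
    ⟨by rw [Measure.restrict_apply_univ]; exact hK.measure_lt_top⟩
  exact (hf.mono_measure (Measure.restrict_mono hKs le_rfl)).integrable le_top

/-- The zeroth order coefficient of the weak formulation. -/
theorem integrableOn_coeff (hU : IsSolution a F U) (hF : MemLp F ⊤ (volume.restrict (strip n 1)))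
    {K : Set (SpaceTime n)} (hK : IsCompact K) (hKs : K ⊆ openStrip n) :
    IntegrableOn (fun p => p.1.2 ^ a * (dt U p - F p)) K := by
  have hKs' := hKs.trans (openStrip_subset_strip n)
  have h : IntegrableOn (fun p => dt U p - F p) K :=
    (memLp_top_integrableOn hU.time_deriv.2 hK hKs').sub (memLp_top_integrableOn hF hK hKs')
  exact h.continuousOn_mul ((continuousOn_rpow_y a).mono fun p hp => (hKs hp).1) hK

/-- The time derivative is moved from the test function onto `U` by applying the definition of the
weak derivative to the test function `y^a φ`. The result involves `φ` and its spatial derivatives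
only, so it can be extended to test functions that are merely continuous in time. -/
theorem weak_form_test (hU : IsSolution a F U) (hF : MemLp F ⊤ (volume.restrict (strip n 1)))
    {φ : SpaceTime n → ℝ} (hφ : IsTest φ) :
    ∫ p in openStrip n, (p.1.2 ^ a * (dt U p - F p) * φ p +
      p.1.2 ^ a * inner ℝ (gradx U p) (gradx φ p) + weightedDy a U p * dy φ p) = 0 := by
  have hdiff : Differentiable ℝ φ := hφ.1.differentiable (by simp)
  have hfd : Continuous (fderiv ℝ φ) := hφ.1.continuous_fderiv (by simp)
  have hψ := hφ.rpow_mul a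
  have hψd : Differentiable ℝ _ := hψ.1.differentiable (by simp)
  have htime := hU.time_deriv.1.2.2 _ hψ
  have heq := hU.equation φ hφ
  set K := tsupport φ with hKdef
  have hK : IsCompact K := hφ.2.1
  have hKs : K ⊆ openStrip n := hφ.2.2
  have hKs1 := hKs.trans (openStrip_subset_strip n)
  have hφ0 : ∀ p ∉ K, φ p = 0 := fun p hp => image_eq_zero_of_notMem_tsupport hp
  have hgx0 : ∀ p ∉ K, gradx φ p = 0 := fun p hp => by
    have := eq_zero_of_notMem_tsupport _ (hasFDerivAt_incl_of_differentiable (inclx n) hdiff p) hp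
    rw [toDual_gradx hdiff, this, map_zero]
  have hgy0 : ∀ p ∉ K, dy φ p = 0 := fun p hp => by
    have := eq_zero_of_notMem_tsupport _ (hasFDerivAt_incl_of_differentiable (incly n) hdiff p) hp
    rw [dy_eq_fderiv hdiff, this, map_zero]
  have hdt0 : ∀ p ∉ K, dt φ p = 0 := fun p hp => by
    have h1 : fderiv ℝ φ p = 0 := by
      by_contra h
      exact hp (support_fderiv_subset ℝ h)
    rw [dt_eq_fderiv hdiff, h1]; rfl
  have hgxc : Continuous (gradx φ) := by
    rw [funext (toDual_gradx hdiff)]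
    exact (InnerProductSpace.toDual ℝ _).symm.continuous.comp (hfd.clm_comp continuous_const)
  have hgyc : Continuous (dy φ) := by
    rw [funext (dy_eq_fderiv hdiff)]
    exact (InnerProductSpace.toDual ℝ _).symm.continuous.comp (hfd.clm_comp continuous_const)
  have hdtc : Continuous (dt φ) := by
    rw [funext (dt_eq_fderiv hdiff)]
    exact hfd.clm_apply continuous_const
  have hyK : ContinuousOn (fun p : SpaceTime n => p.1.2 ^ a) K :=
    (continuousOn_rpow_y a).mono fun p hp => (hKs hp).1
  have i1 : IntegrableOn (fun p => p.1.2 ^ a * (U p * dt φ p)) (openStrip n) := by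
    refine integrableOn_of_eq_zero (K := K) ?_ (fun p hp => by simp [hdt0 p hp]) _
    exact (hyK.mul ((hU.continuousOn.mono (hKs1.trans (strip_subset_stripWithThin n))).mul
      hdtc.continuousOn)).integrableOn_compact hK
  have i2 : IntegrableOn (fun p => p.1.2 ^ a * inner ℝ (gradx U p) (gradx φ p)) (openStrip n) := by
    refine integrableOn_of_eq_zero (K := K) ?_ (fun p hp => by simp [hgx0 p hp]) _
    exact (hyK.mul ((hU.continuousOn_gradx.mono hKs1).inner hgxc.continuousOn)).integrableOn_compact hK
  have i3 : IntegrableOn (fun p => weightedDy a U p * dy φ p) (openStrip n) := by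
    refine integrableOn_of_eq_zero (K := K) ?_ (fun p hp => by simp [hgy0 p hp]) _
    exact ((hU.continuousOn_weightedDy.mono hKs1).mul hgyc.continuousOn).integrableOn_compact hK
  have i4 : IntegrableOn (fun p => p.1.2 ^ a * F p * φ p) (openStrip n) := by
    refine integrableOn_of_eq_zero (K := K) ?_ (fun p hp => by simp [hφ0 p hp]) _
    exact ((memLp_top_integrableOn hF hK hKs1).continuousOn_mul hyK hK).mul_continuousOn
      hφ.1.continuous.continuousOn hK
  have i5 : IntegrableOn (fun p => dt U p * (p.1.2 ^ a * φ p)) (openStrip n) := by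
    refine integrableOn_of_eq_zero (K := K) ?_ (fun p hp => by simp [hφ0 p hp]) _
    exact (memLp_top_integrableOn hU.time_deriv.2 hK hKs1).mul_continuousOn
      (hyK.mul hφ.1.continuous.continuousOn) hK
  have e1 : ∫ p in openStrip n, p.1.2 ^ a * (U p * dt φ p)
      = - ∫ p in openStrip n, dt U p * (p.1.2 ^ a * φ p) := by
    rw [← htime]
    refine integral_congr_ae (ae_of_all _ fun p => ?_)
    simp only
    rw [← dt_eq_fderiv hψd, dt_rpow_mul]; ring
  have e2 : ∫ p in openStrip n, p.1.2 ^ a *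
        (-(U p * dt φ p) + inner ℝ (gradx U p) (gradx φ p) + dy U p * dy φ p)
      = - (∫ p in openStrip n, p.1.2 ^ a * (U p * dt φ p))
        + (∫ p in openStrip n, p.1.2 ^ a * inner ℝ (gradx U p) (gradx φ p))
        + ∫ p in openStrip n, weightedDy a U p * dy φ p := by
    have h1 := integral_add (i1.neg.add i2) i3
    have h2 := integral_add i1.neg i2
    simp only [Pi.neg_apply, Pi.add_apply, integral_neg] at h1 h2
    rw [← h2, ← h1]
    refine integral_congr_ae (ae_of_all _ fun p => ?_)
    simp only [weightedDy]; ring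
  have e3 : ∫ p in openStrip n, (p.1.2 ^ a * (dt U p - F p) * φ p +
      p.1.2 ^ a * inner ℝ (gradx U p) (gradx φ p) + weightedDy a U p * dy φ p)
      = (∫ p in openStrip n, dt U p * (p.1.2 ^ a * φ p))
        - (∫ p in openStrip n, p.1.2 ^ a * F p * φ p)
        + (∫ p in openStrip n, p.1.2 ^ a * inner ℝ (gradx U p) (gradx φ p))
        + ∫ p in openStrip n, weightedDy a U p * dy φ p := by
    have h1 := integral_add ((i5.sub i4).add i2) i3
    have h2 := integral_add (i5.sub i4) i2
    simp only [Pi.sub_apply, Pi.add_apply] at h1 h2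
    rw [← integral_sub i5 i4, ← h2, ← h1]
    refine integral_congr_ae (ae_of_all _ fun p => ?_)
    ring
  rw [e3]; linarith

/-- A sequence of bumps at the origin with radii tending to zero. -/
noncomputable def bumpSeq (n : ℕ) (δ : ℝ) (hδ : 0 < δ) (k : ℕ) : ContDiffBump (0 : SpaceTime n) where
  rIn := δ / (k + 1) / 2
  rOut := δ / (k + 1)
  rIn_pos := by positivity
  rIn_lt_rOut := by
    have : 0 < δ / (k + 1) := by positivity
    linarith

theorem bumpSeq_rOut_le (n : ℕ) {δ : ℝ} (hδ : 0 < δ) (k : ℕ) : (bumpSeq n δ hδ k).rOut ≤ δ := by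
  refine div_le_self hδ.le ?_
  have : (0 : ℝ) ≤ k := by positivity
  linarith

theorem tendsto_bumpSeq_rOut (n : ℕ) {δ : ℝ} (hδ : 0 < δ) :
    Tendsto (fun k => (bumpSeq n δ hδ k).rOut) atTop (𝓝 0) :=
  tendsto_const_div_atTop_nhds_zero_nat δ |>.comp (tendsto_add_atTop_nat 1) |>.congr fun k => by
    simp [bumpSeq]

theorem exists_cthickening_subset_openStrip {K : Set (SpaceTime n)} (hK : IsCompact K)
    (hKs : K ⊆ openStrip n) : ∃ δ > 0, IsCompact (Metric.cthickening δ K) ∧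
      Metric.cthickening δ K ⊆ openStrip n := by
  obtain ⟨δ, h1, h2⟩ := hK.exists_cthickening_subset_open (isOpen_openStrip n) hKs
  exact ⟨δ, h1, hK.cthickening, h2⟩

/-- The weak formulation for continuous test functions with continuous first derivatives in `X`. -/
theorem weak_form (hU : IsSolution a F U) (hF : MemLp F ⊤ (volume.restrict (strip n 1)))
    {φ : SpaceTime n → ℝ} {gx : SpaceTime n → EuclideanSpace ℝ (Fin n)} {gy : SpaceTime n → ℝ}
    (hφ : Continuous φ) (hφc : HasCompactSupport φ) (hφs : tsupport φ ⊆ openStrip n)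
    (hgx : Continuous gx) (hgy : Continuous gy)
    (hdx : ∀ p, HasGradientAt (fun x => φ ((x, p.1.2), p.2)) (gx p) p.1.1)
    (hdy : ∀ p, HasDerivAt (fun y => φ ((p.1.1, y), p.2)) (gy p) p.1.2) :
    ∫ p in openStrip n, (p.1.2 ^ a * (dt U p - F p) * φ p +
      p.1.2 ^ a * inner ℝ (gradx U p) (gx p) + weightedDy a U p * gy p) = 0 := by
  set S := tsupport φ with hSdef
  -- Room for mollification: every mollification at scale at most `δ` stays supported in one fixed
  -- compact subset `K` of the open strip, where all coefficients are integrable.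
  obtain ⟨δ, hδ, hK, hKs⟩ := exists_cthickening_subset_openStrip hφc hφs
  set K := Metric.cthickening δ S with hKdef
  have hKs1 := hKs.trans (openStrip_subset_strip n)
  simp only [← hasFDerivAt_inclx_iff] at hdx
  simp only [← hasFDerivAt_incly_iff] at hdy
  have hφ0 : ∀ p ∉ S, φ p = 0 := fun p hp => image_eq_zero_of_notMem_tsupport hp
  have hgx0 : ∀ p ∉ S, gx p = 0 := fun p hp => by
    simpa using eq_zero_of_notMem_tsupport _ (hdx p) hp
  have hgy0 : ∀ p ∉ S, gy p = 0 := fun p hp => by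
    simpa using eq_zero_of_notMem_tsupport _ (hdy p) hp
  have hgxc : HasCompactSupport gx := HasCompactSupport.intro hφc hgx0
  have hgyc : HasCompactSupport gy := HasCompactSupport.intro hφc hgy0
  obtain ⟨C0, hC0⟩ := hφc.exists_bound_of_continuous hφ
  obtain ⟨C1, hC1⟩ := hgxc.exists_bound_of_continuous hgx
  obtain ⟨C2, hC2⟩ := hgyc.exists_bound_of_continuous hgy
  set b := bumpSeq n δ hδ with hb
  have hbt : Tendsto (fun k => (b k).rOut) atTop (𝓝 0) := tendsto_bumpSeq_rOut n hδ
  have m0 : ∀ k, ∀ p ∉ K, mollify (b k) φ p = 0 := fun k p hp =>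
    mollify_eq_zero (b k) hφ0 (bumpSeq_rOut_le n hδ k) hp
  have m1 : ∀ k, ∀ p ∉ K, mollify (b k) gx p = 0 := fun k p hp =>
    mollify_eq_zero (b k) hgx0 (bumpSeq_rOut_le n hδ k) hp
  have m2 : ∀ k, ∀ p ∉ K, mollify (b k) gy p = 0 := fun k p hp =>
    mollify_eq_zero (b k) hgy0 (bumpSeq_rOut_le n hδ k) hp
  have hsmooth : ∀ k, ContDiff ℝ ∞ (mollify (b k) φ) := fun k =>
    contDiff_mollify _ hφ.locallyIntegrable
  have htest : ∀ k, IsTest (mollify (b k) φ) := fun k => by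
    refine ⟨hsmooth k, HasCompactSupport.intro hK (m0 k), ?_⟩
    refine (closure_minimal (fun p hp => ?_) hK.isClosed).trans hKs
    by_contra h
    exact hp (m0 k p h)
  have hcomp : ∀ {E : Type} [NormedAddCommGroup E] [InnerProductSpace ℝ E] [CompleteSpace E]
      (k : ℕ) (g : SpaceTime n → E) (hg : Continuous g) (hgc : HasCompactSupport g) (p),
      mollify (b k) (fun q => InnerProductSpace.toDual ℝ E (g q)) p
        = InnerProductSpace.toDual ℝ E (mollify (b k) g p) := by
    intro E _ _ _ k g hg hgc p
    simp only [mollify_apply]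
    have hint : Integrable (fun q => (b k).normed volume q • g (p - q)) :=
      ((b k).continuous_normed.smul (by fun_prop)).integrable_of_hasCompactSupport
        (b k).hasCompactSupport_normed.smul_right
    have := (InnerProductSpace.toDual ℝ E).toContinuousLinearEquiv.toContinuousLinearMap.integral_comp_comm
      hint
    simpa using this
  have hgradx : ∀ k p, gradx (mollify (b k) φ) p = mollify (b k) gx p := by
    intro k p
    have h := hasFDerivAt_mollify (inclx n) (b k) hφ
      ((InnerProductSpace.toDual ℝ _).continuous.comp hgx)
      (HasCompactSupport.intro hφc fun p hp => by simp [hgx0 p hp]) hdx p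
    change HasFDerivAt _ (mollify (b k) (fun q => InnerProductSpace.toDual ℝ _ (gx q)) p) 0 at h
    rw [hcomp k gx hgx hgxc, hasFDerivAt_inclx_iff] at h
    exact h.gradient
  have hdy' : ∀ k p, dy (mollify (b k) φ) p = mollify (b k) gy p := by
    intro k p
    have h := hasFDerivAt_mollify (incly n) (b k) hφ
      ((InnerProductSpace.toDual ℝ _).continuous.comp hgy)
      (HasCompactSupport.intro hφc fun p hp => by simp [hgy0 p hp]) hdy p
    change HasFDerivAt _ (mollify (b k) (fun q => InnerProductSpace.toDual ℝ _ (gy q)) p) 0 at h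
    rw [hcomp k gy hgy hgyc, hasFDerivAt_incly_iff] at h
    exact h.deriv
  have hyK : ContinuousOn (fun p : SpaceTime n => p.1.2 ^ a) K :=
    (continuousOn_rpow_y a).mono fun p hp => (hKs hp).1
  have hcA := integrableOn_coeff hU hF hK hKs
  have hcP : IntegrableOn (fun p => p.1.2 ^ a * ‖gradx U p‖) K :=
    (hyK.mul (hU.continuousOn_gradx.mono hKs1).norm).integrableOn_compact hK
  have hcW : IntegrableOn (weightedDy a U) K :=
    (hU.continuousOn_weightedDy.mono hKs1).integrableOn_compact hK
  have hred : ∀ (f0 : SpaceTime n → ℝ) (f1 : SpaceTime n → EuclideanSpace ℝ (Fin n))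
      (f2 : SpaceTime n → ℝ), (∀ p ∉ K, f0 p = 0) → (∀ p ∉ K, f1 p = 0) → (∀ p ∉ K, f2 p = 0) →
      ∫ p in openStrip n, (p.1.2 ^ a * (dt U p - F p) * f0 p +
        p.1.2 ^ a * inner ℝ (gradx U p) (f1 p) + weightedDy a U p * f2 p)
      = ∫ p in K, (p.1.2 ^ a * (dt U p - F p) * f0 p +
        p.1.2 ^ a * inner ℝ (gradx U p) (f1 p) + weightedDy a U p * f2 p) := by
    intro f0 f1 f2 h0 h1 h2
    refine (setIntegral_eq_of_subset_of_forall_sdiff_eq_zero (isOpen_openStrip n).measurableSet hKs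
      fun p hp => ?_)
    simp [h0 p hp.2, h1 p hp.2, h2 p hp.2]
  have hSK : S ⊆ K := Metric.self_subset_cthickening S
  rw [hred φ gx gy (fun p hp => hφ0 p fun h => hp (hSK h)) (fun p hp => hgx0 p fun h => hp (hSK h))
    (fun p hp => hgy0 p fun h => hp (hSK h))]
  have hzero : ∀ k, ∫ p in K, (p.1.2 ^ a * (dt U p - F p) * mollify (b k) φ p +
        p.1.2 ^ a * inner ℝ (gradx U p) (mollify (b k) gx p)
          + weightedDy a U p * mollify (b k) gy p) = 0 := by
    intro k
    rw [← hred _ _ _ (m0 k) (m1 k) (m2 k)]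
    have := weak_form_test hU hF (htest k)
    simpa only [hgradx, hdy'] using this
  have hmc : ∀ {E : Type} [NormedAddCommGroup E] [NormedSpace ℝ E]
      (k : ℕ) (g : SpaceTime n → E) (_ : Continuous g), Continuous (mollify (b k) g) :=
    fun k g hg => (contDiff_mollify _ hg.locallyIntegrable).continuous
  -- Mollification does not increase sup norms, so `C0`, `C1`, `C2` dominate all approximants, while
  -- continuity of the test function and its spatial derivatives gives pointwise convergence.
  have hlim := tendsto_integral_of_dominated_convergence (μ := volume.restrict K)
    (F := fun k p => p.1.2 ^ a * (dt U p - F p) * mollify (b k) φ p +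
        p.1.2 ^ a * inner ℝ (gradx U p) (mollify (b k) gx p)
          + weightedDy a U p * mollify (b k) gy p)
    (f := fun p => p.1.2 ^ a * (dt U p - F p) * φ p +
        p.1.2 ^ a * inner ℝ (gradx U p) (gx p) + weightedDy a U p * gy p)
    (fun p => |p.1.2 ^ a * (dt U p - F p)| * C0 + p.1.2 ^ a * ‖gradx U p‖ * C1
      + |weightedDy a U p| * C2) ?_ ?_ ?_ ?_
  · simp only [hzero] at hlim
    exact (tendsto_nhds_unique hlim tendsto_const_nhds)
  · intro k
    have h1 := hcA.aestronglyMeasurable.mul (hmc k φ hφ).aestronglyMeasurable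
    have h2 : AEStronglyMeasurable (fun p => p.1.2 ^ a * inner ℝ (gradx U p) (mollify (b k) gx p))
        (volume.restrict K) :=
      (hyK.mul ((hU.continuousOn_gradx.mono hKs1).inner
        (hmc k gx hgx).continuousOn)).aestronglyMeasurable hK.measurableSet
    have h3 := hcW.aestronglyMeasurable.mul (hmc k gy hgy).aestronglyMeasurable
    exact (h1.add h2).add h3
  · exact ((hcA.norm.mul_const C0).add (hcP.mul_const C1)).add (hcW.norm.mul_const C2)
  · intro k
    filter_upwards [ae_restrict_mem hK.measurableSet] with p hp
    have hy : 0 ≤ p.1.2 ^ a := Real.rpow_nonneg (hKs hp).1.le a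
    refine (norm_add₃_le).trans (add_le_add (add_le_add ?_ ?_) ?_)
    · rw [norm_mul, Real.norm_eq_abs]
      exact mul_le_mul_of_nonneg_left (norm_mollify_le _ hC0 p) (abs_nonneg _)
    · rw [norm_mul, Real.norm_of_nonneg hy, mul_assoc]
      exact mul_le_mul_of_nonneg_left ((norm_inner_le_norm _ _).trans
        (mul_le_mul_of_nonneg_left (norm_mollify_le _ hC1 p) (norm_nonneg _))) hy
    · rw [norm_mul, Real.norm_eq_abs]
      exact mul_le_mul_of_nonneg_left (norm_mollify_le _ hC2 p) (abs_nonneg _)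
  · refine ae_of_all _ fun p => ?_
    exact ((tendsto_const_nhds.mul (tendsto_mollify hbt hφ p)).add
      (tendsto_const_nhds.mul (tendsto_const_nhds.inner (tendsto_mollify hbt hgx p)))).add
      (tendsto_const_nhds.mul (tendsto_mollify hbt hgy p))

end

/-! ### Lipschitz regularity in time -/

theorem exists_ae_bound {α : Type*} [MeasurableSpace α] {μ : Measure α} {f : α → ℝ}
    (hf : MemLp f ⊤ μ) : ∃ L : ℝ, 0 ≤ L ∧ ∀ᵐ p ∂μ, |f p| ≤ L := by
  refine ⟨(eLpNormEssSup f μ).toReal, ENNReal.toReal_nonneg, ?_⟩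
  have hfin : eLpNormEssSup f μ ≠ ⊤ := by
    have := hf.2; rw [eLpNorm_exponent_top] at this; exact this.ne
  filter_upwards [ae_le_eLpNormEssSup (f := f) (μ := μ)] with p hp
  have := (ENNReal.toReal_le_toReal enorm_ne_top hfin).2 hp
  simpa using this

section
variable {n : ℕ} {a : ℝ} {F U : SpaceTime n → ℝ}

/-- The mollified time derivative is bounded by the bound of the weak time derivative. -/
theorem hasDerivAt_mollify_time {U g : SpaceTime n → ℝ} (hw : HasWeakPartial (et n) U g)
    (b : ContDiffBump (0 : SpaceTime n)) {K : Set (SpaceTime n)} (hK : MeasurableSet K)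
    (hKs : K ⊆ openStrip n) (hUK : IntegrableOn U K) {X : EuclideanSpace ℝ (Fin n) × ℝ} {s : ℝ}
    (hball : Metric.closedBall (X, s) b.rOut ⊆ K) :
    HasDerivAt (fun s => mollify b (K.indicator U) (X, s))
      (∫ q in openStrip n, g q * b.normed volume ((X, s) - q)) s := by
  set ρ : SpaceTime n → ℝ := b.normed volume with hρ
  have hρs : ContDiff ℝ ∞ ρ := b.contDiff_normed
  have hρd : Differentiable ℝ ρ := hρs.differentiable (by simp)
  have hρc : Continuous (fderiv ℝ ρ) := hρs.continuous_fderiv (by simp)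
  have hρcs : HasCompactSupport ρ := b.hasCompactSupport_normed
  obtain ⟨C, hC⟩ := (hρcs.fderiv ℝ).exists_bound_of_continuous hρc
  obtain ⟨C0, hC0⟩ := hρcs.exists_bound_of_continuous hρs.continuous
  have hf : Integrable (K.indicator U) := (integrable_indicator_iff hK).2 hUK
  have hmol : ∀ p, mollify b (K.indicator U) p = ∫ q, ρ (p - q) * K.indicator U q := by
    intro p
    rw [mollify, convolution_eq_swap]; rfl
  have hder : ∀ (q : SpaceTime n) (s : ℝ), HasDerivAt (fun s => ρ ((X, s) - q))
      (fderiv ℝ ρ ((X, s) - q) (et n)) s := by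
    intro q s
    have h1 : HasDerivAt (fun s : ℝ => ((X, s) : SpaceTime n) - q) (et n) s :=
      ((hasDerivAt_const s X).prodMk (hasDerivAt_id s)).sub_const q
    exact (hρd _).hasFDerivAt.comp_hasDerivAt s h1
  have key := (hasDerivAt_integral_of_dominated_loc_of_deriv_le (μ := (volume : Measure (SpaceTime n)))
    (F := fun s q => ρ ((X, s) - q) * K.indicator U q)
    (F' := fun s q => fderiv ℝ ρ ((X, s) - q) (et n) * K.indicator U q) (x₀ := s)
    (s := univ) (bound := fun q => C * ‖et n‖ * ‖K.indicator U q‖) univ_mem ?_ ?_ ?_ ?_ ?_ ?_).2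
  · simp only [hmol]
    suffices hE : ∫ q in openStrip n, g q * b.normed volume ((X, s) - q)
        = ∫ q, fderiv ℝ ρ ((X, s) - q) (et n) * K.indicator U q by rw [hE]; exact key
    set φ : SpaceTime n → ℝ := fun q => ρ ((X, s) - q) with hφ
    have hsupp : tsupport φ ⊆ Metric.closedBall (X, s) b.rOut := by
      refine closure_minimal (fun q hq => ?_) Metric.isClosed_closedBall
      have h1 : (X, s) - q ∈ Function.support ρ := hq
      rw [hρ, b.support_normed_eq] at h1
      rw [Metric.mem_closedBall, dist_comm, dist_eq_norm]
      exact (by simpa using h1 : ‖(X, s) - q‖ < b.rOut).le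
    have htest : IsTest φ := by
      refine ⟨hρs.comp (contDiff_const.sub contDiff_id), ?_, (hsupp.trans hball).trans hKs⟩
      exact HasCompactSupport.of_support_subset_isCompact (isCompact_closedBall (X, s) b.rOut)
        (subset_closure.trans hsupp)
    -- The reflection `q ↦ (X, s) - q` produces a minus sign which cancels the one in the definition
    -- of the weak derivative.
    have hfd : ∀ q, fderiv ℝ φ q (et n) = - fderiv ℝ ρ ((X, s) - q) (et n) := by
      intro q
      have h1 : HasFDerivAt (fun q => (X, s) - q) (-ContinuousLinearMap.id ℝ (SpaceTime n)) q :=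
        (hasFDerivAt_id q).const_sub _
      have h2 := (hρd ((X, s) - q)).hasFDerivAt.comp q h1
      have h3 : fderiv ℝ φ q = _ := h2.fderiv
      rw [h3]; simp
    have hwk := hw.2.2 φ htest
    change ∫ q in openStrip n, g q * φ q = _
    rw [← neg_eq_iff_eq_neg.2 hwk, ← integral_neg,
      ← integral_indicator (isOpen_openStrip n).measurableSet]
    refine integral_congr_ae (ae_of_all _ fun q => ?_)
    simp only
    by_cases hq : q ∈ K
    · rw [indicator_of_mem (hKs hq), indicator_of_mem hq, hfd]; ring
    · have h0 : fderiv ℝ φ q = 0 := by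
        by_contra h
        exact hq (hball (hsupp (support_fderiv_subset ℝ h)))
      rw [indicator_of_notMem hq, mul_zero]
      by_cases hq' : q ∈ openStrip n
      · rw [indicator_of_mem hq', h0]; simp
      · rw [indicator_of_notMem hq']
  · refine Eventually.of_forall fun s => ?_
    exact (hρs.continuous.comp (by fun_prop)).aestronglyMeasurable.mul hf.aestronglyMeasurable
  · exact hf.bdd_mul (c := C0) (hρs.continuous.comp (by fun_prop)).aestronglyMeasurable
      (ae_of_all _ fun q => hC0 _)
  · have : Continuous fun q => fderiv ℝ ρ ((X, s) - q) (et n) :=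
      (hρc.comp (by fun_prop)).clm_apply continuous_const
    exact this.aestronglyMeasurable.mul hf.aestronglyMeasurable
  · refine ae_of_all _ fun q s _ => ?_
    rw [norm_mul]
    exact mul_le_mul_of_nonneg_right ((ContinuousLinearMap.le_opNorm _ _).trans
      (mul_le_mul_of_nonneg_right (hC _) (norm_nonneg _))) (norm_nonneg _)
  · exact hf.norm.const_mul _
  · exact ae_of_all _ fun q s _ => (hder q s).mul_const _

/-- The mollified function has as classical time derivative an average of the weak derivative `g`,
hence bounded by `L`. The mean value inequality gives the Lipschitz bound for each mollification,
and continuity of `U` passes it to the limit at every point, not just almost everywhere. -/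
theorem lipschitz_time_of_weak {U g : SpaceTime n → ℝ} (hw : HasWeakPartial (et n) U g)
    (hUc : ContinuousOn U (openStrip n)) {L : ℝ} (hL : ∀ᵐ p ∂(volume.restrict (openStrip n)), |g p| ≤ L)
    {X : EuclideanSpace ℝ (Fin n) × ℝ} (hX : 0 < X.2) {t t' : ℝ} (ht : t ∈ Ioo (-1) 0)
    (ht' : t' ∈ Ioo (-1) 0) : |U (X, t') - U (X, t)| ≤ L * |t' - t| := by
  have hS : IsCompact (({X} : Set (EuclideanSpace ℝ (Fin n) × ℝ)) ×ˢ uIcc t t') :=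
    isCompact_singleton.prod isCompact_uIcc
  have hSs : ({X} : Set (EuclideanSpace ℝ (Fin n) × ℝ)) ×ˢ uIcc t t' ⊆ openStrip n := by
    rintro ⟨Y, s⟩ ⟨hY, hs⟩
    rw [mem_singleton_iff] at hY
    simp only at hY hs
    subst hY
    have := (Set.ordConnected_Ioo (a := (-1 : ℝ)) (b := 0)).uIcc_subset ht ht' hs
    exact ⟨hX, this.1, this.2⟩
  obtain ⟨δ, hδ, hK, hKs⟩ := exists_cthickening_subset_openStrip hS hSs
  set K := Metric.cthickening δ (({X} : Set (EuclideanSpace ℝ (Fin n) × ℝ)) ×ˢ uIcc t t') with hKdef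
  have hUK : IntegrableOn U K := (hUc.mono hKs).integrableOn_compact hK
  have hf : Integrable (K.indicator U) := (integrable_indicator_iff hK.measurableSet).2 hUK
  have hball : ∀ s ∈ uIcc t t', Metric.closedBall ((X, s) : SpaceTime n) δ ⊆ K := fun s hs =>
    Metric.closedBall_subset_cthickening (mk_mem_prod (mem_singleton X) hs) δ
  set b := bumpSeq n δ hδ with hb
  have hbt : Tendsto (fun k => (b k).rOut) atTop (𝓝 0) := tendsto_bumpSeq_rOut n hδ
  have hconv : ∀ s ∈ uIcc t t',
      Tendsto (fun k => mollify (b k) (K.indicator U) (X, s)) atTop (𝓝 (U (X, s))) := by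
    intro s hs
    have hnhds : K ∈ 𝓝 ((X, s) : SpaceTime n) :=
      mem_of_superset (Metric.closedBall_mem_nhds _ hδ) (hball s hs)
    refine ContDiffBump.convolution_tendsto_right (g := fun _ => K.indicator U)
      (k := fun _ => (X, s)) hbt
      (Eventually.of_forall fun _ => hf.aestronglyMeasurable) ?_ tendsto_const_nhds
    have h1 : Tendsto (K.indicator U) (𝓝 (X, s)) (𝓝 (U (X, s))) := by
      have hc : ContinuousAt U (X, s) := (hUc.mono hKs).continuousAt hnhds
      refine hc.tendsto.congr' ?_
      filter_upwards [hnhds] with q hq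
      rw [indicator_of_mem hq]
    exact h1.comp tendsto_snd
  have hbound : ∀ k, |mollify (b k) (K.indicator U) (X, t') - mollify (b k) (K.indicator U) (X, t)|
      ≤ L * |t' - t| := by
    intro k
    have hd : ∀ s ∈ uIcc t t', HasDerivWithinAt (fun s => mollify (b k) (K.indicator U) (X, s))
        (∫ q in openStrip n, g q * (b k).normed volume ((X, s) - q)) (uIcc t t') s := fun s hs =>
      (hasDerivAt_mollify_time hw (b k) hK.measurableSet hKs hUK
        ((Metric.closedBall_subset_closedBall (bumpSeq_rOut_le n hδ k)).trans
          (hball s hs))).hasDerivWithinAt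
    refine Convex.norm_image_sub_le_of_norm_hasDerivWithin_le hd (fun s hs => ?_)
      (convex_uIcc t t') left_mem_uIcc right_mem_uIcc
    have hint : Integrable fun q => (b k).normed volume ((X, s) - q) :=
      (b k).integrable_normed.comp_sub_left _
    -- The open strip has positive measure, so the almost everywhere bound holds at some point.
    have hL0 : 0 ≤ L := by
      have : (ae (volume.restrict (openStrip n))).NeBot := by
        rw [ae_neBot, Ne, Measure.restrict_eq_zero]
        exact ((isOpen_openStrip n).measure_pos volume ⟨(X, t), hX, ht.1, ht.2⟩).ne'
      obtain ⟨p, hp⟩ := hL.exists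
      exact (abs_nonneg _).trans hp
    calc ‖∫ q in openStrip n, g q * (b k).normed volume ((X, s) - q)‖
        ≤ ∫ q in openStrip n, L * (b k).normed volume ((X, s) - q) := by
          refine norm_integral_le_of_norm_le (hint.const_mul L).integrableOn ?_
          filter_upwards [hL] with q hq
          rw [norm_mul, Real.norm_of_nonneg ((b k).nonneg_normed _)]
          exact mul_le_mul_of_nonneg_right hq ((b k).nonneg_normed _)
      _ ≤ ∫ q, L * (b k).normed volume ((X, s) - q) :=
          setIntegral_le_integral (hint.const_mul L)
            (ae_of_all _ fun q => mul_nonneg hL0 ((b k).nonneg_normed _))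
      _ = L := by
          rw [integral_const_mul, integral_sub_left_eq_self ((b k).normed volume), (b k).integral_normed, mul_one]
  have hlim := ((hconv t' right_mem_uIcc).sub (hconv t left_mem_uIcc)).abs
  exact le_of_tendsto hlim (Eventually.of_forall hbound)

/-- A function which is Lipschitz in time is differentiable in time almost everywhere. -/
theorem ae_differentiableAt_time (hUc : ContinuousOn U (stripWithThin n)) {L : ℝ} (hL0 : 0 ≤ L)
    (hL : ∀ X : EuclideanSpace ℝ (Fin n) × ℝ, 0 < X.2 → ∀ t ∈ Ioo (-1 : ℝ) 0, ∀ t' ∈ Ioo (-1 : ℝ) 0,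
      |U (X, t') - U (X, t)| ≤ L * |t' - t|) :
    ∀ᵐ p : SpaceTime n, p ∈ openStrip n → DifferentiableAt ℝ (fun t => U (p.1, t)) p.2 := by
  set δ : ℕ → ℝ := fun k => 1 / ((k : ℝ) + 2) with hδ
  have hδ0 : ∀ k, 0 < δ k := fun k => by positivity
  have hδ1 : ∀ k, δ k ≤ 1 / 2 := fun k => by
    apply one_div_le_one_div_of_le (by norm_num)
    have : (0 : ℝ) ≤ k := by positivity
    linarith
  -- Clamping `t` to a compact subinterval of `(-1, 0)` and replacing `y` by `|y|` yields a function
  -- continuous on all of space-time. This makes the set of differentiability in time measurable, as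
  -- needed to apply Fubini to the one-dimensional Rademacher theorem. As `k` grows, the clamped
  -- functions agree with `U` near any given point of the open strip.
  set c : ℕ → ℝ → ℝ := fun k t => max (-1 + δ k) (min t (-δ k)) with hc
  have hcm : ∀ k t, c k t ∈ Icc (-1 + δ k) (-δ k) := fun k t =>
    ⟨le_max_left _ _, max_le (by linarith [hδ1 k]) (min_le_right _ _)⟩
  have hcl : ∀ k t t', |c k t' - c k t| ≤ |t' - t| := fun k t t' => by
    refine (abs_max_sub_max_le_max _ _ _ _).trans ?_
    rw [sub_self, abs_zero, max_eq_right (abs_nonneg _)]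
    refine (abs_min_sub_min_le_max _ _ _ _).trans ?_
    rw [sub_self, abs_zero, max_eq_left (abs_nonneg _)]
  have hcm' : ∀ k t, c k t ∈ Ioo (-1 : ℝ) 0 := fun k t =>
    ⟨by linarith [(hcm k t).1, hδ0 k], by linarith [(hcm k t).2, hδ0 k]⟩
  set f : ℕ → (EuclideanSpace ℝ (Fin n) × ℝ) → ℝ → ℝ :=
    fun k X t => U ((X.1, |X.2|), c k t) with hf
  have hfc : ∀ k, Continuous (Function.uncurry (f k)) := by
    intro k
    have hin : Continuous fun q : (EuclideanSpace ℝ (Fin n) × ℝ) × ℝ =>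
        (((q.1.1, |q.1.2|), c k q.2) : SpaceTime n) := by
      simp only [hc]; fun_prop
    exact hUc.comp_continuous hin fun q =>
      ⟨abs_nonneg _, (hcm' k q.2).1, (hcm' k q.2).2.le⟩
  have hae : ∀ k, ∀ᵐ p : SpaceTime n, DifferentiableAt ℝ (f k p.1) p.2 := by
    intro k
    have hmeas := measurableSet_of_differentiableAt_with_param ℝ (hfc k)
    rw [Measure.volume_eq_prod, Measure.ae_prod_iff_ae_ae hmeas]
    have hne : ∀ᵐ X : EuclideanSpace ℝ (Fin n) × ℝ, X.2 ≠ 0 := by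
      rw [Measure.volume_eq_prod]
      exact (Measure.quasiMeasurePreserving_snd (μ := (volume : Measure (EuclideanSpace ℝ (Fin n))))
        (ν := (volume : Measure ℝ))).ae (Measure.ae_ne volume 0)
    filter_upwards [hne] with X hX
    have hlip : LipschitzWith L.toNNReal (f k X) := by
      refine LipschitzWith.of_dist_le_mul fun t t' => ?_
      rw [Real.dist_eq, Real.dist_eq, Real.coe_toNNReal _ hL0]
      refine (hL (X.1, |X.2|) (abs_pos.2 hX) _ (hcm' k t') _ (hcm' k t)).trans ?_
      exact mul_le_mul_of_nonneg_left (hcl k t' t) hL0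
    exact hlip.ae_differentiableAt_real
  rw [← ae_all_iff] at hae
  filter_upwards [hae] with p hp hps
  obtain ⟨k, hk⟩ : ∃ k, δ k < min (p.2 + 1) (-p.2) := by
    have ht : Tendsto δ atTop (𝓝 0) := by
      have := (tendsto_one_div_add_atTop_nhds_zero_nat (𝕜 := ℝ)).comp (tendsto_add_atTop_nat 1)
      refine this.congr fun k => ?_
      simp only [hδ, Function.comp]; push_cast; ring_nf
    have hpos : 0 < min (p.2 + 1) (-p.2) := lt_min (by linarith [hps.2.1]) (by linarith [hps.2.2])
    exact (ht.eventually (gt_mem_nhds hpos)).exists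
  refine (hp k).congr_of_eventuallyEq ?_
  have h1 := lt_min_iff.1 hk
  have hnh : Ioo (-1 + δ k) (-δ k) ∈ 𝓝 p.2 := Ioo_mem_nhds (by linarith) (by linarith)
  filter_upwards [hnh] with t ht
  simp only [hf, hc]
  rw [min_eq_left ht.2.le, max_eq_right ht.1.le, abs_of_pos hps.1]

end

/-! ### Difference quotients along the parabolic dilations -/

/-- The quantitative bounds which hold for solutions. -/
structure Bounds {n : ℕ} (a : ℝ) (U : SpaceTime n → ℝ) (R M L : ℝ) : Prop where
  R_nonneg : 0 ≤ R
  M_nonneg : 0 ≤ M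
  L_nonneg : 0 ≤ L
  supp : ∀ p ∈ stripWithThin n, R < normSqX p.1 → U p = 0
  gradx_le : ∀ p ∈ strip n 1, ‖gradx U p‖ ≤ M
  weightedDy_le : ∀ p ∈ strip n 1, |weightedDy a U p| ≤ M
  lip : ∀ X : EuclideanSpace ℝ (Fin n) × ℝ, 0 < X.2 → ∀ t ∈ Ioo (-1 : ℝ) 0, ∀ t' ∈ Ioo (-1 : ℝ) 0,
      |U (X, t') - U (X, t)| ≤ L * |t' - t|

section
variable {n : ℕ} {a : ℝ} {F U : SpaceTime n → ℝ}

theorem IsSolution.exists_bounds (hU : IsSolution a F U) : ∃ R M L, Bounds a U R M L := by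
  obtain ⟨R, hR⟩ := hU.bounded_support
  obtain ⟨α, -, -, ⟨M1, h1, -⟩, ⟨M2, h2, -⟩⟩ := hU.holder
  obtain ⟨L, hL0, hL⟩ := exists_ae_bound hU.time_deriv.2
  refine ⟨max R 0, max M1 (max M2 0), L, le_max_right _ _,
    (le_max_right _ _).trans (le_max_right _ _), hL0,
    fun p hp h => hR p hp (lt_of_le_of_lt (le_max_left _ _) h),
    fun p hp => (h1 p hp).trans (le_max_left _ _),
    fun p hp => (h2 p hp).trans ((le_max_left _ _).trans (le_max_right _ _)),
    fun X hX t ht t' ht' => ?_⟩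
  exact lipschitz_time_of_weak hU.time_deriv.1
    (hU.continuousOn.mono ((openStrip_subset_strip n).trans (strip_subset_stripWithThin n)))
    (ae_restrict_of_ae_restrict_of_subset (openStrip_subset_strip n) hL) hX ht ht'

theorem rpow_neg_le_of_mem {y z a : ℝ} (ha : -1 < a) (ha' : a < 1) (hy : 0 < y)
    (hz : z ∈ Icc (y / 2) (2 * y)) : z ^ (-a) ≤ 2 * y ^ (-a) := by
  have hz0 : 0 < z := by linarith [hz.1]
  rcases le_total 0 a with h | h
  · calc z ^ (-a) ≤ (y / 2) ^ (-a) := Real.rpow_le_rpow_of_nonpos (by positivity) hz.1 (by linarith)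
      _ = 2 ^ a * y ^ (-a) := by
          rw [Real.div_rpow hy.le (by norm_num), Real.rpow_neg (by norm_num : (0 : ℝ) ≤ 2)]
          field_simp
      _ ≤ 2 * y ^ (-a) := by
          refine mul_le_mul_of_nonneg_right ?_ (by positivity)
          calc (2 : ℝ) ^ a ≤ 2 ^ (1 : ℝ) := Real.rpow_le_rpow_of_exponent_le (by norm_num) ha'.le
            _ = 2 := Real.rpow_one 2
  · calc z ^ (-a) ≤ (2 * y) ^ (-a) := Real.rpow_le_rpow hz0.le hz.2 (by linarith)
      _ = 2 ^ (-a) * y ^ (-a) := Real.mul_rpow (by norm_num) hy.le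
      _ ≤ 2 * y ^ (-a) := by
          refine mul_le_mul_of_nonneg_right ?_ (by positivity)
          calc (2 : ℝ) ^ (-a) ≤ 2 ^ (1 : ℝ) :=
                Real.rpow_le_rpow_of_exponent_le (by norm_num) (by linarith)
            _ = 2 := Real.rpow_one 2

theorem abs_dy_le {R M L : ℝ} (hB : Bounds a U R M L) {p : SpaceTime n} (hp : p ∈ strip n 1) :
    |dy U p| ≤ M * p.1.2 ^ (-a) := by
  have hy := hp.1
  have h := hB.weightedDy_le p hp
  have h2 : dy U p = p.1.2 ^ (-a) * weightedDy a U p := by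
    simp only [weightedDy]; rw [← mul_assoc, ← Real.rpow_add hy]; simp
  rw [h2, abs_mul, abs_of_nonneg (Real.rpow_nonneg hy.le _), mul_comm]
  exact mul_le_mul_of_nonneg_right h (Real.rpow_nonneg hy.le _)

/-- Uniform Lipschitz bound along dilations, inside the strip. -/
theorem abs_dil_sub_le (ha : -1 < a) (ha' : a < 1) (hU : IsSolution a F U) {R M L : ℝ}
    (hB : Bounds a U R M L) {l : ℝ} (hl : l ∈ Icc (1 / 2 : ℝ) 2) {p : SpaceTime n}
    (hy : 0 < p.1.2) (ht : p.2 ∈ Ioo (-1 : ℝ) 0) (hlt : -1 < l ^ 2 * p.2) :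
    |U (dil l p) - U p|
      ≤ (M * (2 * √R) + 2 * M * (2 * √R) ^ (1 - a) + 3 * L) * |l - 1| := by
  obtain ⟨⟨x, y⟩, t⟩ := p
  simp only at hy ht hlt
  have hl0 : 0 < l := by linarith [hl.1]
  have ht2 : l ^ 2 * t ∈ Ioo (-1 : ℝ) 0 := ⟨hlt, mul_neg_of_pos_of_neg (by positivity) ht.2⟩
  have hM := hB.M_nonneg
  have hL := hB.L_nonneg
  have hR := hB.R_nonneg
  rw [dil_apply]
  -- Since `l ≥ 1/2`, a dilation divides `|X|²` by at most four. Beyond `4R` both points lie outside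
  -- the support, and otherwise `|X| ≤ 2√R`.
  by_cases hsupp : 4 * R < normSqX (x, y)
  · have h1 : U ((x, y), t) = 0 := by
      refine hB.supp _ ⟨hy.le, ht.1, ht.2.le⟩ ?_
      simp only; linarith
    have h2 : U ((l • x, l * y), l ^ 2 * t) = 0 := by
      refine hB.supp _ ⟨by positivity, ht2.1, ht2.2.le⟩ ?_
      have := normSqX_dil l ((x, y), t)
      rw [dil_apply] at this
      simp only at this ⊢
      rw [this]
      have : (1 / 4 : ℝ) ≤ l ^ 2 := by nlinarith [hl.1]
      nlinarith
    rw [h1, h2]; simp; positivity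
  · have hN : ‖x‖ ^ 2 + y ^ 2 ≤ (2 * √R) ^ 2 := by
      rw [mul_pow, Real.sq_sqrt hR]
      have := not_lt.1 hsupp
      simp only [normSqX] at this
      linarith
    have hx : ‖x‖ ≤ 2 * √R := abs_le_of_sq_le_sq' (by nlinarith [sq_nonneg y]) (by positivity) |>.2
    have hyR : y ≤ 2 * √R := abs_le_of_sq_le_sq' (by nlinarith [sq_nonneg ‖x‖]) (by positivity) |>.2
    have e1 : |U ((l • x, l * y), l ^ 2 * t) - U ((x, l * y), l ^ 2 * t)|
        ≤ M * (2 * √R) * |l - 1| := by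
      have hd : ∀ z ∈ (univ : Set (EuclideanSpace ℝ (Fin n))),
          HasFDerivWithinAt (fun z => U ((z, l * y), l ^ 2 * t))
            (InnerProductSpace.toDual ℝ _ (gradx U ((z, l * y), l ^ 2 * t))) univ z := fun z _ =>
        (hU.hasGradientAt (p := ((z, l * y), l ^ 2 * t))
          ⟨by positivity, by simpa using ht2.1, ht2.2.le⟩).hasFDerivAt.hasFDerivWithinAt
      have := convex_univ.norm_image_sub_le_of_norm_hasFDerivWithin_le hd (C := M) (fun z _ => by
        rw [LinearIsometryEquiv.norm_map]
        exact hB.gradx_le _ ⟨by positivity, by simpa using ht2.1, ht2.2.le⟩)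
        (mem_univ x) (mem_univ (l • x))
      rw [Real.norm_eq_abs] at this
      refine this.trans ?_
      have h3 : l • x - x = (l - 1) • x := by rw [sub_smul, one_smul]
      rw [h3, norm_smul, Real.norm_eq_abs, mul_assoc, mul_comm |l - 1|]
      exact mul_le_mul_of_nonneg_left (mul_le_mul_of_nonneg_right hx (abs_nonneg _)) hM
    -- The derivative in `y` may blow up like `y^(-a)`, but this leg has length `|l - 1| y`. The
    -- product carries `y^(1-a)`, bounded on the support because `a < 1`; the segment stays in
    -- `[y/2, 2y]`, where `z^(-a)` is comparable to `y^(-a)`.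
    have e2 : |U ((x, l * y), l ^ 2 * t) - U ((x, y), l ^ 2 * t)|
        ≤ 2 * M * (2 * √R) ^ (1 - a) * |l - 1| := by
      have hpos : ∀ z ∈ Icc (y / 2) (2 * y), 0 < z := fun z hz => by linarith [hz.1]
      have hmem : ∀ z ∈ Icc (y / 2) (2 * y), (((x, z), l ^ 2 * t) : SpaceTime n) ∈ strip n 1 :=
        fun z hz => ⟨hpos z hz, by simpa using ht2.1, ht2.2.le⟩
      have hd : ∀ z ∈ Icc (y / 2) (2 * y),
          HasDerivWithinAt (fun z => U ((x, z), l ^ 2 * t))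
            (dy U ((x, z), l ^ 2 * t)) (Icc (y / 2) (2 * y)) z := fun z hz =>
        (hU.hasDerivAt_y (hmem z hz)).hasDerivWithinAt
      have := (convex_Icc (y / 2) (2 * y)).norm_image_sub_le_of_norm_hasDerivWithin_le hd
        (C := M * (2 * y ^ (-a))) (fun z hz => by
          refine (abs_dy_le hB (hmem z hz)).trans ?_
          exact mul_le_mul_of_nonneg_left (rpow_neg_le_of_mem ha ha' hy hz) hM)
        (x := y) (y := l * y) ⟨by linarith, by linarith⟩
        ⟨by nlinarith [hl.1], by nlinarith [hl.2]⟩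
      rw [Real.norm_eq_abs] at this
      refine this.trans ?_
      have h3 : l * y - y = (l - 1) * y := by ring
      have h4 : y ^ (-a) * y = y ^ (1 - a) := by
        rw [show (1 - a) = -a + 1 by ring, Real.rpow_add hy, Real.rpow_one]
      have h5 : y ^ (1 - a) ≤ (2 * √R) ^ (1 - a) := Real.rpow_le_rpow hy.le hyR (by linarith)
      rw [h3, norm_mul, Real.norm_eq_abs, Real.norm_eq_abs, abs_of_pos hy]
      calc M * (2 * y ^ (-a)) * (|l - 1| * y) = 2 * M * (y ^ (-a) * y) * |l - 1| := by ring
        _ ≤ _ := by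
          rw [h4]
          exact mul_le_mul_of_nonneg_right (mul_le_mul_of_nonneg_left h5 (by positivity))
            (abs_nonneg _)
    have e3 : |U ((x, y), l ^ 2 * t) - U ((x, y), t)| ≤ 3 * L * |l - 1| := by
      refine (hB.lip (x, y) hy t ht _ ht2).trans ?_
      have h3 : l ^ 2 * t - t = (l - 1) * ((l + 1) * t) := by ring
      have h4 : |(l + 1) * t| ≤ 3 := by
        rw [abs_mul, abs_of_pos (by linarith : 0 < l + 1), abs_of_neg ht.2]
        nlinarith [hl.2, ht.1, ht.2]
      rw [h3, abs_mul]
      calc L * (|l - 1| * |(l + 1) * t|) ≤ L * (|l - 1| * 3) := by gcongr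
        _ = _ := by ring
    have := abs_add_three (U ((l • x, l * y), l ^ 2 * t) - U ((x, l * y), l ^ 2 * t))
      (U ((x, l * y), l ^ 2 * t) - U ((x, y), l ^ 2 * t)) (U ((x, y), l ^ 2 * t) - U ((x, y), t))
    rw [show U ((l • x, l * y), l ^ 2 * t) - U ((x, l * y), l ^ 2 * t) +
      (U ((x, l * y), l ^ 2 * t) - U ((x, y), l ^ 2 * t)) +
      (U ((x, y), l ^ 2 * t) - U ((x, y), t)) = U ((l • x, l * y), l ^ 2 * t) - U ((x, y), t) by
        ring] at this
    nlinarith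

theorem dil_mem_stripWithThin {l : ℝ} (hl : 0 < l) {p : SpaceTime n} (hy : 0 ≤ p.1.2)
    (ht : p.2 ≤ 0) (hlt : -1 < l ^ 2 * p.2) : dil l p ∈ stripWithThin n := by
  rw [dil_apply]
  exact ⟨by positivity, hlt, mul_nonpos_of_nonneg_of_nonpos (by positivity) ht⟩

/-- Continuity up to the thin set, along the `y` direction. -/
theorem tendsto_thin {f : SpaceTime n → ℝ} (hf : ContinuousOn f (stripWithThin n))
    {x : EuclideanSpace ℝ (Fin n)} {t : ℝ} (ht : -1 < t) (ht' : t ≤ 0) :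
    Tendsto (fun y => f ((x, y), t)) (𝓝[>] 0) (𝓝 (f ((x, 0), t))) := by
  have hc := hf ((x, 0), t) ⟨le_rfl, ht, ht'⟩
  refine hc.tendsto.comp (tendsto_nhdsWithin_iff.2 ⟨?_, ?_⟩)
  · have : Continuous fun y : ℝ => (((x, y), t) : SpaceTime n) := by fun_prop
    exact (this.tendsto 0).mono_left nhdsWithin_le_nhds
  · filter_upwards [self_mem_nhdsWithin] with y hy using ⟨le_of_lt hy, ht, ht'⟩

/-- Uniform Lipschitz bound along dilations, up to the thin set. -/
theorem exists_dil_lipschitz (ha : -1 < a) (ha' : a < 1) (hU : IsSolution a F U) :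
    ∃ C : ℝ, 0 ≤ C ∧ ∀ l ∈ Icc (1 / 2 : ℝ) 2, ∀ p : SpaceTime n, 0 ≤ p.1.2 →
      p.2 ∈ Ioo (-1 : ℝ) 0 → -1 < l ^ 2 * p.2 → |U (dil l p) - U p| ≤ C * |l - 1| := by
  obtain ⟨R, M, L, hB⟩ := hU.exists_bounds
  have hM := hB.M_nonneg
  have hL := hB.L_nonneg
  have hR := hB.R_nonneg
  refine ⟨M * (2 * √R) + 2 * M * (2 * √R) ^ (1 - a) + 3 * L, by positivity, ?_⟩
  intro l hl p hy ht hlt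
  rcases hy.eq_or_lt with hy0 | hy0
  · obtain ⟨⟨x, y⟩, t⟩ := p
    simp only at hy0 ht hlt
    subst hy0
    have hl0 : 0 < l := by linarith [hl.1]
    have h1 := tendsto_thin (x := x) hU.continuousOn ht.1 ht.2.le
    have h2 : Tendsto (fun y => U (dil l ((x, y), t))) (𝓝[>] 0) (𝓝 (U (dil l ((x, 0), t)))) := by
      have hc := hU.continuousOn (dil l ((x, 0), t)) (dil_mem_stripWithThin hl0 le_rfl ht.2.le hlt)
      refine hc.tendsto.comp (tendsto_nhdsWithin_iff.2 ⟨?_, ?_⟩)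
      · have : Continuous fun y : ℝ => dil l (((x, y), t) : SpaceTime n) :=
          (continuous_dil l).comp (by fun_prop)
        exact (this.tendsto 0).mono_left nhdsWithin_le_nhds
      · filter_upwards [self_mem_nhdsWithin] with y hy
          using dil_mem_stripWithThin hl0 (le_of_lt hy) ht.2.le hlt
    -- On the thin set the estimate is the limit `y → 0⁺` of the interior one, whose constant does
    -- not depend on `y`.
    refine le_of_tendsto (h2.sub h1).abs ?_
    filter_upwards [self_mem_nhdsWithin] with y hy
    exact abs_dil_sub_le ha ha' hU hB hl (p := ((x, y), t)) hy ht hlt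
  · exact abs_dil_sub_le ha ha' hU hB hl hy0 ht hlt

/-- Derivative of `f l l - f 1 l` at `1` for `f` differentiable in the first variable. -/
theorem hasDerivAt_diag {f f' : ℝ → ℝ → ℝ}
    (h : ∀ᶠ q : ℝ × ℝ in 𝓝 (1, 1), HasDerivAt (fun l => f l q.2) (f' q.1 q.2) q.1)
    (hc : ContinuousAt (fun q : ℝ × ℝ => f' q.1 q.2) (1, 1)) :
    HasDerivAt (fun l => f l l - f 1 l) (f' 1 1) 1 := by
  rw [hasDerivAt_iff_isLittleO, Asymptotics.isLittleO_iff]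
  intro ε hε
  have h2 : ∀ᶠ q : ℝ × ℝ in 𝓝 (1, 1), ‖f' q.1 q.2 - f' 1 1‖ ≤ ε := by
    have := Metric.tendsto_nhds.1 hc.tendsto ε hε
    filter_upwards [this] with q hq
    exact (dist_eq_norm (f' q.1 q.2) (f' 1 1) ▸ hq).le
  obtain ⟨δ, hδ, hb⟩ := Metric.eventually_nhds_iff_ball.1 (h.and h2)
  filter_upwards [Metric.ball_mem_nhds (1 : ℝ) hδ] with l hl
  have hball : ∀ m ∈ Metric.ball (1 : ℝ) δ, ((m, l) : ℝ × ℝ) ∈ Metric.ball ((1, 1) : ℝ × ℝ) δ := by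
    intro m hm
    rw [Metric.mem_ball, Prod.dist_eq]
    exact max_lt hm hl
  -- Mean value inequality in the first variable with the second frozen at `l`. Joint continuity of
  -- `f'` makes the derivative of the corrected function at most `ε`, uniformly in `l`.
  have hd : ∀ m ∈ Metric.ball (1 : ℝ) δ, HasDerivWithinAt (fun m => f m l - m * f' 1 1)
      (f' m l - 1 * f' 1 1) (Metric.ball (1 : ℝ) δ) m := fun m hm =>
    ((hb _ (hball m hm)).1.sub ((hasDerivAt_id m).mul_const _)).hasDerivWithinAt
  have := (convex_ball (1 : ℝ) δ).norm_image_sub_le_of_norm_hasDerivWithin_le hd (C := ε)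
    (fun m hm => by rw [one_mul]; exact (hb _ (hball m hm)).2) (Metric.mem_ball_self hδ) hl
  refine le_trans (le_of_eq ?_) this
  congr 1
  simp only [smul_eq_mul]; ring

/-- Joint differentiability of `U` in `(X, t)` is not available, so the dilation is split into legs
in `x`, `y` and `t`. On the first two the base point also moves with `l`, and continuity of the
spatial derivatives handles them through `hasDerivAt_diag`. The time leg starts from the fixed point
`X` and needs differentiability in `t` at `p` only. -/
theorem hasDerivAt_dil (hU : IsSolution a F U) {p : SpaceTime n} (hp : p ∈ openStrip n)
    (ht : DifferentiableAt ℝ (fun t => U (p.1, t)) p.2) :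
    HasDerivAt (fun l => U (dil l p)) (Zfield U p) 1 := by
  have hcgx : ContinuousAt (gradx U) p := (hU.continuousOn_gradx.mono
    (openStrip_subset_strip n)).continuousAt ((isOpen_openStrip n).mem_nhds hp)
  have hcdy : ContinuousAt (dy U) p := (hU.continuousOn_dy.mono
    (openStrip_subset_strip n)).continuousAt ((isOpen_openStrip n).mem_nhds hp)
  have hA := hasDerivAt_diag (f := fun m l => U ((m • p.1.1, l * p.1.2), l ^ 2 * p.2))
    (f' := fun m l => inner ℝ (gradx U ((m • p.1.1, l * p.1.2), l ^ 2 * p.2)) p.1.1) ?_ ?_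
  · have hB := hasDerivAt_diag (f := fun m l => U ((p.1.1, m * p.1.2), l ^ 2 * p.2))
      (f' := fun m l => dy U ((p.1.1, m * p.1.2), l ^ 2 * p.2) * p.1.2) ?_ ?_
    · have hC : HasDerivAt (fun l : ℝ => U (p.1, l ^ 2 * p.2)) (dt U p * (2 * p.2)) 1 := by
        have h1 : HasDerivAt (fun l : ℝ => l ^ 2 * p.2) (2 * p.2) 1 := by
          simpa using ((hasDerivAt_id (1 : ℝ)).pow 2).mul_const p.2
        have h2 : HasDerivAt (fun t => U (p.1, t)) (dt U p) (1 ^ 2 * p.2) := by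
          rw [one_pow, one_mul]; exact ht.hasDerivAt
        exact h2.comp (1 : ℝ) h1
      have hsum := (hA.add hB).add hC
      have e : (fun l => U (dil l p)) = (fun l => U ((l • p.1.1, l * p.1.2), l ^ 2 * p.2)
          - U (((1 : ℝ) • p.1.1, l * p.1.2), l ^ 2 * p.2)) + (fun l =>
          U ((p.1.1, l * p.1.2), l ^ 2 * p.2) - U ((p.1.1, 1 * p.1.2), l ^ 2 * p.2))
          + fun l => U (p.1, l ^ 2 * p.2) := by
        ext l
        simp only [dil_apply, Pi.add_apply, one_smul, one_mul]; ring
      rw [e]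
      refine hsum.congr_deriv ?_
      simp only [Zfield, one_smul, one_mul, one_pow, Prod.mk.eta]
      rw [real_inner_comm]; ring
    · have hmap : Continuous fun q : ℝ × ℝ => (((p.1.1, q.1 * p.1.2), q.2 ^ 2 * p.2) : SpaceTime n) := by
        fun_prop
      have hev : ∀ᶠ q : ℝ × ℝ in 𝓝 (1, 1),
          (((p.1.1, q.1 * p.1.2), q.2 ^ 2 * p.2) : SpaceTime n) ∈ openStrip n :=
        hmap.continuousAt.eventually_mem ((isOpen_openStrip n).mem_nhds (by simpa using hp))
      filter_upwards [hev] with q hq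
      have h1 := hU.hasDerivAt_y (openStrip_subset_strip n hq)
      have h2 : HasDerivAt (fun m : ℝ => m * p.1.2) p.1.2 q.1 := by
        simpa using (hasDerivAt_id q.1).mul_const p.1.2
      exact h1.comp q.1 h2
    · have hmap : Continuous fun q : ℝ × ℝ => (((p.1.1, q.1 * p.1.2), q.2 ^ 2 * p.2) : SpaceTime n) := by
        fun_prop
      have h1 : ContinuousAt (fun q : ℝ × ℝ => dy U ((p.1.1, q.1 * p.1.2), q.2 ^ 2 * p.2)) (1, 1) :=
        ContinuousAt.comp (g := dy U) (by simpa using hcdy) hmap.continuousAt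
      exact h1.mul continuousAt_const
  · have hmap : Continuous fun q : ℝ × ℝ =>
        (((q.1 • p.1.1, q.2 * p.1.2), q.2 ^ 2 * p.2) : SpaceTime n) := by fun_prop
    have hev : ∀ᶠ q : ℝ × ℝ in 𝓝 (1, 1),
        (((q.1 • p.1.1, q.2 * p.1.2), q.2 ^ 2 * p.2) : SpaceTime n) ∈ openStrip n :=
      hmap.continuousAt.eventually_mem ((isOpen_openStrip n).mem_nhds (by simpa using hp))
    filter_upwards [hev] with q hq
    have h1 := (hU.hasGradientAt (openStrip_subset_strip n hq)).hasFDerivAt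
    have h2 : HasDerivAt (fun m : ℝ => m • p.1.1) p.1.1 q.1 := by
      simpa using (hasDerivAt_id q.1).smul_const p.1.1
    have h3 := h1.comp_hasDerivAt q.1 h2
    rw [InnerProductSpace.toDual_apply_apply] at h3
    exact h3
  · have hmap : Continuous fun q : ℝ × ℝ =>
        (((q.1 • p.1.1, q.2 * p.1.2), q.2 ^ 2 * p.2) : SpaceTime n) := by fun_prop
    have h1 : ContinuousAt (fun q : ℝ × ℝ => gradx U ((q.1 • p.1.1, q.2 * p.1.2), q.2 ^ 2 * p.2))
        (1, 1) := ContinuousAt.comp (g := gradx U) (by simpa using hcgx) hmap.continuousAt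
    exact h1.inner continuousAt_const

theorem ae_hasDerivAt_dil (hU : IsSolution a F U) :
    ∀ᵐ p : SpaceTime n, p ∈ openStrip n → HasDerivAt (fun l => U (dil l p)) (Zfield U p) 1 := by
  obtain ⟨R, M, L, hB⟩ := hU.exists_bounds
  filter_upwards [ae_differentiableAt_time hU.continuousOn hB.L_nonneg hB.lip] with p hp hps
  exact hasDerivAt_dil hU hps (hp hps)

theorem strip_ae_eq_inter (r : ℝ) : ∀ᵐ p ∂(volume.restrict (strip n r)), p.2 < 0 := by
  have hne : ∀ᵐ p : SpaceTime n, p.2 ≠ 0 := by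
    rw [Measure.volume_eq_prod]
    exact (Measure.quasiMeasurePreserving_snd
      (μ := (volume : Measure (EuclideanSpace ℝ (Fin n) × ℝ)))
      (ν := (volume : Measure ℝ))).ae (Measure.ae_ne volume 0)
  filter_upwards [ae_restrict_mem (measurableSet_strip n r), ae_restrict_of_ae hne] with p hp h
  exact lt_of_le_of_ne hp.2.2 h

/-- `ZU` is almost everywhere a limit of difference quotients along dilations, which the Lipschitz
estimate bounds by `C`. -/
theorem ae_abs_Zfield_le (hU : IsSolution a F U) {C : ℝ}
    (hC : ∀ l ∈ Icc (1 / 2 : ℝ) 2, ∀ p : SpaceTime n, 0 ≤ p.1.2 →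
      p.2 ∈ Ioo (-1 : ℝ) 0 → -1 < l ^ 2 * p.2 → |U (dil l p) - U p| ≤ C * |l - 1|) :
    ∀ᵐ p : SpaceTime n, p ∈ openStrip n → |Zfield U p| ≤ C := by
  filter_upwards [ae_hasDerivAt_dil hU] with p hp hps
  have h := (hasDerivAt_iff_tendsto_slope.1 (hp hps)).abs
  refine le_of_tendsto h ?_
  have h1 : ∀ᶠ l : ℝ in 𝓝 1, l ∈ Icc (1 / 2 : ℝ) 2 := Icc_mem_nhds (by norm_num) (by norm_num)
  have h2 : ∀ᶠ l : ℝ in 𝓝 1, -1 < l ^ 2 * p.2 := by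
    have : ContinuousAt (fun l : ℝ => l ^ 2 * p.2) 1 := by fun_prop
    exact this.eventually_const_lt (by simpa using hps.2.1)
  filter_upwards [h1.filter_mono nhdsWithin_le_nhds, h2.filter_mono nhdsWithin_le_nhds,
    self_mem_nhdsWithin] with l hl hl2 hne
  have hne' : 0 < |l - 1| := abs_pos.2 (sub_ne_zero.2 hne)
  have h3 := hC l hl p hps.1.le hps.2 hl2
  rw [slope_def_field, abs_div, div_le_iff₀ hne']
  have : dil 1 p = p := by rw [dil_apply]; simp
  rwa [this]

end

/-! ### The conormal derivative on the thin set -/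

section
variable {n : ℕ} {a : ℝ} {F U : SpaceTime n → ℝ}

theorem ParHolder.exists_tendsto_thin {α : ℝ} (hα : 0 < α) {f : SpaceTime n → ℝ}
    (hf : ParHolder α f) (x : EuclideanSpace ℝ (Fin n)) {t : ℝ} (ht : -1 < t) (ht' : t ≤ 0) :
    ∃ v, Tendsto (fun y => f ((x, y), t)) (𝓝[>] 0) (𝓝 v) := by
  obtain ⟨M, -, hM⟩ := hf
  have hmem : ∀ y ∈ Ioi (0 : ℝ), (((x, y), t) : SpaceTime n) ∈ strip n 1 := fun y hy =>
    ⟨hy, by simpa using ht, ht'⟩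
  have hest : ∀ y ∈ Ioi (0 : ℝ), ∀ z ∈ Ioi (0 : ℝ),
      |f ((x, y), t) - f ((x, z), t)| ≤ M * |y - z| ^ α := by
    intro y hy z hz
    have := hM _ (hmem y hy) _ (hmem z hz)
    have h0 : (0 : ℝ) ^ (α / 2) = 0 := Real.zero_rpow (by positivity)
    simpa [normSqX, h0, Real.sqrt_sq_eq_abs] using this
  refine cauchy_map_iff_exists_tendsto.1 ?_
  rw [Metric.cauchy_iff]
  refine ⟨inferInstance, fun ε hε => ?_⟩
  have hc : Tendsto (fun δ : ℝ => M * |δ| ^ α) (𝓝 0) (𝓝 0) := by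
    have : Continuous fun δ : ℝ => M * |δ| ^ α :=
      continuous_const.mul (continuous_abs.rpow_const fun _ => Or.inr hα.le)
    simpa [Real.zero_rpow hα.ne'] using this.tendsto 0
  obtain ⟨δ, hδ, hδε⟩ := Metric.eventually_nhds_iff_ball.1 (hc.eventually_lt_const hε)
  refine ⟨(fun y => f ((x, y), t)) '' Ioo 0 δ, image_mem_map (Ioo_mem_nhdsGT hδ), ?_⟩
  rintro _ ⟨y, hy, rfl⟩ _ ⟨z, hz, rfl⟩
  rw [Real.dist_eq]
  refine (hest y hy.1 z hz.1).trans_lt (hδε _ ?_)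
  rw [Metric.mem_ball, Real.dist_eq, sub_zero, abs_lt]
  exact ⟨by linarith [hy.1, hz.2], by linarith [hy.2, hz.1]⟩

/-- The Hölder bound in `y` makes `y^a U_y` Cauchy as `y → 0⁺`; hence the `limUnder` in `conormal`
is a genuine limit. -/
theorem IsSolution.tendsto_conormal (hU : IsSolution a F U) (x : EuclideanSpace ℝ (Fin n)) {t : ℝ}
    (ht : -1 < t) (ht' : t ≤ 0) :
    Tendsto (fun y => weightedDy a U ((x, y), t)) (𝓝[>] 0) (𝓝 (conormal a U x t)) := by
  obtain ⟨α, hα, -, -, h⟩ := hU.holder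
  exact tendsto_nhds_limUnder (h.exists_tendsto_thin hα x ht ht')

/-- The Hölder estimate for `y^a U_y` between two points with the same `y` does not involve `y`, so
it survives the limit `y → 0⁺`. -/
theorem IsSolution.continuous_conormal_dil (hU : IsSolution a F U) (x : EuclideanSpace ℝ (Fin n))
    {t : ℝ} (ht : t ∈ Ioo (-1 : ℝ) 0) :
    Tendsto (fun l : ℝ => conormal a U (l • x) (l ^ 2 * t)) (𝓝 1) (𝓝 (conormal a U x t)) := by
  obtain ⟨α, hα, -, -, M, -, hM⟩ := hU.holder
  have hev : ∀ᶠ l : ℝ in 𝓝 1, l ^ 2 * t ∈ Ioo (-1 : ℝ) 0 := by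
    have : ContinuousAt (fun l : ℝ => l ^ 2 * t) 1 := by fun_prop
    exact this.eventually_mem (isOpen_Ioo.mem_nhds (by simpa using ht))
  have hcont : Continuous fun l : ℝ => M * (‖l • x - x‖ ^ α + |l ^ 2 * t - t| ^ (α / 2)) := by
    have h1 : Continuous fun l : ℝ => ‖l • x - x‖ := by fun_prop
    have h2 : Continuous fun l : ℝ => |l ^ 2 * t - t| := by fun_prop
    exact continuous_const.mul ((h1.rpow_const fun _ => Or.inr hα.le).add
      (h2.rpow_const fun _ => Or.inr (by positivity)))
  have h0 := hcont.tendsto 1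
  simp only [one_smul, sub_self, norm_zero, one_pow, one_mul, abs_zero, Real.zero_rpow hα.ne',
    Real.zero_rpow (show α / 2 ≠ 0 by positivity), add_zero, mul_zero] at h0
  rw [tendsto_iff_norm_sub_tendsto_zero]
  refine squeeze_zero' (Eventually.of_forall fun _ => norm_nonneg _) ?_ h0
  filter_upwards [hev] with l hl
  have h1 := hU.tendsto_conormal (l • x) hl.1 hl.2.le
  have h2 := hU.tendsto_conormal x ht.1 ht.2.le
  refine le_of_tendsto (h1.sub h2).norm ?_
  filter_upwards [self_mem_nhdsWithin] with y hy
  have := hM ((l • x, y), l ^ 2 * t) ⟨hy, by simpa using hl.1, hl.2.le⟩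
    ((x, y), t) ⟨hy, by simpa using ht.1, ht.2.le⟩
  simpa [normSqX, Real.sqrt_sq] using this

theorem abs_conormal_le (hU : IsSolution a F U) {R M L : ℝ} (hB : Bounds a U R M L)
    (x : EuclideanSpace ℝ (Fin n)) {t : ℝ} (ht : t ∈ Ioo (-1 : ℝ) 0) : |conormal a U x t| ≤ M := by
  refine le_of_tendsto (hU.tendsto_conormal x ht.1 ht.2.le).abs ?_
  filter_upwards [self_mem_nhdsWithin] with y hy
  exact hB.weightedDy_le _ ⟨hy, by simpa using ht.1, ht.2.le⟩

theorem IsSolution.mul_conormal (hU : IsSolution a F U) (x : EuclideanSpace ℝ (Fin n)) {t : ℝ}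
    (ht : t ∈ Ioo (-1 : ℝ) 0) : U ((x, 0), t) * conormal a U x t = 0 := by
  have h := hU.signorini x t ht.1 ht.2.le
  rcases min_choice (U ((x, 0), t)) (-conormal a U x t) with h1 | h1
  · rw [← h1, h, zero_mul]
  · have : conormal a U x t = 0 := by linarith
    rw [this, mul_zero]

/-- Near a point with nonvanishing conormal derivative the solution vanishes along dilations. -/
theorem IsSolution.eventually_dil_mul_conormal (hU : IsSolution a F U)
    (x : EuclideanSpace ℝ (Fin n)) {t : ℝ} (ht : t ∈ Ioo (-1 : ℝ) 0) :
    ∀ᶠ l : ℝ in 𝓝 1, U (dil l ((x, 0), t)) * conormal a U x t = 0 := by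
  by_cases h0 : conormal a U x t = 0
  · exact Eventually.of_forall fun l => by rw [h0, mul_zero]
  · have hev : ∀ᶠ l : ℝ in 𝓝 1, l ^ 2 * t ∈ Ioo (-1 : ℝ) 0 := by
      have : ContinuousAt (fun l : ℝ => l ^ 2 * t) 1 := by fun_prop
      exact this.eventually_mem (isOpen_Ioo.mem_nhds (by simpa using ht))
    -- The conormal derivative is still nonzero at the dilated point, so complementarity there
    -- forces `U` to vanish.
    filter_upwards [hev, (hU.continuous_conormal_dil x ht).eventually_ne h0] with l hl hne
    have := hU.mul_conormal (l • x) hl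
    rw [dil_apply, mul_zero]
    rw [(mul_eq_zero.1 this).resolve_right hne, zero_mul]

/-! ### Cutoffs -/

/-- The derivative of the transition function. -/
noncomputable def cutDeriv (z : ℝ) : ℝ := deriv Real.smoothTransition z

theorem hasDerivAt_smoothTransition (z : ℝ) : HasDerivAt Real.smoothTransition (cutDeriv z) z :=
  ((Real.smoothTransition.contDiff (n := 1)).differentiable (by norm_num) z).hasDerivAt

theorem continuous_cutDeriv : Continuous cutDeriv :=
  (Real.smoothTransition.contDiff (n := 1)).continuous_deriv (by norm_num)

/-- The endpoints are included: at every such point the transition function attains its minimum `0`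
or its maximum `1`. -/
theorem cutDeriv_eq_zero {z : ℝ} (hz : z ∉ Ioo (0 : ℝ) 1) : cutDeriv z = 0 := by
  rcases le_or_gt z 0 with h | h
  · refine IsLocalMin.deriv_eq_zero (Eventually.of_forall fun y => ?_)
    rw [Real.smoothTransition.zero_of_nonpos h]; exact Real.smoothTransition.nonneg y
  · have h1 : 1 ≤ z := by
      by_contra h1
      exact hz ⟨h, not_le.1 h1⟩
    refine IsLocalMax.deriv_eq_zero (Eventually.of_forall fun y => ?_)
    rw [Real.smoothTransition.one_of_one_le h1]; exact Real.smoothTransition.le_one y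

theorem exists_abs_cutDeriv_le : ∃ C : ℝ, 0 ≤ C ∧ ∀ z, |cutDeriv z| ≤ C := by
  have hc : HasCompactSupport cutDeriv := HasCompactSupport.intro (isCompact_Icc (a := (0 : ℝ)) (b := 1))
    fun z hz => cutDeriv_eq_zero fun h => hz (Ioo_subset_Icc_self h)
  obtain ⟨C, hC⟩ := hc.exists_bound_of_continuous continuous_cutDeriv
  exact ⟨C, (norm_nonneg _).trans (hC 0), hC⟩

/-- Cutoff in `y` which vanishes for `y ≤ 1/(k+1)`. -/
noncomputable def cuty (k : ℕ) (y : ℝ) : ℝ := Real.smoothTransition ((k + 1) * y - 1)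

/-- Cutoff in `t` supported inside `(-ρ², 0)`. -/
noncomputable def cutt (ρ : ℝ) (k : ℕ) (t : ℝ) : ℝ :=
  Real.smoothTransition ((k + 1) * (-t) - 1) * Real.smoothTransition ((k + 1) * (t + ρ ^ 2) - 1)

theorem continuous_smoothTransition : Continuous Real.smoothTransition :=
  (Real.smoothTransition.contDiff (n := 0)).continuous

theorem continuous_cuty (k : ℕ) : Continuous (cuty k) :=
  continuous_smoothTransition.comp (by fun_prop)

theorem continuous_cutt (ρ : ℝ) (k : ℕ) : Continuous (cutt ρ k) :=
  (continuous_smoothTransition.comp (by fun_prop)).mul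
    (continuous_smoothTransition.comp (by fun_prop))

theorem hasDerivAt_cuty (k : ℕ) (y : ℝ) :
    HasDerivAt (cuty k) ((k + 1) * cutDeriv ((k + 1) * y - 1)) y := by
  have h : HasDerivAt (fun y : ℝ => ((k : ℝ) + 1) * y - 1) ((k : ℝ) + 1) y := by
    simpa using ((hasDerivAt_id y).const_mul ((k : ℝ) + 1)).sub_const 1
  have := (hasDerivAt_smoothTransition (((k : ℝ) + 1) * y - 1)).comp y h
  rw [mul_comm]; exact this

theorem cuty_mem (k : ℕ) (y : ℝ) : cuty k y ∈ Icc (0 : ℝ) 1 :=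
  ⟨Real.smoothTransition.nonneg _, Real.smoothTransition.le_one _⟩

theorem cutt_mem (ρ : ℝ) (k : ℕ) (t : ℝ) : cutt ρ k t ∈ Icc (0 : ℝ) 1 :=
  ⟨mul_nonneg (Real.smoothTransition.nonneg _) (Real.smoothTransition.nonneg _),
    mul_le_one₀ (Real.smoothTransition.le_one _) (Real.smoothTransition.nonneg _)
      (Real.smoothTransition.le_one _)⟩

theorem cuty_eq_zero {k : ℕ} {y : ℝ} (hy : y < 1 / ((k : ℝ) + 1)) : cuty k y = 0 := by
  have hk : (0 : ℝ) < k + 1 := by positivity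
  refine Real.smoothTransition.zero_of_nonpos ?_
  rw [lt_div_iff₀ hk] at hy; linarith

theorem cutDeriv_cuty_eq_zero {k : ℕ} {y : ℝ} (hy : y < 1 / ((k : ℝ) + 1)) :
    cutDeriv ((k + 1) * y - 1) = 0 := by
  have hk : (0 : ℝ) < k + 1 := by positivity
  refine cutDeriv_eq_zero fun h => ?_
  rw [lt_div_iff₀ hk] at hy
  linarith [h.1]

theorem cutt_eq_zero {ρ : ℝ} {k : ℕ} {t : ℝ}
    (ht : t ∉ Icc (-ρ ^ 2 + 1 / ((k : ℝ) + 1)) (-(1 / ((k : ℝ) + 1)))) : cutt ρ k t = 0 := by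
  have hk : (0 : ℝ) < k + 1 := by positivity
  by_contra h
  have h1 := left_ne_zero_of_mul h
  have h2 := right_ne_zero_of_mul h
  apply ht
  constructor
  · by_contra h3
    refine h2 (Real.smoothTransition.zero_of_nonpos ?_)
    have : t + ρ ^ 2 < 1 / ((k : ℝ) + 1) := by linarith
    rw [lt_div_iff₀ hk] at this; linarith
  · by_contra h3
    refine h1 (Real.smoothTransition.zero_of_nonpos ?_)
    have : -t < 1 / ((k : ℝ) + 1) := by linarith
    rw [lt_div_iff₀ hk] at this; linarith

theorem tendsto_smoothTransition {c : ℝ} (hc : 0 < c) :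
    Tendsto (fun k : ℕ => Real.smoothTransition ((k + 1) * c - 1)) atTop (𝓝 1) := by
  have h : Tendsto (fun k : ℕ => ((k : ℝ) + 1) * c - 1) atTop atTop :=
    tendsto_atTop_add_const_right _ _
      (((tendsto_natCast_atTop_atTop).atTop_add tendsto_const_nhds).atTop_mul_const hc)
  refine tendsto_const_nhds.congr' ?_
  filter_upwards [h.eventually_ge_atTop 1] with k hk
  rw [Real.smoothTransition.one_of_one_le hk]

theorem tendsto_cuty {y : ℝ} (hy : 0 < y) : Tendsto (fun k => cuty k y) atTop (𝓝 1) :=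
  tendsto_smoothTransition hy

theorem tendsto_cutt {ρ t : ℝ} (ht : t ∈ Ioo (-ρ ^ 2) 0) :
    Tendsto (fun k => cutt ρ k t) atTop (𝓝 1) := by
  have := (tendsto_smoothTransition (c := -t) (by linarith [ht.2])).mul
    (tendsto_smoothTransition (c := t + ρ ^ 2) (by linarith [ht.1]))
  rw [one_mul] at this
  exact this

/-! ### Integrability of the trace of the Gaussian -/

/-- The product of the unit interval in the auxiliary variable with `ℝⁿ × (-ρ², 0)`. -/
def thinBox (n : ℕ) (ρ : ℝ) : Set (SpaceTime n) := {p | p.1.2 ∈ Ioo (0 : ℝ) 1 ∧ p.2 ∈ Ioo (-ρ ^ 2) 0}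

theorem measurableSet_thinBox (n : ℕ) (ρ : ℝ) : MeasurableSet (thinBox n ρ) := by
  have h1 : Measurable fun p : SpaceTime n => p.1.2 := by fun_prop
  have h2 : Measurable fun p : SpaceTime n => p.2 := by fun_prop
  exact (h1 measurableSet_Ioo).inter (h2 measurableSet_Ioo)

/-- The function `|t| 𝒢̄_a`. -/
noncomputable def tGauss (a : ℝ) (p : SpaceTime n) : ℝ := |p.2| * gaussian a p

theorem measurable_tGauss (a : ℝ) : Measurable (tGauss (n := n) a) := by
  unfold tGauss gaussian normSqX; fun_prop

theorem tGauss_nonneg (ha : -1 < a) (p : SpaceTime n) : 0 ≤ tGauss a p :=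
  mul_nonneg (abs_nonneg _) (gaussian_nonneg ha p)

theorem tGauss_le_thin (ha : -1 < a) (x : EuclideanSpace ℝ (Fin n)) (y t : ℝ) :
    tGauss a ((x, y), t) ≤ tGauss a ((x, 0), t) := by
  have h := gaussConst_pos n ha
  unfold tGauss
  rw [gaussian_eq, gaussian_eq]
  simp only
  gcongr
  simp only [normSqX]
  nlinarith [sq_nonneg y]

/-- Integrating `|t|𝒢̄_a` at `y = 0` over `x` leaves a multiple of `|t|^((1-a)/2)`, which is bounded
because `a < 1`. -/
theorem integrableOn_tGauss_thin (ha : -1 < a) (ha' : a < 1) (ρ : ℝ) :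
    IntegrableOn (fun p : SpaceTime n => tGauss a ((p.1.1, 0), p.2)) (thinBox n ρ) := by
  have hset : thinBox n ρ = ((univ : Set (EuclideanSpace ℝ (Fin n))) ×ˢ Ioo (0 : ℝ) 1) ×ˢ
      Ioo (-ρ ^ 2) 0 := by
    ext p; simp [thinBox]
  have hmeas : Measurable fun p : SpaceTime n => tGauss a ((p.1.1, 0), p.2) :=
    (measurable_tGauss a).comp (by fun_prop)
  rw [hset, IntegrableOn, Measure.volume_eq_prod, ← Measure.prod_restrict,
    Measure.volume_eq_prod, ← Measure.prod_restrict, Measure.restrict_univ]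
  rw [integrable_prod_iff' hmeas.aestronglyMeasurable]
  set m : ℝ := -((n : ℝ) + a + 1) / 2 with hm
  have hform : ∀ (X : EuclideanSpace ℝ (Fin n) × ℝ) (t : ℝ), tGauss a ((X.1, 0), t)
      = (gaussConst n a * (|t| * |t| ^ m)) * (Real.exp (-(1 / (4 * |t|)) * ‖X.1‖ ^ 2) * 1) := by
    intro X t
    simp only [tGauss, gaussian_eq, normSqX]
    rw [mul_one]
    have : -(‖X.1‖ ^ 2 + 0 ^ 2) / (4 * |t|) = -(1 / (4 * |t|)) * ‖X.1‖ ^ 2 := by ring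
    rw [this]; ring
  have hx : ∀ s : ℝ, 0 < s → Integrable (fun x : EuclideanSpace ℝ (Fin n) =>
      Real.exp (-(1 / (4 * s)) * ‖x‖ ^ 2)) := by
    intro s hs
    have h := (GaussianFourier.integrable_cexp_neg_mul_sq_norm_add (V := EuclideanSpace ℝ (Fin n))
      (b := ((1 / (4 * s) : ℝ) : ℂ)) (by rw [Complex.ofReal_re]; positivity) 0 0).norm
    refine h.congr (ae_of_all _ fun x => ?_)
    simp only [Complex.norm_exp]
    congr 1
    rw [← Complex.ofReal_pow, zero_mul, add_zero, ← Complex.ofReal_neg, ← Complex.ofReal_mul,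
      Complex.ofReal_re]
  constructor
  · filter_upwards [ae_restrict_mem measurableSet_Ioo] with t ht
    have ht : 0 < |t| := abs_pos.2 ht.2.ne
    simp only [hform]
    exact ((hx _ ht).mul_prod (integrable_const (1 : ℝ))).const_mul _
  · have hint : ∀ t ∈ Ioo (-ρ ^ 2) 0, ∫ X, ‖tGauss (n := n) a ((X.1, 0), t)‖
        ∂((volume : Measure (EuclideanSpace ℝ (Fin n))).prod ((volume : Measure ℝ).restrict (Ioo 0 1)))
        = (gaussConst n a * (4 * Real.pi) ^ ((n : ℝ) / 2)) * (-t) ^ ((1 - a) / 2) := by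
      intro t ht
      have ht' : |t| = -t := abs_of_neg ht.2
      have ht0 : 0 < -t := by linarith [ht.2]
      have h0 : ∀ X : EuclideanSpace ℝ (Fin n) × ℝ, ‖tGauss (n := n) a ((X.1, 0), t)‖
          = tGauss (n := n) a ((X.1, 0), t) := fun X => Real.norm_of_nonneg (tGauss_nonneg ha _)
      rw [integral_congr_ae (ae_of_all _ h0)]
      simp only [hform]
      rw [integral_const_mul, integral_prod_mul
        (fun x : EuclideanSpace ℝ (Fin n) => Real.exp (-(1 / (4 * |t|)) * ‖x‖ ^ 2))
        (fun _ : ℝ => (1 : ℝ)), ht',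
        GaussianFourier.integral_rexp_neg_mul_sq_norm (by positivity), finrank_euclideanSpace_fin]
      have h1 : Real.pi / (1 / (4 * -t)) = (4 * Real.pi) * (-t) := by field_simp
      have h2 : ∫ _ : ℝ in Ioo (0 : ℝ) 1, (1 : ℝ) = 1 := by simp
      rw [h1, h2, Real.mul_rpow (by positivity) ht0.le]
      have h3 : (-t) ^ ((1 - a) / 2) = -t * (-t) ^ m * (-t) ^ ((n : ℝ) / 2) := by
        have h4 : -t * (-t) ^ m = (-t) ^ (1 + m) := by rw [Real.rpow_add ht0, Real.rpow_one]
        rw [h4, ← Real.rpow_add ht0]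
        congr 1; rw [hm]; ring
      rw [h3]; ring
    have hbase : IntegrableOn (fun t : ℝ => (-t) ^ ((1 - a) / 2)) (Ioo (-ρ ^ 2) 0) := by
      have hc : Continuous fun t : ℝ => (-t) ^ ((1 - a) / 2) :=
        continuous_neg.rpow_const fun _ => Or.inr (by linarith)
      exact (hc.integrableOn_Icc).mono_set Ioo_subset_Icc_self
    exact (integrableOn_congr_fun hint measurableSet_Ioo).2 (hbase.const_mul _)

end

/-! ### Admissible multipliers and the weak formulation in Gaussian space -/

/-- The open slab `{y > 0, -ρ² < t < 0}`. -/
def openSlab (n : ℕ) (ρ : ℝ) : Set (SpaceTime n) := {p | 0 < p.1.2 ∧ p.2 ∈ Ioo (-ρ ^ 2) 0}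

/-- The slab `{y ≥ 0, -ρ² < t < 0}`. -/
def slab (n : ℕ) (ρ : ℝ) : Set (SpaceTime n) := {p | 0 ≤ p.1.2 ∧ p.2 ∈ Ioo (-ρ ^ 2) 0}

theorem isOpen_openSlab (n : ℕ) (ρ : ℝ) : IsOpen (openSlab n ρ) := by
  have h1 : IsOpen {p : SpaceTime n | 0 < p.1.2} := isOpen_lt continuous_const (by fun_prop)
  have h2 : IsOpen {p : SpaceTime n | p.2 ∈ Ioo (-ρ ^ 2) 0} := isOpen_Ioo.preimage (by fun_prop)
  exact h1.inter h2

theorem openSlab_subset_slab (n : ℕ) (ρ : ℝ) : openSlab n ρ ⊆ slab n ρ :=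
  fun _ hp => ⟨hp.1.le, hp.2⟩

theorem openSlab_subset_openStrip (n : ℕ) {ρ : ℝ} (hρ : ρ ∈ Icc (0 : ℝ) 1) :
    openSlab n ρ ⊆ openStrip n := fun p hp =>
  ⟨hp.1, by nlinarith [hp.2.1, hρ.1, hρ.2], hp.2.2⟩

theorem openSlab_subset_strip (n : ℕ) (ρ : ℝ) : openSlab n ρ ⊆ strip n ρ := fun _ hp =>
  ⟨hp.1, hp.2.1, hp.2.2.le⟩

theorem openSlab_ae_eq_strip (n : ℕ) (ρ : ℝ) : openSlab n ρ =ᵐ[volume] strip n ρ := by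
  have h := strip_ae_eq_inter (n := n) ρ
  rw [ae_restrict_iff' (measurableSet_strip n ρ)] at h
  filter_upwards [h] with p hp
  refine propext ⟨fun h1 => openSlab_subset_strip n ρ h1, fun h1 => ⟨h1.1, h1.2.1, hp h1⟩⟩

theorem slab_subset_stripWithThin (n : ℕ) {ρ : ℝ} (hρ : ρ ∈ Icc (0 : ℝ) 1) :
    slab n ρ ⊆ stripWithThin n := fun p hp =>
  ⟨hp.1, by nlinarith [hp.2.1, hρ.1, hρ.2], hp.2.2.le⟩

/-- Bounded functions of bounded support, continuous up to the thin set, of class `C¹` in `X`,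
with bounds as those of a solution. -/
structure Adm {n : ℕ} (a ρ : ℝ) (ψ : SpaceTime n → ℝ)
    (gx : SpaceTime n → EuclideanSpace ℝ (Fin n)) (gy : SpaceTime n → ℝ) : Prop where
  cont : ContinuousOn ψ (slab n ρ)
  grad : ∀ p ∈ openSlab n ρ, HasGradientAt (fun x => ψ ((x, p.1.2), p.2)) (gx p) p.1.1
  deriv : ∀ p ∈ openSlab n ρ, HasDerivAt (fun y => ψ ((p.1.1, y), p.2)) (gy p) p.1.2
  cont_gx : ContinuousOn gx (openSlab n ρ)
  cont_gy : ContinuousOn gy (openSlab n ρ)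
  bound : ∃ M : ℝ, 0 ≤ M ∧ (∀ p ∈ slab n ρ, |ψ p| ≤ M) ∧ (∀ p ∈ openSlab n ρ, ‖gx p‖ ≤ M) ∧
    (∀ p ∈ openSlab n ρ, |gy p| ≤ M * p.1.2 ^ (-a))
  supp : ∃ R : ℝ, ∀ p ∈ slab n ρ, R < normSqX p.1 → ψ p = 0

section
variable {n : ℕ} {a : ℝ} {F U : SpaceTime n → ℝ}

theorem Adm.sub {ρ : ℝ} {ψ ψ' : SpaceTime n → ℝ} {gx gx' : SpaceTime n → EuclideanSpace ℝ (Fin n)}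
    {gy gy' : SpaceTime n → ℝ} (h : Adm a ρ ψ gx gy) (h' : Adm a ρ ψ' gx' gy') :
    Adm a ρ (fun p => ψ p - ψ' p) (fun p => gx p - gx' p) (fun p => gy p - gy' p) := by
  obtain ⟨M, hM, h1, h2, h3⟩ := h.bound
  obtain ⟨M', hM', h1', h2', h3'⟩ := h'.bound
  obtain ⟨R, hR⟩ := h.supp
  obtain ⟨R', hR'⟩ := h'.supp
  refine ⟨h.cont.sub h'.cont, fun p hp => ?_, fun p hp => (h.deriv p hp).sub (h'.deriv p hp),
    h.cont_gx.sub h'.cont_gx, h.cont_gy.sub h'.cont_gy, ⟨M + M', by positivity, fun p hp => ?_,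
    fun p hp => ?_, fun p hp => ?_⟩, ⟨max R R', fun p hp hlt => ?_⟩⟩
  · have := (h.grad p hp).hasFDerivAt.sub (h'.grad p hp).hasFDerivAt
    rw [← map_sub] at this
    exact this
  · exact (abs_sub _ _).trans (add_le_add (h1 p hp) (h1' p hp))
  · exact (norm_sub_le _ _).trans (add_le_add (h2 p hp) (h2' p hp))
  · rw [add_mul]
    exact (abs_sub _ _).trans (add_le_add (h3 p hp) (h3' p hp))
  · rw [hR p hp ((le_max_left _ _).trans_lt hlt), hR' p hp ((le_max_right _ _).trans_lt hlt),
      sub_zero]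

/-- Continuity is available for `t > -1` only. For `r < 1` the support in the closed slab `-r² ≤ t ≤
0` is contained in a compact subset of the domain of continuity; this is where strips strictly
smaller than the unit one are required. -/
theorem exists_bound_of_supp (hUc : ContinuousOn U (stripWithThin n)) {R : ℝ}
    (hR : ∀ p ∈ stripWithThin n, R < normSqX p.1 → U p = 0) {r : ℝ} (hr : r < 1) (hr0 : 0 ≤ r) :
    ∃ M : ℝ, 0 ≤ M ∧ ∀ p ∈ slab n r, |U p| ≤ M := by
  set K : Set (SpaceTime n) := {p | 0 ≤ p.1.2 ∧ normSqX p.1 ≤ R ∧ p.2 ∈ Icc (-r ^ 2) 0} with hK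
  have hKc : IsCompact K := by
    refine Metric.isCompact_of_isClosed_isBounded ?_ ?_
    · have h1 : IsClosed {p : SpaceTime n | 0 ≤ p.1.2} := isClosed_le continuous_const (by fun_prop)
      have h2 : IsClosed {p : SpaceTime n | normSqX p.1 ≤ R} :=
        isClosed_le (continuous_normSqX.comp continuous_fst) continuous_const
      have h3 : IsClosed {p : SpaceTime n | p.2 ∈ Icc (-r ^ 2) 0} := isClosed_Icc.preimage (by fun_prop)
      exact h1.inter (h2.inter h3)
    · refine (Metric.isBounded_iff_subset_closedBall 0).2 ⟨max (max (√R) (√R)) 1, fun p hp => ?_⟩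
      have hN : ‖p.1.1‖ ^ 2 + p.1.2 ^ 2 ≤ R := hp.2.1
      rw [mem_closedBall_zero_iff, Prod.norm_def, Prod.norm_def]
      refine max_le_max (max_le_max ?_ ?_) ?_
      · exact Real.le_sqrt_of_sq_le (by nlinarith [sq_nonneg p.1.2])
      · rw [Real.norm_of_nonneg hp.1]
        exact Real.le_sqrt_of_sq_le (by nlinarith [sq_nonneg ‖p.1.1‖])
      · rw [Real.norm_eq_abs, abs_of_nonpos hp.2.2.2]; nlinarith [hp.2.2.1]
  have hKs : K ⊆ stripWithThin n := fun p hp => ⟨hp.1, by nlinarith [hp.2.2.1], hp.2.2.2⟩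
  obtain ⟨C, hC⟩ := hKc.exists_bound_of_continuousOn (hUc.mono hKs)
  refine ⟨max C 0, le_max_right _ _, fun p hp => ?_⟩
  by_cases h : R < normSqX p.1
  · rw [hR p ⟨hp.1, by nlinarith [hp.2.1], hp.2.2.le⟩ h, abs_zero]; exact le_max_right _ _
  · exact (hC p ⟨hp.1, not_lt.1 h, hp.2.1.le, hp.2.2.le⟩).trans (le_max_left _ _)

theorem dil_mem_slab {l ρ : ℝ} (hl : 0 < l) {p : SpaceTime n} (hp : p ∈ slab n ρ) :
    dil l p ∈ slab n (l * ρ) := by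
  have h2 : 0 < l ^ 2 := by positivity
  have hp1 := hp.1
  rw [dil_apply]
  exact ⟨by positivity, by rw [mul_pow]; nlinarith [hp.2.1], by nlinarith [hp.2.2]⟩

theorem dil_mem_openSlab {l ρ : ℝ} (hl : 0 < l) {p : SpaceTime n} (hp : p ∈ openSlab n ρ) :
    dil l p ∈ openSlab n (l * ρ) := by
  have h2 : 0 < l ^ 2 := by positivity
  have hp1 := hp.1
  rw [dil_apply]
  exact ⟨by positivity, by rw [mul_pow]; nlinarith [hp.2.1], by nlinarith [hp.2.2]⟩

/-- Dilations of a solution are admissible. -/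
theorem IsSolution.adm_dil (hU : IsSolution a F U) {l ρ : ℝ} (hl : 0 < l) (hρ : 0 ≤ ρ)
    (hlρ : l * ρ < 1) :
    Adm a ρ (fun p => U (dil l p)) (fun p => l • gradx U (dil l p)) (fun p => l * dy U (dil l p)) := by
  obtain ⟨R, M, L, hB⟩ := hU.exists_bounds
  have hmem : l * ρ ∈ Icc (0 : ℝ) 1 := ⟨by positivity, hlρ.le⟩
  have hin : ∀ p ∈ slab n ρ, dil l p ∈ stripWithThin n := fun p hp =>
    slab_subset_stripWithThin n hmem (dil_mem_slab hl hp)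
  have hin' : ∀ p ∈ openSlab n ρ, dil l p ∈ strip n 1 := fun p hp =>
    openStrip_subset_strip n (openSlab_subset_openStrip n hmem (dil_mem_openSlab hl hp))
  obtain ⟨M', hM', hb⟩ := exists_bound_of_supp hU.continuousOn hB.supp hlρ hmem.1
  refine ⟨hU.continuousOn.comp (continuous_dil l).continuousOn hin, fun p hp => ?_, fun p hp => ?_,
    (hU.continuousOn_gradx.comp (continuous_dil l).continuousOn hin').const_smul l,
    continuousOn_const.mul (hU.continuousOn_dy.comp (continuous_dil l).continuousOn hin'),
    ⟨max M' (max (l * M) (l * M * l ^ (-a))), ?_, fun p hp => ?_, fun p hp => ?_, fun p hp => ?_⟩,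
    ⟨R / l ^ 2, fun p hp hlt => ?_⟩⟩
  · have h1 := (hU.hasGradientAt (hin' p hp)).hasFDerivAt
    have h2 : HasFDerivAt (fun x : EuclideanSpace ℝ (Fin n) => l • x)
        (l • ContinuousLinearMap.id ℝ _) p.1.1 := (hasFDerivAt_id p.1.1).const_smul l
    rw [dil_apply] at h1
    have h3 := h1.comp p.1.1 h2
    rw [hasGradientAt_iff_hasFDerivAt]
    have h4 : (fun x => U (dil l ((x, p.1.2), p.2)))
        = (fun x => U ((x, l * p.1.2), l ^ 2 * p.2)) ∘ fun x : EuclideanSpace ℝ (Fin n) => l • x := by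
      ext x; simp [dil_apply]
    rw [h4, dil_apply]
    refine h3.congr_fderiv ?_
    ext v; simp
  · have h1 := hU.hasDerivAt_y (hin' p hp)
    have h2 : HasDerivAt (fun y : ℝ => l * y) l p.1.2 := by
      simpa using (hasDerivAt_id p.1.2).const_mul l
    rw [dil_apply] at h1
    have h3 := h1.comp p.1.2 h2
    have h4 : (fun y => U (dil l ((p.1.1, y), p.2)))
        = (fun y => U ((l • p.1.1, y), l ^ 2 * p.2)) ∘ fun y : ℝ => l * y := by
      ext x; simp [dil_apply]
    rw [h4, dil_apply]
    exact h3.congr_deriv (mul_comm _ _)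
  · exact hM'.trans (le_max_left _ _)
  · exact (hb _ (dil_mem_slab hl hp)).trans (le_max_left _ _)
  · rw [norm_smul, Real.norm_of_nonneg hl.le]
    exact (mul_le_mul_of_nonneg_left (hB.gradx_le _ (hin' p hp)) hl.le).trans
      ((le_max_left _ _).trans (le_max_right _ _))
  · rw [abs_mul, abs_of_pos hl]
    have h1 := abs_dy_le hB (hin' p hp)
    have h2 : (dil l p).1.2 = l * p.1.2 := by rw [dil_apply]
    rw [h2, Real.mul_rpow hl.le hp.1.le] at h1
    calc l * |dy U (dil l p)| ≤ l * (M * (l ^ (-a) * p.1.2 ^ (-a))) := by gcongr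
      _ = (l * M * l ^ (-a)) * p.1.2 ^ (-a) := by ring
      _ ≤ _ := mul_le_mul_of_nonneg_right ((le_max_right _ _).trans (le_max_right _ _))
        (Real.rpow_nonneg hp.1.le _)
  · refine hB.supp _ (hin p hp) ?_
    rw [normSqX_dil]
    rw [div_lt_iff₀ (by positivity)] at hlt
    linarith

theorem dil_one (p : SpaceTime n) : dil 1 p = p := by rw [dil_apply]; simp

theorem IsSolution.adm (hU : IsSolution a F U) {ρ : ℝ} (hρ : ρ ∈ Ico (0 : ℝ) 1) :
    Adm a ρ U (gradx U) (dy U) := by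
  simpa [dil_one] using hU.adm_dil one_pos hρ.1 (by simpa using hρ.2)

/-- The integrand of the weak formulation in Gaussian space. -/
noncomputable def gaussForm (a : ℝ) (F U ψ : SpaceTime n → ℝ)
    (gx : SpaceTime n → EuclideanSpace ℝ (Fin n)) (gy : SpaceTime n → ℝ) (p : SpaceTime n) : ℝ :=
  (|p.2| * (inner ℝ (gradx U p) (gx p) + dy U p * gy p)
    - (1 / 2 * Zfield U p + |p.2| * F p) * ψ p) * weight a p

/-- The contribution of the thin set to the weak formulation in Gaussian space. -/
noncomputable def thinTerm (a ρ : ℝ) (U ψ : SpaceTime n → ℝ) : ℝ :=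
  ∫ p in thinBox n ρ, cutDeriv p.1.2 *
    (tGauss a ((p.1.1, 0), p.2) * (ψ ((p.1.1, 0), p.2) * conormal a U p.1.1 p.2))

/-- Integrability of the weight occurring in the estimate of the energy. -/
theorem integrableOn_energyWeight (ha' : a < 1) (ρ : ℝ) :
    IntegrableOn (fun p : SpaceTime n => |p.2| * weight a p * p.1.2 ^ (-(2 * a))) (strip n ρ) := by
  have h : IntegrableOn (fun p : SpaceTime n => gaussConst n a *
      profile (-((n : ℝ) + a + 1) / 2 + 1) (-a) (1 / 4) p) (strip n ρ) :=
    -- Here the power of `y` is `y^(-a)`, integrable at `0` for `a < 1`, and the power of `|t|` left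
    -- after integrating in `X` is `1 - a`.
    (integrableOn_profile (by linarith) (by norm_num) (by ring_nf; linarith) ρ).const_mul _
  refine IntegrableOn.congr_set_ae ?_ (openSlab_ae_eq_strip n ρ).symm
  refine IntegrableOn.congr_fun (h.mono_set (openSlab_subset_strip n ρ)) (fun p hp => ?_)
    (isOpen_openSlab n ρ).measurableSet
  have ht : 0 < |p.2| := abs_pos.2 hp.2.2.ne
  rw [weight_eq_profile]
  unfold profile
  rw [Real.rpow_add ht, Real.rpow_one, show -a = a + -(2 * a) by ring, Real.rpow_add hp.1]
  ring

theorem aestronglyMeasurable_Zfield (hU : IsSolution a F U) {ρ : ℝ} (hρ : ρ ∈ Icc (0 : ℝ) 1) :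
    AEStronglyMeasurable (Zfield U) (volume.restrict (openSlab n ρ)) := by
  have hsub := openSlab_subset_openStrip n hρ
  have hm := (isOpen_openSlab n ρ).measurableSet
  have h1 : ContinuousOn (fun p : SpaceTime n => inner ℝ p.1.1 (gradx U p) + p.1.2 * dy U p)
      (openSlab n ρ) := by
    have c1 := hU.continuousOn_gradx.mono (hsub.trans (openStrip_subset_strip n))
    have c2 := hU.continuousOn_dy.mono (hsub.trans (openStrip_subset_strip n))
    have c3 : Continuous fun p : SpaceTime n => p.1.1 := by fun_prop
    have c4 : Continuous fun p : SpaceTime n => p.1.2 := by fun_prop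
    exact (c3.continuousOn.inner c1).add (c4.continuousOn.mul c2)
  have h2 : AEStronglyMeasurable (dt U) (volume.restrict (openSlab n ρ)) :=
    hU.time_deriv.2.1.mono_measure
      (Measure.restrict_mono (hsub.trans (openStrip_subset_strip n)) le_rfl)
  have h3 : Continuous fun p : SpaceTime n => 2 * p.2 := by fun_prop
  exact (h1.aestronglyMeasurable hm).add (h3.aestronglyMeasurable.mul h2)

/-- Integrability against the Gaussian weight of bounded measurable functions. -/
theorem integrableOn_bdd_mul_weight (ha : -1 < a) {ρ : ℝ} {f : SpaceTime n → ℝ}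
    (hf : AEStronglyMeasurable f (volume.restrict (openSlab n ρ))) {C : ℝ}
    (hC : ∀ᵐ p ∂(volume.restrict (openSlab n ρ)), |f p| ≤ C) :
    IntegrableOn (fun p => f p * weight a p) (strip n ρ) := by
  rw [IntegrableOn, ← Measure.restrict_congr_set (openSlab_ae_eq_strip n ρ)]
  have := (integrableOn_weight ha ρ).mono_set (openSlab_subset_strip n ρ)
  exact Integrable.bdd_mul this hf hC

theorem ae_openSlab_of_ae {P : SpaceTime n → Prop} {ρ : ℝ} (hρ : ρ ∈ Icc (0 : ℝ) 1)
    (h : ∀ᵐ p : SpaceTime n, p ∈ openStrip n → P p) :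
    ∀ᵐ p ∂(volume.restrict (openSlab n ρ)), P p := by
  filter_upwards [ae_restrict_of_ae h, ae_restrict_mem (isOpen_openSlab n ρ).measurableSet]
    with p hp hps using hp (openSlab_subset_openStrip n hρ hps)

/-- Boundedness of the factor multiplying the test function. -/
theorem exists_ae_bound_source (ha : -1 < a) (ha' : a < 1) (hU : IsSolution a F U)
    (hF : MemLp F ⊤ (volume.restrict (strip n 1))) {ρ : ℝ} (hρ : ρ ∈ Icc (0 : ℝ) 1) :
    AEStronglyMeasurable (fun p => 1 / 2 * Zfield U p + |p.2| * F p)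
      (volume.restrict (openSlab n ρ)) ∧
    ∃ C : ℝ, 0 ≤ C ∧ ∀ᵐ p ∂(volume.restrict (openSlab n ρ)),
      |1 / 2 * Zfield U p + |p.2| * F p| ≤ C := by
  obtain ⟨CF, hCF0, hCF⟩ := exists_ae_bound hF
  obtain ⟨C, hC0, hC⟩ := exists_dil_lipschitz ha ha' hU
  have hsub := (openSlab_subset_openStrip n hρ).trans (openStrip_subset_strip n)
  constructor
  · have h1 := aestronglyMeasurable_Zfield hU hρ
    have h2 : AEStronglyMeasurable F (volume.restrict (openSlab n ρ)) :=
      hF.1.mono_measure (Measure.restrict_mono hsub le_rfl)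
    have h3 : Continuous fun p : SpaceTime n => |p.2| := by fun_prop
    exact (aestronglyMeasurable_const.mul h1).add (h3.aestronglyMeasurable.mul h2)
  · refine ⟨1 / 2 * C + CF, by positivity, ?_⟩
    filter_upwards [ae_openSlab_of_ae hρ (ae_abs_Zfield_le hU hC),
      ae_restrict_of_ae_restrict_of_subset hsub hCF,
      ae_restrict_mem (isOpen_openSlab n ρ).measurableSet] with p h1 h2 h3
    have ht : |p.2| ≤ 1 := by
      rw [abs_of_neg h3.2.2]; nlinarith [h3.2.1, hρ.1, hρ.2]
    calc |1 / 2 * Zfield U p + |p.2| * F p| ≤ |1 / 2 * Zfield U p| + |(|p.2| * F p)| := abs_add_le _ _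
      _ = 1 / 2 * |Zfield U p| + |p.2| * |F p| := by
          rw [abs_mul, abs_mul, abs_abs, abs_of_pos (by norm_num : (0 : ℝ) < 1 / 2)]
      _ ≤ 1 / 2 * C + 1 * CF := by gcongr
      _ = _ := by ring

/-- The `y` derivatives are each of order `y^(-a)`, so their product against the weight is
controlled by `integrableOn_energyWeight`; the `x` derivatives are bounded. -/
theorem integrableOn_grad_mul_grad (ha : -1 < a) (ha' : a < 1) {ρ : ℝ} (hρ : ρ ∈ Icc (0 : ℝ) 1)
    {ψ ψ' : SpaceTime n → ℝ} {gx gx' : SpaceTime n → EuclideanSpace ℝ (Fin n)}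
    {gy gy' : SpaceTime n → ℝ} (h : Adm a ρ ψ gx gy) (h' : Adm a ρ ψ' gx' gy') :
    IntegrableOn (fun p => |p.2| * (inner ℝ (gx p) (gx' p) + gy p * gy' p) * weight a p)
      (strip n ρ) := by
  obtain ⟨M, hM, -, h2, h3⟩ := h.bound
  obtain ⟨M', hM', -, h2', h3'⟩ := h'.bound
  have hdom : IntegrableOn (fun p : SpaceTime n => M * M' * weight a p +
      M * M' * (|p.2| * weight a p * p.1.2 ^ (-(2 * a)))) (strip n ρ) :=
    ((integrableOn_weight ha ρ).const_mul _).add ((integrableOn_energyWeight ha' ρ).const_mul _)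
  rw [IntegrableOn, ← Measure.restrict_congr_set (openSlab_ae_eq_strip n ρ)] at hdom ⊢
  refine hdom.mono' ?_ ?_
  · have hm := (isOpen_openSlab n ρ).measurableSet
    have hc : ContinuousOn (fun p : SpaceTime n => |p.2| * (inner ℝ (gx p) (gx' p) + gy p * gy' p))
        (openSlab n ρ) := by
      have c1 : Continuous fun p : SpaceTime n => |p.2| := by fun_prop
      exact c1.continuousOn.mul ((h.cont_gx.inner h'.cont_gx).add (h.cont_gy.mul h'.cont_gy))
    exact (hc.aestronglyMeasurable hm).mul (measurable_weight a).aestronglyMeasurable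
  · filter_upwards [ae_restrict_mem (isOpen_openSlab n ρ).measurableSet] with p hp
    have hw := weight_nonneg ha hp.1
    have ht : |p.2| ≤ 1 := by
      rw [abs_of_neg hp.2.2]; nlinarith [hp.2.1, hρ.1, hρ.2]
    have e1 : |inner ℝ (gx p) (gx' p)| ≤ M * M' := (abs_real_inner_le_norm _ _).trans
      (mul_le_mul (h2 p hp) (h2' p hp) (norm_nonneg _) hM)
    have e2 : |gy p * gy' p| ≤ M * M' * p.1.2 ^ (-(2 * a)) := by
      rw [abs_mul]
      calc |gy p| * |gy' p| ≤ (M * p.1.2 ^ (-a)) * (M' * p.1.2 ^ (-a)) :=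
            mul_le_mul (h3 p hp) (h3' p hp) (abs_nonneg _)
              (mul_nonneg hM (Real.rpow_nonneg hp.1.le _))
        _ = M * M' * (p.1.2 ^ (-a) * p.1.2 ^ (-a)) := by ring
        _ = _ := by rw [← Real.rpow_add hp.1]; congr 2; ring
    rw [Real.norm_eq_abs, abs_mul, abs_mul, abs_abs, abs_of_nonneg hw]
    calc |p.2| * |inner ℝ (gx p) (gx' p) + gy p * gy' p| * weight a p
        ≤ |p.2| * (M * M' + M * M' * p.1.2 ^ (-(2 * a))) * weight a p := by
          gcongr
          exact (abs_add_le _ _).trans (add_le_add e1 e2)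
      _ = |p.2| * (M * M' * weight a p) + M * M' * (|p.2| * weight a p * p.1.2 ^ (-(2 * a))) := by
          ring
      _ ≤ 1 * (M * M' * weight a p) + M * M' * (|p.2| * weight a p * p.1.2 ^ (-(2 * a))) := by
          gcongr
      _ = _ := by ring

theorem integrableOn_source_mul (ha : -1 < a) (ha' : a < 1) (hU : IsSolution a F U)
    (hF : MemLp F ⊤ (volume.restrict (strip n 1))) {ρ : ℝ} (hρ : ρ ∈ Icc (0 : ℝ) 1)
    {ψ : SpaceTime n → ℝ} {gx : SpaceTime n → EuclideanSpace ℝ (Fin n)}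
    {gy : SpaceTime n → ℝ} (h : Adm a ρ ψ gx gy) :
    IntegrableOn (fun p => (1 / 2 * Zfield U p + |p.2| * F p) * ψ p * weight a p) (strip n ρ) := by
  obtain ⟨M, hM, h1, -, -⟩ := h.bound
  obtain ⟨hm, C, hC0, hC⟩ := exists_ae_bound_source ha ha' hU hF hρ
  refine integrableOn_bdd_mul_weight ha (C := C * M) (hm.mul
    ((h.cont.mono (openSlab_subset_slab n ρ)).aestronglyMeasurable
      (isOpen_openSlab n ρ).measurableSet)) ?_
  filter_upwards [hC, ae_restrict_mem (isOpen_openSlab n ρ).measurableSet] with p hp hps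
  rw [abs_mul]
  exact mul_le_mul hp (h1 p (openSlab_subset_slab n ρ hps)) (abs_nonneg _) hC0

theorem integrableOn_gaussForm (ha : -1 < a) (ha' : a < 1) (hU : IsSolution a F U)
    (hF : MemLp F ⊤ (volume.restrict (strip n 1))) {ρ : ℝ} (hρ : ρ ∈ Ico (0 : ℝ) 1)
    {ψ : SpaceTime n → ℝ} {gx : SpaceTime n → EuclideanSpace ℝ (Fin n)}
    {gy : SpaceTime n → ℝ} (h : Adm a ρ ψ gx gy) :
    IntegrableOn (gaussForm a F U ψ gx gy) (strip n ρ) := by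
  have hρ' := Ico_subset_Icc_self hρ
  have := (integrableOn_grad_mul_grad ha ha' hρ' (hU.adm hρ) h).sub
    (integrableOn_source_mul ha ha' hU hF hρ' h)
  refine this.congr (ae_of_all _ fun p => ?_)
  simp only [gaussForm, Pi.sub_apply]; ring

end

/-! ### Testing the equation with cut off Gaussian multiples -/

section
variable {n : ℕ} {a : ℝ} {F U : SpaceTime n → ℝ}

/-- The factor `|t|` makes the gradient `tGauss · X / (2t) = -½ 𝒢̄_a X`. This is the source of the
spatial part of `½ ZU` in the Gaussian weak formulation; the time part comes from `U_t`. -/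
theorem hasGradientAt_tGauss (a : ℝ) (x : EuclideanSpace ℝ (Fin n)) (y : ℝ) {t : ℝ} (ht : t < 0) :
    HasGradientAt (fun x => tGauss a ((x, y), t)) ((tGauss a ((x, y), t) / (2 * t)) • x) x := by
  rw [hasGradientAt_iff_hasFDerivAt]
  have h1 : HasFDerivAt (fun x : EuclideanSpace ℝ (Fin n) => ‖x‖ ^ 2) (2 • innerSL ℝ x) x :=
    (hasStrictFDerivAt_norm_sq x).hasFDerivAt
  have h2 := (((h1.add_const (y ^ 2)).neg.mul_const ((4 * |t|)⁻¹)).exp).const_mul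
    (|t| * (gaussConst n a * |t| ^ (-((n : ℝ) + a + 1) / 2)))
  have h3 : (fun x => tGauss a ((x, y), t)) = fun x : EuclideanSpace ℝ (Fin n) =>
      |t| * (gaussConst n a * |t| ^ (-((n : ℝ) + a + 1) / 2)) *
        Real.exp (-(‖x‖ ^ 2 + y ^ 2) * (4 * |t|)⁻¹) := by
    ext x; simp only [tGauss, gaussian_eq, normSqX, div_eq_mul_inv]; ring
  rw [h3]
  refine h2.congr_fderiv ?_
  have h4 : tGauss a ((x, y), t) = |t| * (gaussConst n a * |t| ^ (-((n : ℝ) + a + 1) / 2)) *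
        Real.exp (-(‖x‖ ^ 2 + y ^ 2) * (4 * |t|)⁻¹) := congrFun h3 x
  ext v
  have h5 := congrFun h3 x
  rw [h5, abs_of_neg ht]
  simp
  field_simp
  ring

theorem hasDerivAt_tGauss (a : ℝ) (x : EuclideanSpace ℝ (Fin n)) (y : ℝ) {t : ℝ} (ht : t < 0) :
    HasDerivAt (fun y => tGauss a ((x, y), t)) (tGauss a ((x, y), t) / (2 * t) * y) y := by
  have h1 : HasDerivAt (fun y : ℝ => y ^ 2) (2 * y) y := by
    simpa using hasDerivAt_pow 2 y
  have h2 := (((h1.const_add (‖x‖ ^ 2)).neg.mul_const ((4 * |t|)⁻¹)).exp).const_mul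
    (|t| * (gaussConst n a * |t| ^ (-((n : ℝ) + a + 1) / 2)))
  have h3 : (fun y => tGauss a ((x, y), t)) = fun y : ℝ =>
      |t| * (gaussConst n a * |t| ^ (-((n : ℝ) + a + 1) / 2)) *
        Real.exp (-(‖x‖ ^ 2 + y ^ 2) * (4 * |t|)⁻¹) := by
    ext x; simp only [tGauss, gaussian_eq, normSqX, div_eq_mul_inv]; ring
  rw [h3]
  refine h2.congr_deriv ?_
  have h5 := congrFun h3 y
  simp only [Pi.neg_apply]
  rw [h5, abs_of_neg ht]
  generalize Real.exp (-(‖x‖ ^ 2 + y ^ 2) * (4 * -t)⁻¹) = E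
  have ht0 : t ≠ 0 := ht.ne
  field_simp
  ring

theorem continuousOn_tGauss (a : ℝ) : ContinuousOn (tGauss (n := n) a) {p | p.2 < 0} := by
  intro p hp
  have ht : |p.2| ≠ 0 := abs_ne_zero.2 (ne_of_lt hp)
  have h1 : ContinuousAt (fun p : SpaceTime n => |p.2|) p := by fun_prop
  have h2 : ContinuousAt (fun p : SpaceTime n => -(normSqX p.1)) p :=
    (continuous_normSqX.comp continuous_fst).neg.continuousAt
  have h3 : ContinuousAt (fun p : SpaceTime n => Real.exp (-(normSqX p.1) / (4 * |p.2|))) p :=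
    (h2.div (continuousAt_const.mul h1) (mul_ne_zero four_ne_zero ht)).rexp
  exact (h1.mul ((continuousAt_const.mul (h1.rpow_const (Or.inl ht))).mul h3)).continuousWithinAt

/-- The cut off test function. -/
noncomputable def cutTest (a ρ : ℝ) (k : ℕ) (ψ : SpaceTime n → ℝ) (p : SpaceTime n) : ℝ :=
  cutt ρ k p.2 * cuty k p.1.2 * (tGauss a p * ψ p)

/-- The gradient in `x` of the cut off test function. -/
noncomputable def cutTestx (a ρ : ℝ) (k : ℕ) (ψ : SpaceTime n → ℝ)
    (gx : SpaceTime n → EuclideanSpace ℝ (Fin n)) (p : SpaceTime n) : EuclideanSpace ℝ (Fin n) :=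
  (cutt ρ k p.2 * cuty k p.1.2) •
    (tGauss a p • gx p + (ψ p * (tGauss a p / (2 * p.2))) • p.1.1)

/-- The derivative in `y` of the cut off test function. -/
noncomputable def cutTesty (a ρ : ℝ) (k : ℕ) (ψ gy : SpaceTime n → ℝ) (p : SpaceTime n) : ℝ :=
  cutt ρ k p.2 * cuty k p.1.2 * (tGauss a p * gy p + ψ p * (tGauss a p / (2 * p.2) * p.1.2))
    + cutt ρ k p.2 * ((k + 1) * cutDeriv ((k + 1) * p.1.2 - 1)) * (tGauss a p * ψ p)

/-- The compact set carrying the cut off test function. -/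
def cutSet (n : ℕ) (R ρ : ℝ) (k : ℕ) : Set (SpaceTime n) :=
  {p | 1 / ((k : ℝ) + 1) ≤ p.1.2 ∧ normSqX p.1 ≤ R ∧
    p.2 ∈ Icc (-ρ ^ 2 + 1 / ((k : ℝ) + 1)) (-(1 / ((k : ℝ) + 1)))}

theorem isCompact_cutSet (n : ℕ) (R ρ : ℝ) (k : ℕ) : IsCompact (cutSet n R ρ k) := by
  refine Metric.isCompact_of_isClosed_isBounded ?_ ?_
  · have h1 : IsClosed {p : SpaceTime n | 1 / ((k : ℝ) + 1) ≤ p.1.2} :=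
      isClosed_le continuous_const (by fun_prop)
    have h2 : IsClosed {p : SpaceTime n | normSqX p.1 ≤ R} :=
      isClosed_le (continuous_normSqX.comp continuous_fst) continuous_const
    have h3 : IsClosed {p : SpaceTime n | p.2 ∈ Icc (-ρ ^ 2 + 1 / ((k : ℝ) + 1))
        (-(1 / ((k : ℝ) + 1)))} := isClosed_Icc.preimage (by fun_prop)
    exact h1.inter (h2.inter h3)
  · refine (Metric.isBounded_iff_subset_closedBall 0).2 ⟨max (max (√R) (√R)) (ρ ^ 2), fun p hp => ?_⟩
    have hN : ‖p.1.1‖ ^ 2 + p.1.2 ^ 2 ≤ R := hp.2.1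
    have hk : 0 < 1 / ((k : ℝ) + 1) := by positivity
    rw [mem_closedBall_zero_iff, Prod.norm_def, Prod.norm_def]
    refine max_le_max (max_le_max ?_ ?_) ?_
    · exact Real.le_sqrt_of_sq_le (by nlinarith [sq_nonneg p.1.2])
    · rw [Real.norm_of_nonneg (hk.le.trans hp.1)]
      exact Real.le_sqrt_of_sq_le (by nlinarith [sq_nonneg ‖p.1.1‖])
    · rw [Real.norm_eq_abs, abs_of_nonpos (by linarith [hp.2.2.2])]; linarith [hp.2.2.1]

theorem cutSet_subset_openSlab (n : ℕ) (R ρ : ℝ) (k : ℕ) : cutSet n R ρ k ⊆ openSlab n ρ := by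
  intro p hp
  have hk : 0 < 1 / ((k : ℝ) + 1) := by positivity
  exact ⟨hk.trans_le hp.1, by linarith [hp.2.2.1], by linarith [hp.2.2.2]⟩

theorem cutt_mul_cuty_eq_zero {ρ : ℝ} {k : ℕ} {p : SpaceTime n} (hp : p ∉ openSlab n ρ) :
    cutt ρ k p.2 * cuty k p.1.2 = 0 := by
  have hk : 0 < 1 / ((k : ℝ) + 1) := by positivity
  by_cases hy : p.1.2 < 1 / ((k : ℝ) + 1)
  · rw [cuty_eq_zero hy, mul_zero]
  · rw [cutt_eq_zero, zero_mul]
    intro h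
    exact hp ⟨hk.trans_le (not_lt.1 hy), by linarith [h.1], by linarith [h.2]⟩

theorem cutt_mul_cutDeriv_eq_zero {ρ : ℝ} {k : ℕ} {p : SpaceTime n} (hp : p ∉ openSlab n ρ) :
    cutt ρ k p.2 * ((k + 1) * cutDeriv ((k + 1) * p.1.2 - 1)) = 0 := by
  have hk : 0 < 1 / ((k : ℝ) + 1) := by positivity
  by_cases hy : p.1.2 < 1 / ((k : ℝ) + 1)
  · rw [cutDeriv_cuty_eq_zero hy, mul_zero, mul_zero]
  · rw [cutt_eq_zero, zero_mul]
    intro h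
    exact hp ⟨hk.trans_le (not_lt.1 hy), by linarith [h.1], by linarith [h.2]⟩

theorem cutTest_eq_zero {R ρ : ℝ} {ψ : SpaceTime n → ℝ}
    (hR : ∀ p ∈ slab n ρ, R < normSqX p.1 → ψ p = 0) {k : ℕ} {p : SpaceTime n}
    (hp : p ∉ cutSet n R ρ k) : cutTest a ρ k ψ p = 0 := by
  unfold cutTest
  by_cases hO : p ∈ openSlab n ρ
  · by_cases hN : R < normSqX p.1
    · rw [hR p (openSlab_subset_slab n ρ hO) hN]; ring
    · by_cases hy : p.1.2 < 1 / ((k : ℝ) + 1)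
      · rw [cuty_eq_zero hy]; ring
      · rw [cutt_eq_zero, zero_mul, zero_mul]
        exact fun h => hp ⟨not_lt.1 hy, not_lt.1 hN, h⟩
  · rw [cutt_mul_cuty_eq_zero hO, zero_mul]

variable {ρ : ℝ} {ψ : SpaceTime n → ℝ} {gx : SpaceTime n → EuclideanSpace ℝ (Fin n)}
  {gy : SpaceTime n → ℝ}

theorem hasGradientAt_cutTest (h : Adm a ρ ψ gx gy) (k : ℕ) (p : SpaceTime n) :
    HasGradientAt (fun x => cutTest a ρ k ψ ((x, p.1.2), p.2)) (cutTestx a ρ k ψ gx p) p.1.1 := by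
  rw [hasGradientAt_iff_hasFDerivAt]
  by_cases hO : p ∈ openSlab n ρ
  · have h1 := (hasGradientAt_tGauss a p.1.1 p.1.2 hO.2.2).hasFDerivAt
    have h2 := (h.grad p hO).hasFDerivAt
    have h3 := (h1.mul h2).const_mul (cutt ρ k p.2 * cuty k p.1.2)
    refine h3.congr_fderiv ?_
    ext v
    simp [cutTestx]
    left; ring
  · have h0 := cutt_mul_cuty_eq_zero (k := k) hO
    have h1 : (fun x => cutTest a ρ k ψ ((x, p.1.2), p.2)) = fun _ => 0 := by
      ext x; simp only [cutTest, h0, zero_mul]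
    rw [h1, cutTestx, h0, zero_smul, map_zero]
    exact hasFDerivAt_const _ _

theorem hasDerivAt_cutTest (h : Adm a ρ ψ gx gy) (k : ℕ) (p : SpaceTime n) :
    HasDerivAt (fun y => cutTest a ρ k ψ ((p.1.1, y), p.2)) (cutTesty a ρ k ψ gy p) p.1.2 := by
  by_cases hO : p ∈ openSlab n ρ
  · have h1 := hasDerivAt_tGauss a p.1.1 p.1.2 hO.2.2
    have h2 := h.deriv p hO
    have h3 := ((hasDerivAt_cuty k p.1.2).const_mul (cutt ρ k p.2)).mul (h1.mul h2)
    refine h3.congr_deriv ?_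
    simp only [cutTesty, Prod.mk.eta, Pi.mul_apply]
    ring
  · have h0 := cutt_mul_cuty_eq_zero (k := k) hO
    have h0' := cutt_mul_cutDeriv_eq_zero (k := k) hO
    rw [cutTesty, h0, h0', zero_mul, zero_mul, add_zero]
    have hk : 0 < 1 / ((k : ℝ) + 1) := by positivity
    -- Off the open slab nothing is known about `ψ`. If `y > 0` the time cutoff vanishes identically
    -- along the line; if `y ≤ 0` the cutoff in `y` vanishes on a whole neighbourhood.
    by_cases hy : 0 < p.1.2
    · have hc : cutt ρ k p.2 = 0 := cutt_eq_zero fun h =>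
        hO ⟨hy, by linarith [h.1], by linarith [h.2]⟩
      have h1 : (fun y => cutTest a ρ k ψ ((p.1.1, y), p.2)) = fun _ => 0 := by
        ext x; simp only [cutTest, hc, zero_mul]
      rw [h1]; exact hasDerivAt_const _ _
    · refine (hasDerivAt_const p.1.2 (0 : ℝ)).congr_of_eventuallyEq ?_
      filter_upwards [gt_mem_nhds ((not_lt.1 hy).trans_lt hk)] with y hy'
      simp only [cutTest, cuty_eq_zero hy', mul_zero, zero_mul]

theorem tsupport_cutTest_subset {R : ℝ} (hR : ∀ p ∈ slab n ρ, R < normSqX p.1 → ψ p = 0) (k : ℕ) :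
    tsupport (cutTest a ρ k ψ) ⊆ cutSet n R ρ k := by
  refine closure_minimal (fun p hp => ?_) (isCompact_cutSet n R ρ k).isClosed
  by_contra h
  exact hp (cutTest_eq_zero hR h)

theorem continuousOn_cutt (k : ℕ) (s : Set (SpaceTime n)) :
    ContinuousOn (fun p : SpaceTime n => cutt ρ k p.2) s :=
  ((continuous_cutt ρ k).comp continuous_snd).continuousOn

theorem continuousOn_cuty (k : ℕ) (s : Set (SpaceTime n)) :
    ContinuousOn (fun p : SpaceTime n => cuty k p.1.2) s :=
  ((continuous_cuty k).comp (continuous_snd.comp continuous_fst)).continuousOn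

theorem openSlab_subset_neg (n : ℕ) (ρ : ℝ) : openSlab n ρ ⊆ {p : SpaceTime n | p.2 < 0} :=
  fun _ hp => hp.2.2

theorem Adm.cont' (h : Adm a ρ ψ gx gy) : ContinuousOn ψ (openSlab n ρ) :=
  h.cont.mono (openSlab_subset_slab n ρ)

theorem continuousOn_tGauss_div (a ρ : ℝ) :
    ContinuousOn (fun p : SpaceTime n => tGauss a p / (2 * p.2)) (openSlab n ρ) := by
  have h2 : Continuous fun p : SpaceTime n => 2 * p.2 := by fun_prop
  exact ((continuousOn_tGauss a).mono (openSlab_subset_neg n ρ)).div h2.continuousOn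
    fun p hp => mul_ne_zero two_ne_zero hp.2.2.ne

/-- The weak formulation for the cut off test functions. -/
theorem weak_form_cutTest (hU : IsSolution a F U) (hF : MemLp F ⊤ (volume.restrict (strip n 1)))
    (hρ : ρ ∈ Icc (0 : ℝ) 1) (h : Adm a ρ ψ gx gy) (k : ℕ) :
    ∫ p in openStrip n, (p.1.2 ^ a * (dt U p - F p) * cutTest a ρ k ψ p +
      p.1.2 ^ a * inner ℝ (gradx U p) (cutTestx a ρ k ψ gx p)
        + weightedDy a U p * cutTesty a ρ k ψ gy p) = 0 := by
  obtain ⟨R, hR⟩ := h.supp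
  have hts := tsupport_cutTest_subset (a := a) hR k
  have hO := isOpen_openSlab n ρ
  have hG := (continuousOn_tGauss (n := n) a).mono (openSlab_subset_neg n ρ)
  have hsub := hts.trans (cutSet_subset_openSlab n R ρ k)
  have hz : ∀ p ∉ cutSet n R ρ k, p ∉ tsupport (cutTest a ρ k ψ) := fun p hp h => hp (hts h)
  have hgx0 : ∀ p ∉ cutSet n R ρ k, cutTestx a ρ k ψ gx p = 0 := fun p hp => by
    simpa using eq_zero_of_notMem_tsupport _
      (hasFDerivAt_inclx_iff.2 (hasGradientAt_cutTest h k p)) (hz p hp)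
  have hgy0 : ∀ p ∉ cutSet n R ρ k, cutTesty a ρ k ψ gy p = 0 := fun p hp => by
    simpa using eq_zero_of_notMem_tsupport _
      (hasFDerivAt_incly_iff.2 (hasDerivAt_cutTest h k p)) (hz p hp)
  have hcl := (isCompact_cutSet n R ρ k).isClosed
  have htx : tsupport (cutTestx a ρ k ψ gx) ⊆ openSlab n ρ :=
    (closure_minimal (fun p hp => by by_contra h; exact hp (hgx0 p h)) hcl).trans
      (cutSet_subset_openSlab n R ρ k)
  have hty : tsupport (cutTesty a ρ k ψ gy) ⊆ openSlab n ρ :=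
    (closure_minimal (fun p hp => by by_contra h; exact hp (hgy0 p h)) hcl).trans
      (cutSet_subset_openSlab n R ρ k)
  have hct := (continuousOn_cutt (n := n) (ρ := ρ) k (openSlab n ρ)).mul
    (continuousOn_cuty (n := n) k (openSlab n ρ))
  have hx : Continuous fun p : SpaceTime n => p.1.1 := by fun_prop
  have hy : Continuous fun p : SpaceTime n => p.1.2 := by fun_prop
  refine weak_form hU hF ?_ (HasCompactSupport.of_support_subset_isCompact
    (isCompact_cutSet n R ρ k) (subset_closure.trans hts))
    (hsub.trans (openSlab_subset_openStrip n hρ)) ?_ ?_ (hasGradientAt_cutTest h k)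
    (hasDerivAt_cutTest h k)
  · exact ContinuousOn.continuous_of_tsupport_subset (hct.mul (hG.mul h.cont')) hO hsub
  · refine ContinuousOn.continuous_of_tsupport_subset ?_ hO htx
    exact hct.smul ((hG.smul h.cont_gx).add
      ((h.cont'.mul (continuousOn_tGauss_div a ρ)).smul hx.continuousOn))
  · refine ContinuousOn.continuous_of_tsupport_subset ?_ hO hty
    have hcd : Continuous fun p : SpaceTime n => ((k : ℝ) + 1) * cutDeriv ((k + 1) * p.1.2 - 1) :=
      continuous_const.mul (continuous_cutDeriv.comp (by fun_prop))
    exact (hct.mul ((hG.mul h.cont_gy).add (h.cont'.mul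
      ((continuousOn_tGauss_div a ρ).mul hy.continuousOn)))).add
      (((continuousOn_cutt (n := n) k _).mul hcd.continuousOn).mul (hG.mul h.cont'))

/-- The terms `|t| U_t` and `|t| ⟨X, ∇U⟩ / (2t)` combine to `-½ ZU`. The only further term comes
from the derivative of the cutoff in `y`. The time cutoff leaves none, because the time derivative
falls on `U`. -/
theorem weak_form_integrand (k : ℕ) {p : SpaceTime n} (hp : p ∈ openSlab n ρ) :
    p.1.2 ^ a * (dt U p - F p) * cutTest a ρ k ψ p +
      p.1.2 ^ a * inner ℝ (gradx U p) (cutTestx a ρ k ψ gx p)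
        + weightedDy a U p * cutTesty a ρ k ψ gy p
      = cutt ρ k p.2 * cuty k p.1.2 * gaussForm a F U ψ gx gy p
        + cutt ρ k p.2 * ((k + 1) * cutDeriv ((k + 1) * p.1.2 - 1)) *
          (tGauss a p * (ψ p * weightedDy a U p)) := by
  have ht : p.2 < 0 := hp.2.2
  have ht0 : p.2 ≠ 0 := ht.ne
  simp only [cutTest, cutTestx, cutTesty, gaussForm, weightedDy, inner_smul_right, inner_add_right,
    Zfield, tGauss, weight]
  rw [abs_of_neg ht, real_inner_comm (gradx U p) p.1.1]
  field_simp
  ring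

/-- The boundary layer integrals converge to the contribution of the thin set. -/
theorem tendsto_boundary_layer (ha : -1 < a) (ha' : a < 1) (hU : IsSolution a F U)
    (hρ : ρ ∈ Icc (0 : ℝ) 1) (h : Adm a ρ ψ gx gy) :
    Tendsto (fun k : ℕ => ∫ p in openSlab n ρ,
      cutt ρ k p.2 * ((k + 1) * cutDeriv ((k + 1) * p.1.2 - 1)) *
          (tGauss a p * (ψ p * weightedDy a U p))) atTop (𝓝 (thinTerm a ρ U ψ)) := by
  obtain ⟨R, M, L, hB⟩ := hU.exists_bounds
  obtain ⟨M', hM', hψ, -, -⟩ := h.bound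
  obtain ⟨Cs, hCs0, hCs⟩ := exists_abs_cutDeriv_le
  have hO := (isOpen_openSlab n ρ).measurableSet
  have hsub := openSlab_subset_openStrip n hρ
  have hsub1 := hsub.trans (openStrip_subset_strip n)
  -- The derivative of the cutoff lives on the layer `β < y < 2β`. The substitution `y = β y' + β`
  -- maps `0 < y' < 1` onto it, and its Jacobian `β` cancels the factor `k + 1`, leaving the fixed
  -- profile `cutDeriv y'`. Everything else is then evaluated at heights tending to zero.
  set β : ℕ → ℝ := fun k => 1 / ((k : ℝ) + 1) with hβ
  have hβ0 : ∀ k, 0 < β k := fun k => by positivity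
  set f : ℕ → SpaceTime n → ℝ := fun k => (openSlab n ρ).indicator fun p =>
    cutt ρ k p.2 * ((k + 1) * cutDeriv ((k + 1) * p.1.2 - 1)) *
          (tGauss a p * (ψ p * weightedDy a U p)) with hf
  set g : ℕ → SpaceTime n → ℝ := fun k p => β k * f k (aff 1 (β k) (β k) 1 p) with hg
  have haff : ∀ k (p : SpaceTime n), aff 1 (β k) (β k) 1 p = ((p.1.1, β k * p.1.2 + β k), p.2) :=
    fun k p => by simp [aff]
  have hgz : ∀ k p, p ∉ thinBox n ρ → g k p = 0 := by
    intro k p hp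
    simp only [hg, hf, haff]
    by_cases hm : ((p.1.1, β k * p.1.2 + β k), p.2) ∈ openSlab n ρ
    · rw [indicator_of_mem hm]
      have h1 : ((k : ℝ) + 1) * (β k * p.1.2 + β k) - 1 = p.1.2 := by
        simp only [hβ]; field_simp; ring
      simp only [h1]
      rw [cutDeriv_eq_zero fun h => hp ⟨h, hm.2⟩]; ring
    · rw [indicator_of_notMem hm, mul_zero]
  have hge : ∀ k, ∀ p ∈ thinBox n ρ, g k p = cutt ρ k p.2 * cutDeriv p.1.2 *
      (tGauss a ((p.1.1, β k * p.1.2 + β k), p.2) * (ψ ((p.1.1, β k * p.1.2 + β k), p.2) *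
        weightedDy a U ((p.1.1, β k * p.1.2 + β k), p.2))) := by
    intro k p hp
    simp only [hg, hf, haff]
    have hm : ((p.1.1, β k * p.1.2 + β k), p.2) ∈ openSlab n ρ :=
      ⟨by have := hp.1.1; have := hβ0 k; positivity, hp.2⟩
    rw [indicator_of_mem hm]
    have h1 : ((k : ℝ) + 1) * (β k * p.1.2 + β k) - 1 = p.1.2 := by
      simp only [hβ]; field_simp; ring
    simp only [h1]
    have h2 : β k * ((k : ℝ) + 1) = 1 := by simp only [hβ]; field_simp
    linear_combination (cutt ρ k p.2 * cutDeriv p.1.2 *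
      (tGauss a ((p.1.1, β k * p.1.2 + β k), p.2) * (ψ ((p.1.1, β k * p.1.2 + β k), p.2) *
        weightedDy a U ((p.1.1, β k * p.1.2 + β k), p.2)))) * h2
  have hint : ∀ k : ℕ, ∫ p in openSlab n ρ,
      cutt ρ k p.2 * ((k + 1) * cutDeriv ((k + 1) * p.1.2 - 1)) *
          (tGauss a p * (ψ p * weightedDy a U p)) = ∫ p in thinBox n ρ, g k p := by
    intro k
    rw [← integral_indicator hO]
    change ∫ p, f k p = _
    rw [integral_comp_aff (β k) one_pos (hβ0 k) one_pos, ← integral_const_mul,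
      ← integral_indicator (measurableSet_thinBox n ρ)]
    refine integral_congr_ae (ae_of_all _ fun p => ?_)
    simp only [one_pow, one_mul, mul_one]
    by_cases hp : p ∈ thinBox n ρ
    · rw [indicator_of_mem hp]
    · rw [indicator_of_notMem hp, ← hgz k p hp]
  simp only [hint]
  unfold thinTerm
  -- The Gaussian decreases in `y`, so its trace on the thin set dominates it on every layer.
  refine tendsto_integral_of_dominated_convergence
    (fun p => Cs * (M' * M) * tGauss a ((p.1.1, 0), p.2)) ?_ ?_ ?_ ?_
  · intro k
    have h1 : AEStronglyMeasurable (f k) := by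
      rw [hf]
      refine (aestronglyMeasurable_indicator_iff hO).2 ?_
      have hcd : Continuous fun p : SpaceTime n => ((k : ℝ) + 1) * cutDeriv ((k + 1) * p.1.2 - 1) :=
        continuous_const.mul (continuous_cutDeriv.comp (by fun_prop))
      have hc : ContinuousOn (fun p : SpaceTime n =>
          cutt ρ k p.2 * ((k + 1) * cutDeriv ((k + 1) * p.1.2 - 1)) *
          (tGauss a p * (ψ p * weightedDy a U p))) (openSlab n ρ) :=
        ((continuousOn_cutt k _).mul hcd.continuousOn).mul
          (((continuousOn_tGauss a).mono (openSlab_subset_neg n ρ)).mul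
            (h.cont'.mul (hU.continuousOn_weightedDy.mono hsub1)))
      exact hc.aestronglyMeasurable hO
    have h2 := h1.comp_quasiMeasurePreserving
      (quasiMeasurePreserving_aff (n := n) (β k) one_pos (hβ0 k) one_pos)
    exact (h2.const_mul (β k)).restrict
  · exact (integrableOn_tGauss_thin ha ha' ρ).const_mul _
  · intro k
    filter_upwards [ae_restrict_mem (measurableSet_thinBox n ρ)] with p hp
    have hm : ((p.1.1, β k * p.1.2 + β k), p.2) ∈ openSlab n ρ :=
      ⟨by have := hp.1.1; have := hβ0 k; positivity, hp.2⟩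
    have hM := hB.M_nonneg
    have hc := cutt_mem ρ k p.2
    have hT := tGauss_nonneg ha ((p.1.1, β k * p.1.2 + β k), p.2)
    have hT0 := tGauss_nonneg ha ((p.1.1, (0 : ℝ)), p.2)
    rw [hge k p hp, Real.norm_eq_abs, abs_mul, abs_mul, abs_mul, abs_mul, abs_of_nonneg hT,
      abs_of_nonneg hc.1]
    calc cutt ρ k p.2 * |cutDeriv p.1.2| * (tGauss a ((p.1.1, β k * p.1.2 + β k), p.2) *
          (|ψ ((p.1.1, β k * p.1.2 + β k), p.2)| *
            |weightedDy a U ((p.1.1, β k * p.1.2 + β k), p.2)|))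
        ≤ 1 * Cs * (tGauss a ((p.1.1, 0), p.2) * (M' * M)) := by
          gcongr
          · exact hc.2
          · exact hCs _
          · exact tGauss_le_thin ha _ _ _
          · exact hψ _ (openSlab_subset_slab n ρ hm)
          · exact hB.weightedDy_le _ (hsub1 hm)
      _ = _ := by ring
  · filter_upwards [ae_restrict_mem (measurableSet_thinBox n ρ)] with p hp
    have ht1 : -1 < p.2 := by nlinarith [hp.2.1, hρ.1, hρ.2]
    have hz : Tendsto (fun k => β k * p.1.2 + β k) atTop (𝓝[>] 0) := by
      refine tendsto_nhdsWithin_iff.2 ⟨?_, Eventually.of_forall fun k => ?_⟩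
      · have h1 : Tendsto β atTop (𝓝 0) := tendsto_one_div_add_atTop_nhds_zero_nat
        simpa using (h1.mul_const p.1.2).add h1
      · have := hp.1.1; have := hβ0 k
        exact (by positivity : 0 < β k * p.1.2 + β k)
    have l1 := tendsto_cutt (ρ := ρ) hp.2
    have l2 : Tendsto (fun k => tGauss a ((p.1.1, β k * p.1.2 + β k), p.2)) atTop
        (𝓝 (tGauss a ((p.1.1, 0), p.2))) := by
      have hc : ContinuousAt (fun y : ℝ => tGauss a ((p.1.1, y), p.2)) 0 :=
        (hasDerivAt_tGauss a p.1.1 0 hp.2.2).continuousAt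
      exact hc.tendsto.comp (hz.mono_right nhdsWithin_le_nhds)
    have l3 : Tendsto (fun k => ψ ((p.1.1, β k * p.1.2 + β k), p.2)) atTop
        (𝓝 (ψ ((p.1.1, 0), p.2))) := by
      have hc := h.cont ((p.1.1, 0), p.2) ⟨le_rfl, hp.2⟩
      refine hc.tendsto.comp (tendsto_nhdsWithin_iff.2 ⟨?_, Eventually.of_forall fun k => ?_⟩)
      · have : Continuous fun y : ℝ => (((p.1.1, y), p.2) : SpaceTime n) := by fun_prop
        exact (this.tendsto 0).comp (hz.mono_right nhdsWithin_le_nhds)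
      · have := hp.1.1; have := hβ0 k
        exact ⟨by positivity, hp.2⟩
    have l4 := (hU.tendsto_conormal p.1.1 ht1 hp.2.2.le).comp hz
    have := (l1.mul_const (cutDeriv p.1.2)).mul (l2.mul (l3.mul l4))
    rw [one_mul] at this
    refine this.congr fun k => ?_
    rw [hge k p hp]; rfl

/-- The weak formulation in Gaussian space. -/
theorem integral_gaussForm (ha : -1 < a) (ha' : a < 1) (hU : IsSolution a F U)
    (hF : MemLp F ⊤ (volume.restrict (strip n 1))) (hρ : ρ ∈ Ico (0 : ℝ) 1)
    (h : Adm a ρ ψ gx gy) :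
    ∫ p in strip n ρ, gaussForm a F U ψ gx gy p = - thinTerm a ρ U ψ := by
  have hρ' := Ico_subset_Icc_self hρ
  have hO := (isOpen_openSlab n ρ).measurableSet
  have hsub := openSlab_subset_openStrip n hρ'
  have hint : IntegrableOn (gaussForm a F U ψ gx gy) (openSlab n ρ) :=
    (integrableOn_gaussForm ha ha' hU hF hρ h).mono_set (openSlab_subset_strip n ρ)
  have hcm : ∀ k, AEStronglyMeasurable (fun p : SpaceTime n => cutt ρ k p.2 * cuty k p.1.2)
      (volume.restrict (openSlab n ρ)) := fun k =>
    ((continuousOn_cutt k _).mul (continuousOn_cuty k _)).aestronglyMeasurable hO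
  have hcb : ∀ k (p : SpaceTime n), ‖cutt ρ k p.2 * cuty k p.1.2‖ ≤ 1 := fun k p => by
    have h1 := cutt_mem ρ k p.2
    have h2 := cuty_mem k p.1.2
    rw [Real.norm_of_nonneg (mul_nonneg h1.1 h2.1)]
    exact mul_le_one₀ h1.2 h2.1 h2.2
  have hint1 : ∀ k, IntegrableOn (fun p => cutt ρ k p.2 * cuty k p.1.2 * gaussForm a F U ψ gx gy p)
      (openSlab n ρ) := fun k => Integrable.bdd_mul hint (hcm k) (ae_of_all _ (hcb k))
  have hlim1 : Tendsto (fun k => ∫ p in openSlab n ρ,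
      cutt ρ k p.2 * cuty k p.1.2 * gaussForm a F U ψ gx gy p) atTop
      (𝓝 (∫ p in openSlab n ρ, gaussForm a F U ψ gx gy p)) := by
    refine tendsto_integral_of_dominated_convergence (fun p => ‖gaussForm a F U ψ gx gy p‖)
      (fun k => (hint1 k).aestronglyMeasurable) hint.norm (fun k => ae_of_all _ fun p => ?_) ?_
    · rw [norm_mul]
      exact mul_le_of_le_one_left (norm_nonneg _) (hcb k p)
    · filter_upwards [ae_restrict_mem hO] with p hp
      have := ((tendsto_cutt hp.2).mul (tendsto_cuty hp.1)).mul_const (gaussForm a F U ψ gx gy p)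
      simpa using this
  have hlim2 := tendsto_boundary_layer ha ha' hU hρ' h
  have hzero : ∀ k : ℕ, (∫ p in openSlab n ρ,
      cutt ρ k p.2 * cuty k p.1.2 * gaussForm a F U ψ gx gy p) + (∫ p in openSlab n ρ,
      cutt ρ k p.2 * ((k + 1) * cutDeriv ((k + 1) * p.1.2 - 1)) *
          (tGauss a p * (ψ p * weightedDy a U p))) = 0 := by
    intro k
    have hw := weak_form_cutTest hU hF hρ' h k
    obtain ⟨R, hR⟩ := h.supp
    have hint2 : IntegrableOn (fun p : SpaceTime n =>
        cutt ρ k p.2 * ((k + 1) * cutDeriv ((k + 1) * p.1.2 - 1)) *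
          (tGauss a p * (ψ p * weightedDy a U p))) (openSlab n ρ) := by
      have hK := isCompact_cutSet n R ρ k
      have hKs := cutSet_subset_openSlab n R ρ k
      have hcd : Continuous fun p : SpaceTime n => ((k : ℝ) + 1) * cutDeriv ((k + 1) * p.1.2 - 1) :=
        continuous_const.mul (continuous_cutDeriv.comp (by fun_prop))
      have hc : ContinuousOn (fun p : SpaceTime n =>
          cutt ρ k p.2 * ((k + 1) * cutDeriv ((k + 1) * p.1.2 - 1)) *
          (tGauss a p * (ψ p * weightedDy a U p))) (cutSet n R ρ k) :=
        (((continuousOn_cutt k _).mul hcd.continuousOn).mul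
          (((continuousOn_tGauss a).mono (openSlab_subset_neg n ρ)).mul
            (h.cont'.mul (hU.continuousOn_weightedDy.mono
              (hsub.trans (openStrip_subset_strip n)))))).mono hKs
      have hk : IntegrableOn _ (cutSet n R ρ k) := hc.integrableOn_compact hK
      refine hk.of_forall_sdiff_eq_zero hO fun p hp => ?_
      by_cases hN : R < normSqX p.1
      · rw [hR p (openSlab_subset_slab n ρ hp.1) hN]; ring
      · by_cases hy : p.1.2 < 1 / ((k : ℝ) + 1)
        · rw [cutDeriv_cuty_eq_zero hy]; ring
        · rw [cutt_eq_zero, zero_mul, zero_mul]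
          exact fun h => hp.2 ⟨not_lt.1 hy, not_lt.1 hN, h⟩
    rw [← integral_add (hint1 k) hint2, ← hw]
    rw [setIntegral_eq_of_subset_of_forall_sdiff_eq_zero (isOpen_openStrip n).measurableSet hsub]
    · exact setIntegral_congr_fun hO fun p hp => (weak_form_integrand k hp).symm
    · intro p hp
      have h0 := cutt_mul_cuty_eq_zero (k := k) hp.2
      have h0' := cutt_mul_cutDeriv_eq_zero (k := k) hp.2
      simp only [cutTest, cutTestx, cutTesty, h0, h0', zero_mul, zero_smul, inner_zero_right,
        mul_zero, add_zero]
  -- The bulk integral and the boundary layer cancel for every `k`, hence also in the limit.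
  have hsum := hlim1.add hlim2
  simp only [hzero] at hsum
  have := tendsto_nhds_unique hsum tendsto_const_nhds
  rw [← setIntegral_congr_set (openSlab_ae_eq_strip n ρ)]
  linarith

end

/-! ### Derivatives of the energy and the height along dilations -/

/-- Dominated convergence over varying domains. -/
theorem tendsto_setIntegral_of_dominated {α : Type*} [MeasurableSpace α] {μ : Measure α}
    {ι : Type*} {𝓕 : Filter ι} [𝓕.IsCountablyGenerated] {A : ι → Set α} {A₀ B : Set α}
    (hA : ∀ i, MeasurableSet (A i)) (hA₀ : MeasurableSet A₀) (hB : MeasurableSet B)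
    (hAB : ∀ᶠ i in 𝓕, A i ⊆ B) {bd : α → ℝ} (hbd : IntegrableOn bd B μ)
    {f : ι → α → ℝ} {f₀ : α → ℝ}
    (hm : ∀ᶠ i in 𝓕, AEStronglyMeasurable (f i) (μ.restrict (A i)))
    (hle : ∀ᶠ i in 𝓕, ∀ᵐ p ∂μ, p ∈ A i → |f i p| ≤ bd p)
    (hmem : ∀ᵐ p ∂μ, ∀ᶠ i in 𝓕, (p ∈ A i ↔ p ∈ A₀))
    (hlim : ∀ᵐ p ∂μ, p ∈ A₀ → Tendsto (fun i => f i p) 𝓕 (𝓝 (f₀ p))) :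
    Tendsto (fun i => ∫ p in A i, f i p ∂μ) 𝓕 (𝓝 (∫ p in A₀, f₀ p ∂μ)) := by
  simp_rw [← integral_indicator (hA _), ← integral_indicator hA₀]
  refine tendsto_integral_filter_of_dominated_convergence (B.indicator fun p => |bd p|) ?_ ?_
    ((integrable_indicator_iff hB).2 hbd.norm) ?_
  · filter_upwards [hm] with i hi using (aestronglyMeasurable_indicator_iff (hA i)).2 hi
  · filter_upwards [hle, hAB] with i hi hs
    filter_upwards [hi] with p hp
    by_cases h : p ∈ A i
    · rw [indicator_of_mem h, indicator_of_mem (hs h), Real.norm_eq_abs]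
      exact (hp h).trans (le_abs_self _)
    · rw [indicator_of_notMem h, norm_zero]
      exact indicator_nonneg (fun _ _ => abs_nonneg _) _
  · filter_upwards [hmem, hlim] with p h1 h2
    by_cases h : p ∈ A₀
    · rw [indicator_of_mem h]
      refine (h2 h).congr' ?_
      filter_upwards [h1] with i hi
      rw [indicator_of_mem (hi.2 h)]
    · rw [indicator_of_notMem h]
      refine tendsto_const_nhds.congr' ?_
      filter_upwards [h1] with i hi
      rw [indicator_of_notMem (mt hi.1 h)]

/-- Almost every point lies in an interval with a moving endpoint eventually if and only if it
does in the limit. -/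
theorem ae_eventually_mem_Ioo_iff {n : ℕ} {ι : Type*} {𝓕 : Filter ι} {ρ : ι → ℝ} {r : ℝ}
    (hρ : Tendsto ρ 𝓕 (𝓝 r)) :
    ∀ᵐ p : SpaceTime n, ∀ᶠ i in 𝓕, (p.2 ∈ Ioo (-ρ i ^ 2) 0 ↔ p.2 ∈ Ioo (-r ^ 2) 0) := by
  -- Membership can keep changing only on the limiting bottom `t = -r²`, a null set.
  have h0 : ∀ᵐ p : SpaceTime n, p.2 ≠ -r ^ 2 :=
    Measure.quasiMeasurePreserving_snd.ae (Measure.ae_ne volume (-r ^ 2))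
  have hl : Tendsto (fun i => -ρ i ^ 2) 𝓕 (𝓝 (-r ^ 2)) := (hρ.pow 2).neg
  filter_upwards [h0] with p hp
  rcases lt_or_gt_of_ne hp with h | h
  · filter_upwards [hl.eventually_const_lt h] with i hi
    exact ⟨fun h' => absurd h'.1 (not_lt.2 hi.le), fun h' => absurd h'.1 (not_lt.2 h.le)⟩
  · filter_upwards [hl.eventually_lt_const h] with i hi
    exact ⟨fun h' => ⟨h, h'.2⟩, fun h' => ⟨hi, h'.2⟩⟩

section
variable {n : ℕ} {a : ℝ} {F U : SpaceTime n → ℝ}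

/-- Convergence of difference quotients integrated over strips of varying size. -/
theorem tendsto_integral_quotient {g Z : SpaceTime n → ℝ} (hg : IntegrableOn g (strip n 1))
    {r : ℝ} (hr : r ∈ Ioo (0 : ℝ) 1) {ρ : ℝ → ℝ} (hρ : Tendsto ρ (𝓝[≠] 1) (𝓝 r))
    {ψ : ℝ → SpaceTime n → ℝ}
    (hm : ∀ᶠ l in 𝓝[≠] 1, ContinuousOn (ψ l) (openSlab n (ρ l))) {C : ℝ}
    (hC : ∀ᶠ l in 𝓝[≠] 1, ∀ p ∈ openSlab n (ρ l), |ψ l p| ≤ C * |l - 1|)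
    (hlim : ∀ᵐ p : SpaceTime n, p ∈ openStrip n →
      Tendsto (fun l => ψ l p / (l - 1)) (𝓝[≠] 1) (𝓝 (Z p))) :
    Tendsto (fun l => (∫ p in strip n (ρ l), g p * ψ l p) / (l - 1)) (𝓝[≠] 1)
      (𝓝 (∫ p in strip n r, g p * Z p)) := by
  have hρ01 : ∀ᶠ l in 𝓝[≠] 1, ρ l ∈ Ioo (0 : ℝ) 1 := hρ.eventually_mem (isOpen_Ioo.mem_nhds hr)
  have hO : ∀ ρ, MeasurableSet (openSlab n ρ) := fun ρ => (isOpen_openSlab n ρ).measurableSet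
  have hsub : ∀ ρ ∈ Ioo (0 : ℝ) 1, openSlab n ρ ⊆ openStrip n := fun ρ h =>
    openSlab_subset_openStrip n (Ioo_subset_Icc_self h)
  have hgi : IntegrableOn g (openStrip n) := hg.mono_set (openStrip_subset_strip n)
  rw [← setIntegral_congr_set (openSlab_ae_eq_strip n r)]
  refine Tendsto.congr (fun l => ?_) (tendsto_setIntegral_of_dominated (𝓕 := 𝓝[≠] (1 : ℝ))
    (f := fun l p => g p * (ψ l p / (l - 1))) (bd := fun p => |g p| * C)
    (A := fun l => openSlab n (ρ l))
    (fun l => hO _) (hO r) (isOpen_openStrip n).measurableSet ?_ (hgi.norm.mul_const C) ?_ ?_ ?_ ?_)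
  · rw [setIntegral_congr_set (openSlab_ae_eq_strip n (ρ l)), ← integral_div]
    refine integral_congr_ae (ae_of_all _ fun p => ?_)
    simp only; ring
  · filter_upwards [hρ01] with l hl using hsub _ hl
  · filter_upwards [hm, hρ01] with l h1 h2
    have h3 := hgi.1.mono_measure (Measure.restrict_mono (hsub _ h2) le_rfl)
    exact h3.mul ((h1.div_const _).aestronglyMeasurable (hO _))
  · filter_upwards [hC, self_mem_nhdsWithin] with l h1 hne
    have hne' : 0 < |l - 1| := abs_pos.2 (sub_ne_zero.2 hne)
    refine ae_of_all _ fun p hp => ?_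
    rw [abs_mul, abs_div]
    refine mul_le_mul_of_nonneg_left ?_ (abs_nonneg _)
    rw [div_le_iff₀ hne']; exact h1 p hp
  · filter_upwards [ae_eventually_mem_Ioo_iff (n := n) hρ] with p hp
    filter_upwards [hp] with l hl
    exact and_congr_right fun _ => hl
  · filter_upwards [hlim] with p hp hps
    exact (hp (hsub _ hr hps)).const_mul _

theorem aestronglyMeasurable_conormal (hU : IsSolution a F U) {ρ : ℝ} (hρ : ρ ∈ Icc (0 : ℝ) 1) :
    AEStronglyMeasurable (fun p : SpaceTime n => conormal a U p.1.1 p.2)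
      (volume.restrict (thinBox n ρ)) := by
  refine aestronglyMeasurable_of_tendsto_ae atTop
    (f := fun k : ℕ => fun p : SpaceTime n => weightedDy a U ((p.1.1, 1 / ((k : ℝ) + 1)), p.2))
    (fun k => ?_) ?_
  · refine ContinuousOn.aestronglyMeasurable (hU.continuousOn_weightedDy.comp
      (f := fun p : SpaceTime n => (((p.1.1, 1 / ((k : ℝ) + 1)), p.2) : SpaceTime n))
      (Continuous.continuousOn (by fun_prop)) fun p hp => ?_) (measurableSet_thinBox n ρ)
    exact ⟨by positivity, by nlinarith [hp.2.1, hρ.1, hρ.2], hp.2.2.le⟩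
  · filter_upwards [ae_restrict_mem (measurableSet_thinBox n ρ)] with p hp
    have h1 := hU.tendsto_conormal p.1.1 (t := p.2)
      (by nlinarith [hp.2.1, hρ.1, hρ.2]) hp.2.2.le
    exact h1.comp (tendsto_nhdsWithin_iff.2 ⟨tendsto_one_div_add_atTop_nhds_zero_nat,
      Eventually.of_forall fun k => mem_Ioi.2 (by positivity)⟩)

/-- The contributions of the thin set are of lower order. -/
theorem tendsto_thinTerm_div (ha : -1 < a) (ha' : a < 1) (hU : IsSolution a F U)
    {r : ℝ} (hr : r ∈ Ioo (0 : ℝ) 1) {ρ : ℝ → ℝ} (hρ : Tendsto ρ (𝓝[≠] 1) (𝓝 r))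
    {ψ : ℝ → SpaceTime n → ℝ}
    (hm : ∀ᶠ l in 𝓝[≠] 1, ContinuousOn (ψ l) (slab n (ρ l))) {C : ℝ} (hC0 : 0 ≤ C)
    (hC : ∀ᶠ l in 𝓝[≠] 1, ∀ p ∈ slab n (ρ l), |ψ l p| ≤ C * |l - 1|)
    (hlim : ∀ (x : EuclideanSpace ℝ (Fin n)) (t : ℝ), t ∈ Ioo (-1 : ℝ) 0 →
      ∀ᶠ l in 𝓝[≠] 1, ψ l ((x, 0), t) * conormal a U x t = 0) :
    Tendsto (fun l => thinTerm a (ρ l) U (ψ l) / (l - 1)) (𝓝[≠] 1) (𝓝 0) := by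
  obtain ⟨R, M, L, hB⟩ := hU.exists_bounds
  obtain ⟨Cs, hCs0, hCs⟩ := exists_abs_cutDeriv_le
  have hρ01 : ∀ᶠ l in 𝓝[≠] 1, ρ l ∈ Ioo (0 : ℝ) 1 := hρ.eventually_mem (isOpen_Ioo.mem_nhds hr)
  have hO := measurableSet_thinBox n
  have hsub : ∀ ρ ∈ Ioo (0 : ℝ) 1, thinBox n ρ ⊆ thinBox n 1 := fun ρ h p hp =>
    ⟨hp.1, by nlinarith [hp.2.1, h.1, h.2], hp.2.2⟩
  have hz : ∫ p in thinBox n r, (0 : ℝ) = 0 := by simp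
  rw [← hz]
  refine Tendsto.congr (fun l => ?_) (tendsto_setIntegral_of_dominated (𝓕 := 𝓝[≠] (1 : ℝ))
    (f := fun l p => cutDeriv p.1.2 * (tGauss a ((p.1.1, 0), p.2) *
      (ψ l ((p.1.1, 0), p.2) * conormal a U p.1.1 p.2)) / (l - 1))
    (bd := fun p => Cs * C * M * tGauss a ((p.1.1, 0), p.2))
    (A := fun l => thinBox n (ρ l)) (B := thinBox n 1)
    (fun l => hO _) (hO r) (hO 1) ?_ ((integrableOn_tGauss_thin ha ha' 1).const_mul _) ?_ ?_ ?_ ?_)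
  · rw [thinTerm, integral_div]
  · filter_upwards [hρ01] with l hl using hsub _ hl
  · filter_upwards [hm, hρ01] with l h1 h2
    have c1 : Continuous fun p : SpaceTime n => cutDeriv p.1.2 :=
      continuous_cutDeriv.comp (by fun_prop)
    have c2 : Measurable fun p : SpaceTime n => tGauss a (((p.1.1, 0), p.2) : SpaceTime n) :=
      (measurable_tGauss a).comp (by fun_prop)
    have c3 : AEStronglyMeasurable (fun p : SpaceTime n => ψ l ((p.1.1, 0), p.2))
        (volume.restrict (thinBox n (ρ l))) :=
      ContinuousOn.aestronglyMeasurable (h1.comp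
        (f := fun p : SpaceTime n => (((p.1.1, 0), p.2) : SpaceTime n))
        (Continuous.continuousOn (by fun_prop)) fun p hp => ⟨le_rfl, hp.2⟩) (hO _)
    have c4 := aestronglyMeasurable_conormal hU (Ioo_subset_Icc_self h2)
    have := c1.aestronglyMeasurable.mul (c2.aestronglyMeasurable.mul (c3.mul c4))
    exact (this.mul_const (l - 1)⁻¹)
  · filter_upwards [hC, hρ01, self_mem_nhdsWithin] with l h1 h2 hne
    have hne' : 0 < |l - 1| := abs_pos.2 (sub_ne_zero.2 hne)
    refine ae_of_all _ fun p hp => ?_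
    have hc := abs_conormal_le hU hB p.1.1 (t := p.2) (by simpa using (hsub _ h2 hp).2)
    have hψ := h1 ((p.1.1, 0), p.2) ⟨le_rfl, hp.2⟩
    have ht := tGauss_nonneg ha (((p.1.1, 0), p.2) : SpaceTime n)
    rw [abs_div, div_le_iff₀ hne', abs_mul, abs_mul, abs_mul, abs_of_nonneg ht]
    calc |cutDeriv p.1.2| * (tGauss a ((p.1.1, 0), p.2) *
          (|ψ l ((p.1.1, 0), p.2)| * |conormal a U p.1.1 p.2|))
        ≤ Cs * (tGauss a ((p.1.1, 0), p.2) * ((C * |l - 1|) * M)) := by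
          gcongr
          exact hCs _
      _ = _ := by ring
  · filter_upwards [ae_eventually_mem_Ioo_iff (n := n) hρ] with p hp
    filter_upwards [hp] with l hl
    exact and_congr_right fun _ => hl
  · refine ae_of_all _ fun p hp => ?_
    refine tendsto_const_nhds.congr' ?_
    -- The integrand is eventually exactly zero at each point. How close `l` must be to `1` depends
    -- on the point, and the uniform Lipschitz bound supplies the domination that compensates for
    -- this.
    filter_upwards [hlim p.1.1 p.2 (by have := (hsub _ hr hp).2; simpa using this)] with l hl
    rw [hl]; simp

end

/-! ### Rescaled energy and height -/

section
variable {n : ℕ} {a : ℝ} {F U : SpaceTime n → ℝ}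

/-- The source term in the weak formulation in Gaussian space, with its weight. -/
noncomputable def source (a : ℝ) (F U : SpaceTime n → ℝ) (p : SpaceTime n) : ℝ :=
  (1 / 2 * Zfield U p + |p.2| * F p) * weight a p

theorem integrableOn_source (ha : -1 < a) (ha' : a < 1) (hU : IsSolution a F U)
    (hF : MemLp F ⊤ (volume.restrict (strip n 1))) : IntegrableOn (source a F U) (strip n 1) := by
  obtain ⟨hm, C, -, hC⟩ := exists_ae_bound_source ha ha' hU hF (ρ := 1) (by simp)
  exact integrableOn_bdd_mul_weight ha hm hC

theorem integral_grad_mul_grad (ha : -1 < a) (ha' : a < 1) (hU : IsSolution a F U)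
    (hF : MemLp F ⊤ (volume.restrict (strip n 1))) {ρ : ℝ} (hρ : ρ ∈ Ico (0 : ℝ) 1)
    {ψ : SpaceTime n → ℝ} {gx : SpaceTime n → EuclideanSpace ℝ (Fin n)}
    {gy : SpaceTime n → ℝ} (h : Adm a ρ ψ gx gy) :
    ∫ p in strip n ρ, |p.2| * (inner ℝ (gradx U p) (gx p) + dy U p * gy p) * weight a p
      = (∫ p in strip n ρ, source a F U p * ψ p) - thinTerm a ρ U ψ := by
  have hρ' := Ico_subset_Icc_self hρ
  have h1 := integral_sub (integrableOn_grad_mul_grad ha ha' hρ' (hU.adm hρ) h)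
    (integrableOn_source_mul ha ha' hU hF hρ' h)
  have h2 := integral_gaussForm ha ha' hU hF hρ h
  have h3 : ∫ p in strip n ρ, gaussForm a F U ψ gx gy p
      = ∫ p in strip n ρ, (|p.2| * (inner ℝ (gradx U p) (gx p) + dy U p * gy p) * weight a p -
        (1 / 2 * Zfield U p + |p.2| * F p) * ψ p * weight a p) :=
    integral_congr_ae (ae_of_all _ fun p => by simp only [gaussForm]; ring)
  have h4 : ∫ p in strip n ρ, source a F U p * ψ p
      = ∫ p in strip n ρ, (1 / 2 * Zfield U p + |p.2| * F p) * ψ p * weight a p :=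
    integral_congr_ae (ae_of_all _ fun p => by simp only [source]; ring)
  rw [h4]
  linarith

theorem energyIntegrand_eq (p : SpaceTime n) : energyIntegrand a U p
    = |p.2| * (inner ℝ (gradx U p) (gradx U p) + dy U p * dy U p) * weight a p := by
  rw [energyIntegrand, weight, normSqGrad, real_inner_self_eq_norm_sq]; ring

theorem heightIntegrand_eq (p : SpaceTime n) : heightIntegrand a U p = U p ^ 2 * weight a p := by
  rw [heightIntegrand, weight]; ring

/-- The energy of a dilation of `U`. -/
noncomputable def dilEnergy (a : ℝ) (U : SpaceTime n → ℝ) (r l : ℝ) : ℝ :=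
  ∫ p in strip n r, |p.2| * (inner ℝ (l • gradx U (dil l p)) (l • gradx U (dil l p)) +
    (l * dy U (dil l p)) * (l * dy U (dil l p))) * weight a p

theorem abs_dil_snd (l : ℝ) (p : SpaceTime n) : |(dil l p).2| = l ^ 2 * |p.2| := by
  rw [dil_apply, abs_mul, abs_of_nonneg (sq_nonneg l)]

/-- The factor `l²` from `|t|` is absorbed by the two factors `l` from the gradient of `U ∘ dil l`,
so only the scaling `l²` of the measure remains. -/
theorem setIntegral_energyIntegrand_mul {r l : ℝ} (hl : 0 < l) :
    ∫ p in strip n (l * r), energyIntegrand a U p = l ^ 2 * dilEnergy a U r l := by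
  simp_rw [energyIntegrand_eq]
  rw [setIntegral_weight_dil a hl r, dilEnergy]
  congr 1
  refine integral_congr_ae (ae_of_all _ fun p => ?_)
  simp only [abs_dil_snd, inner_smul_left, inner_smul_right, RCLike.conj_to_real]
  ring

theorem setIntegral_heightIntegrand_mul {r l : ℝ} (hl : 0 < l) :
    ∫ p in strip n (l * r), heightIntegrand a U p
      = l ^ 2 * ∫ p in strip n r, U (dil l p) ^ 2 * weight a p := by
  simp_rw [heightIntegrand_eq]
  rw [setIntegral_weight_dil a hl r (fun p => U p ^ 2)]

/-- The increment of the energy along dilations. -/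
theorem dilEnergy_sub (ha : -1 < a) (ha' : a < 1) (hU : IsSolution a F U)
    (hF : MemLp F ⊤ (volume.restrict (strip n 1))) {r l : ℝ} (hr : r ∈ Ioo (0 : ℝ) 1)
    (hl : 0 < l) (hlr : l * r < 1) :
    dilEnergy a U r l - dilEnergy a U r 1 =
      ((∫ p in strip n r, source a F U p * (U (dil l p) - U p)) -
        thinTerm a r U fun p => U (dil l p) - U p) +
      ((∫ p in strip n (l * r), source a F U p * (U p - U (dil l⁻¹ p))) -
        thinTerm a (l * r) U fun p => U p - U (dil l⁻¹ p)) / l ^ 2 := by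
  have hr' : r ∈ Ico (0 : ℝ) 1 := ⟨hr.1.le, hr.2⟩
  have hlr' : l * r ∈ Ico (0 : ℝ) 1 := ⟨by have := hr.1; positivity, hlr⟩
  have A0 := hU.adm hr'
  have A1 := hU.adm_dil hl hr.1.le hlr
  have B0 := hU.adm hlr'
  have B1 := hU.adm_dil (inv_pos.2 hl) hlr'.1 (by rw [inv_mul_cancel_left₀ hl.ne']; exact hr.2)
  -- The identity is `|v|² - |u|² = u·(v - u) + v·(v - u)` with `u = ∇U` and `v = ∇U_l`. The second
  -- product is rescaled to the strip of size `lr`, where it becomes `∇U` tested with `U - U ∘ dil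
  -- l⁻¹`; thus the equation is used for `U` only, never for a dilation of it.
  rw [← integral_grad_mul_grad ha ha' hU hF hr' (A1.sub A0),
    ← integral_grad_mul_grad ha ha' hU hF hlr' (B0.sub B1), setIntegral_weight_dil a hl r
      (fun p => |p.2| * (inner ℝ (gradx U p) (gradx U p - l⁻¹ • gradx U (dil l⁻¹ p)) +
        dy U p * (dy U p - l⁻¹ * dy U (dil l⁻¹ p)))), mul_div_cancel_left₀ _ (by positivity)]
  have hr1 := Ico_subset_Icc_self hr'
  have I1 := integral_sub (integrableOn_grad_mul_grad ha ha' hr1 A1 A1)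
    (integrableOn_grad_mul_grad ha ha' hr1 A0 A0)
  have I2 := integral_add (integrableOn_grad_mul_grad ha ha' hr1 A0 (A1.sub A0))
    (integrableOn_grad_mul_grad ha ha' hr1 A1 (A1.sub A0))
  have e1 : dilEnergy a U r 1 = ∫ p in strip n r,
      |p.2| * (inner ℝ (gradx U p) (gradx U p) + dy U p * dy U p) * weight a p := by
    simp only [dilEnergy, dil_one, one_smul, one_mul]
  have e2 : ∫ p in strip n r, |(dil l p).2| * (inner ℝ (gradx U (dil l p))
        (gradx U (dil l p) - l⁻¹ • gradx U (dil l⁻¹ (dil l p))) +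
        dy U (dil l p) * (dy U (dil l p) - l⁻¹ * dy U (dil l⁻¹ (dil l p)))) * weight a p
      = ∫ p in strip n r, |p.2| * (inner ℝ (l • gradx U (dil l p))
        (l • gradx U (dil l p) - gradx U p) +
        l * dy U (dil l p) * (l * dy U (dil l p) - dy U p)) * weight a p := by
    refine integral_congr_ae (ae_of_all _ fun p => ?_)
    simp only [abs_dil_snd, dil_inv_dil hl, inner_sub_right, inner_smul_left, inner_smul_right,
      RCLike.conj_to_real]
    field_simp
  rw [e2, e1, dilEnergy, ← I1, ← I2]
  refine integral_congr_ae (ae_of_all _ fun p => ?_)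
  simp only [inner_sub_right, inner_smul_left, inner_smul_right,
    RCLike.conj_to_real, real_inner_comm]
  ring

theorem tendsto_mul_const_nhdsNE (r : ℝ) :
    Tendsto (fun l : ℝ => l * r) (𝓝[≠] 1) (𝓝 r) := by
  have : Tendsto (fun l : ℝ => l * r) (𝓝 1) (𝓝 (1 * r)) := tendsto_id.mul_const r
  rw [one_mul] at this
  exact this.mono_left nhdsWithin_le_nhds

/-- Scales close to one. -/
theorem eventually_scale {r : ℝ} (hr : r ∈ Ioo (0 : ℝ) 1) :
    ∀ᶠ l : ℝ in 𝓝[≠] 1, l ∈ Icc (1 / 2 : ℝ) 2 ∧ l * r < 1 :=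
  ((tendsto_id.mono_left nhdsWithin_le_nhds).eventually
    (Icc_mem_nhds (by norm_num) (by norm_num))).and
    ((tendsto_mul_const_nhdsNE r).eventually_lt_const hr.2)

theorem abs_dil_sub_le_of_mem_slab {C : ℝ} (hC : ∀ l ∈ Icc (1 / 2 : ℝ) 2, ∀ p : SpaceTime n, 0 ≤ p.1.2 →
      p.2 ∈ Ioo (-1 : ℝ) 0 → -1 < l ^ 2 * p.2 → |U (dil l p) - U p| ≤ C * |l - 1|)
    {ρ l : ℝ} (hρ : ρ ∈ Ioo (0 : ℝ) 1) (hl : l ∈ Icc (1 / 2 : ℝ) 2) (hlρ : l * ρ < 1) :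
    ∀ p ∈ slab n ρ, |U (dil l p) - U p| ≤ C * |l - 1| := fun p hp => by
  have hl0 : 0 < l := by linarith [hl.1]
  have h0 : 0 < l * ρ := mul_pos hl0 hρ.1
  refine hC l hl p hp.1 ⟨by nlinarith [hp.2.1, hρ.1, hρ.2], hp.2.2⟩ ?_
  have h1 := (dil_mem_slab hl0 hp).2.1
  rw [dil_apply] at h1
  nlinarith

/-- Both increments in `dilEnergy_sub`, divided by `l - 1`, tend to `ZU` almost everywhere with a
uniform bound, which accounts for the factor `2`. The two thin terms, divided by `l - 1`, tend to
zero. -/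
theorem hasDerivAt_dilEnergy (ha : -1 < a) (ha' : a < 1) (hU : IsSolution a F U)
    (hF : MemLp F ⊤ (volume.restrict (strip n 1))) {r : ℝ} (hr : r ∈ Ioo (0 : ℝ) 1) :
    HasDerivAt (dilEnergy a U r) (2 * ∫ p in strip n r, source a F U p * Zfield U p) 1 := by
  obtain ⟨C, hC0, hC⟩ := exists_dil_lipschitz ha ha' hU
  have hid : Tendsto (fun l : ℝ => l * r) (𝓝[≠] 1) (𝓝 r) := tendsto_mul_const_nhdsNE r
  have hev := eventually_scale hr
  have hg := integrableOn_source ha ha' hU hF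
  have hone : Tendsto (fun l : ℝ => l) (𝓝[≠] 1) (𝓝 1) := nhdsWithin_le_nhds
  have hinv : Tendsto (fun l : ℝ => l⁻¹) (𝓝 1) (𝓝 1) := by
    simpa using tendsto_inv₀ (one_ne_zero (α := ℝ))
  -- bounds and regularity of the two increments
  have c1 : ∀ᶠ l : ℝ in 𝓝[≠] 1, ContinuousOn (fun p => U (dil l p) - U p) (slab n r) := by
    filter_upwards [hev] with l hl
    exact ((hU.adm_dil (by linarith [hl.1.1]) hr.1.le hl.2).sub (hU.adm ⟨hr.1.le, hr.2⟩)).cont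
  have b1 : ∀ᶠ l : ℝ in 𝓝[≠] 1, ∀ p ∈ slab n r, |U (dil l p) - U p| ≤ C * |l - 1| := by
    filter_upwards [hev] with l hl using abs_dil_sub_le_of_mem_slab hC hr hl.1 hl.2
  have c2 : ∀ᶠ l : ℝ in 𝓝[≠] 1, ContinuousOn (fun p => U p - U (dil l⁻¹ p)) (slab n (l * r)) := by
    filter_upwards [hev] with l hl
    have hl0 : 0 < l := by linarith [hl.1.1]
    have hlr : 0 ≤ l * r := mul_nonneg hl0.le hr.1.le
    exact ((hU.adm ⟨hlr, hl.2⟩).sub (hU.adm_dil (inv_pos.2 hl0) hlr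
      (by rw [inv_mul_cancel_left₀ hl0.ne']; exact hr.2))).cont
  have b2 : ∀ᶠ l : ℝ in 𝓝[≠] 1, ∀ p ∈ slab n (l * r),
      |U p - U (dil l⁻¹ p)| ≤ (C * 2) * |l - 1| := by
    filter_upwards [hev] with l hl p hp
    have hl0 : 0 < l := by linarith [hl.1.1]
    have hli : l⁻¹ ∈ Icc (1 / 2 : ℝ) 2 := by
      constructor
      · rw [one_div]; exact inv_anti₀ hl0 hl.1.2
      · have := inv_anti₀ (by norm_num) hl.1.1; simpa using this
    have h1 := abs_dil_sub_le_of_mem_slab hC (l := l⁻¹) ⟨mul_pos hl0 hr.1, hl.2⟩ hli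
      (by rw [inv_mul_cancel_left₀ hl0.ne']; exact hr.2) p hp
    rw [abs_sub_comm]
    refine h1.trans ?_
    have h2 : l⁻¹ - 1 = l⁻¹ * (1 - l) := by field_simp
    rw [h2, abs_mul, abs_of_pos (inv_pos.2 hl0), abs_sub_comm 1 l, mul_assoc]
    gcongr
    exact hli.2
  -- limits
  have l1 : ∀ᵐ p : SpaceTime n, p ∈ openStrip n →
      Tendsto (fun l => (U (dil l p) - U p) / (l - 1)) (𝓝[≠] 1) (𝓝 (Zfield U p)) := by
    filter_upwards [ae_hasDerivAt_dil hU] with p hp hps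
    have := hasDerivAt_iff_tendsto_slope.1 (hp hps)
    refine this.congr fun l => ?_
    rw [slope_def_field, dil_one]
  have l2 : ∀ᵐ p : SpaceTime n, p ∈ openStrip n →
      Tendsto (fun l => (U p - U (dil l⁻¹ p)) / (l - 1)) (𝓝[≠] 1) (𝓝 (Zfield U p)) := by
    filter_upwards [ae_hasDerivAt_dil hU] with p hp hps
    have h1 : HasDerivAt (fun l : ℝ => -U (dil l⁻¹ p)) (Zfield U p) 1 := by
      have h2 := hasDerivAt_inv (one_ne_zero (α := ℝ))
      have h3 : HasDerivAt (fun l => U (dil l p)) (Zfield U p) ((1 : ℝ)⁻¹) := by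
        rw [inv_one]; exact hp hps
      exact ((h3.comp 1 h2).neg).congr_deriv (by norm_num)
    refine (hasDerivAt_iff_tendsto_slope.1 h1).congr fun l => ?_
    rw [slope_def_field, inv_one, dil_one]; ring_nf
  have t1 := tendsto_integral_quotient hg hr (tendsto_const_nhds (x := r))
    (c1.mono fun l h => h.mono (openSlab_subset_slab n r))
    (b1.mono fun l h p hp => h p (openSlab_subset_slab n r hp)) l1
  have t2 := tendsto_integral_quotient hg hr hid
    (c2.mono fun l h => h.mono (openSlab_subset_slab n _))
    (b2.mono fun l h p hp => h p (openSlab_subset_slab n _ hp)) l2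
  have t3 := tendsto_thinTerm_div ha ha' hU hr (tendsto_const_nhds (x := r)) c1 hC0 b1
    (fun x t ht => by
      filter_upwards [(hU.eventually_dil_mul_conormal x ht).filter_mono nhdsWithin_le_nhds] with l hl
      rw [sub_mul, hl, hU.mul_conormal x ht, sub_zero])
  have t4 := tendsto_thinTerm_div ha ha' hU hr hid c2 (by positivity) b2
    (fun x t ht => by
      -- The backward increment is handled by the same vanishing property, since `l⁻¹ → 1`.
      filter_upwards [(hinv.eventually (hU.eventually_dil_mul_conormal x ht)).filter_mono
        nhdsWithin_le_nhds] with l hl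
      rw [sub_mul, hl, hU.mul_conormal x ht, sub_zero])
  rw [hasDerivAt_iff_tendsto_slope]
  have t5 := (t1.sub t3).add ((t2.sub t4).div (hone.pow 2) (by norm_num))
  have e : (∫ p in strip n r, source a F U p * Zfield U p) - 0 +
      ((∫ p in strip n r, source a F U p * Zfield U p) - 0) / 1 ^ 2
      = 2 * ∫ p in strip n r, source a F U p * Zfield U p := by ring
  rw [e] at t5
  refine t5.congr' ?_
  filter_upwards [hev, self_mem_nhdsWithin] with l hl hne
  have hl0 : 0 < l := by linarith [hl.1.1]
  rw [slope_def_field, dilEnergy_sub ha ha' hU hF hr hl0 hl.2]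
  simp only [Pi.div_apply]
  ring

theorem hasDerivAt_dilHeight (ha : -1 < a) (ha' : a < 1) (hU : IsSolution a F U)
    {r : ℝ} (hr : r ∈ Ioo (0 : ℝ) 1) :
    HasDerivAt (fun l => ∫ p in strip n r, U (dil l p) ^ 2 * weight a p)
      (∫ p in strip n r, weight a p * (2 * U p * Zfield U p)) 1 := by
  obtain ⟨C, hC0, hC⟩ := exists_dil_lipschitz ha ha' hU
  have hev := eventually_scale hr
  have A0 := hU.adm (F := F) (ρ := r) ⟨hr.1.le, hr.2⟩
  obtain ⟨M, hM0, hM, -, -⟩ := A0.bound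
  have c1 : ∀ᶠ l : ℝ in 𝓝[≠] 1,
      ContinuousOn (fun p => U (dil l p) ^ 2 - U p ^ 2) (openSlab n r) := by
    filter_upwards [hev] with l hl
    have A1 := hU.adm_dil (by linarith [hl.1.1]) hr.1.le hl.2
    exact ((A1.cont.pow 2).sub (A0.cont.pow 2)).mono (openSlab_subset_slab n r)
  have b1 : ∀ᶠ l : ℝ in 𝓝[≠] 1, ∀ p ∈ openSlab n r,
      |U (dil l p) ^ 2 - U p ^ 2| ≤ (C * (2 * M + C)) * |l - 1| := by
    filter_upwards [hev] with l hl p hp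
    have hp' := openSlab_subset_slab n r hp
    have h1 := abs_dil_sub_le_of_mem_slab hC hr hl.1 hl.2 p hp'
    have h2 := hM p hp'
    have h3 : |l - 1| ≤ 1 := abs_le.2 ⟨by linarith [hl.1.1], by linarith [hl.1.2]⟩
    have h4 : |2 * U p + (U (dil l p) - U p)| ≤ 2 * M + C := by
      refine (abs_add_le _ _).trans (add_le_add ?_ (h1.trans (mul_le_of_le_one_right hC0 h3)))
      rw [abs_mul, abs_two]; linarith
    rw [show U (dil l p) ^ 2 - U p ^ 2
      = (U (dil l p) - U p) * (2 * U p + (U (dil l p) - U p)) by ring, abs_mul]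
    calc _ ≤ (C * |l - 1|) * (2 * M + C) := mul_le_mul h1 h4 (abs_nonneg _) (by positivity)
      _ = _ := by ring
  have l1 : ∀ᵐ p : SpaceTime n, p ∈ openStrip n →
      Tendsto (fun l => (U (dil l p) ^ 2 - U p ^ 2) / (l - 1)) (𝓝[≠] 1)
        (𝓝 (2 * U p * Zfield U p)) := by
    filter_upwards [ae_hasDerivAt_dil hU] with p hp hps
    have h := ((hp hps).pow 2).congr_deriv (g' := 2 * U p * Zfield U p) (by simp [dil_one])
    refine (hasDerivAt_iff_tendsto_slope.1 h).congr fun l => ?_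
    rw [slope_def_field]; simp [dil_one]
  have t1 := tendsto_integral_quotient (integrableOn_weight ha 1) hr (tendsto_const_nhds (x := r))
    c1 b1 l1
  have hint : ∀ l : ℝ, 0 < l → l * r < 1 →
      IntegrableOn (fun p => U (dil l p) ^ 2 * weight a p) (strip n r) := fun l h1 h2 => by
    have A1 := hU.adm_dil h1 hr.1.le h2
    obtain ⟨M', hM0', hM', -, -⟩ := A1.bound
    refine integrableOn_bdd_mul_weight ha (C := M' ^ 2)
      (((A1.cont.pow 2).mono (openSlab_subset_slab n r)).aestronglyMeasurable
        (isOpen_openSlab n r).measurableSet) ?_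
    filter_upwards [ae_restrict_mem (isOpen_openSlab n r).measurableSet] with p hp
    rw [abs_pow]
    exact pow_le_pow_left₀ (abs_nonneg _) (hM' p (openSlab_subset_slab n r hp)) 2
  rw [hasDerivAt_iff_tendsto_slope]
  refine t1.congr' ?_
  filter_upwards [hev] with l hl
  rw [slope_def_field, ← integral_sub (hint l (by linarith [hl.1.1]) hl.2)
    (hint 1 one_pos (by linarith [hr.2]))]
  congr 1
  refine integral_congr_ae (ae_of_all _ fun p => ?_)
  simp only [dil_one]; ring

end

/-! ### The derivative of the Weiss functional -/

/-- Near `r` one has `N s = (s / r)² G (s / r)`, so a derivative at scale `1` becomes a derivative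
in the radius at `r`. -/
theorem hasDerivAt_of_mul_right {N G : ℝ → ℝ} {r G' : ℝ} (hr : 0 < r)
    (h : ∀ l, 0 < l → N (l * r) = l ^ 2 * G l) (hG : HasDerivAt G G' 1) :
    HasDerivAt N ((2 * G 1 + G') / r) r := by
  have h1 : HasDerivAt (fun s : ℝ => s / r) (1 / r) r := (hasDerivAt_id r).div_const r
  have h2 : HasDerivAt G G' (r / r) := by rwa [div_self hr.ne']
  have h3 := (h1.pow 2).mul (HasDerivAt.comp r (h₂ := G) (h := fun s : ℝ => s / r) h2 h1)
  refine (h3.congr_deriv ?_).congr_of_eventuallyEq ?_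
  · simp [div_self hr.ne']; ring
  · filter_upwards [lt_mem_nhds hr] with s hs
    have := h (s / r) (by positivity)
    rw [div_mul_cancel₀ _ hr.ne'] at this
    simpa using this

/-- Integration of linear combinations. -/
theorem integral_linear_comb {α : Type*} [MeasurableSpace α] {μ : Measure α}
    {f f₁ f₂ f₃ f₄ : α → ℝ} {c₁ c₂ c₃ c₄ : ℝ} (h₁ : Integrable f₁ μ) (h₂ : Integrable f₂ μ)
    (h₃ : Integrable f₃ μ) (h₄ : Integrable f₄ μ)
    (h : ∀ p, f p = c₁ * f₁ p + c₂ * f₂ p + c₃ * f₃ p + c₄ * f₄ p) :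
    ∫ p, f p ∂μ = c₁ * ∫ p, f₁ p ∂μ + c₂ * ∫ p, f₂ p ∂μ + c₃ * ∫ p, f₃ p ∂μ
      + c₄ * ∫ p, f₄ p ∂μ := by
  simp_rw [h]
  have i₁ := h₁.const_mul c₁
  have i₂ := h₂.const_mul c₂
  have i₃ := h₃.const_mul c₃
  have i₄ := h₄.const_mul c₄
  have e₁ := integral_add i₁ i₂
  have e₂ := integral_add (i₁.add i₂) i₃
  have e₃ := integral_add ((i₁.add i₂).add i₃) i₄
  simp only [Pi.add_apply] at e₂ e₃
  rw [e₃, e₂, e₁]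
  simp_rw [integral_const_mul]

section
variable {n : ℕ} {a : ℝ} {F U : SpaceTime n → ℝ}

theorem integrableOn_mul_weight_of_memLp_top (ha : -1 < a) {ρ : ℝ} {f : SpaceTime n → ℝ}
    (hf : MemLp f ⊤ (volume.restrict (openSlab n ρ))) :
    IntegrableOn (fun p => f p * weight a p) (strip n ρ) := by
  obtain ⟨C, -, hC⟩ := exists_ae_bound hf
  exact integrableOn_bdd_mul_weight ha hf.1 hC

theorem memLp_top_Zfield (ha : -1 < a) (ha' : a < 1) (hU : IsSolution a F U)
    {ρ : ℝ} (hρ : ρ ∈ Icc (0 : ℝ) 1) : MemLp (Zfield U) ⊤ (volume.restrict (openSlab n ρ)) := by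
  obtain ⟨C, -, hC⟩ := exists_dil_lipschitz ha ha' hU
  exact memLp_top_of_bound (aestronglyMeasurable_Zfield hU hρ) C
    (ae_openSlab_of_ae hρ (ae_abs_Zfield_le hU hC))

theorem memLp_top_solution (hU : IsSolution a F U) {ρ : ℝ} (hρ : ρ ∈ Ico (0 : ℝ) 1) :
    MemLp U ⊤ (volume.restrict (openSlab n ρ)) := by
  have hO := (isOpen_openSlab n ρ).measurableSet
  have A := hU.adm hρ
  obtain ⟨M, -, hM, -, -⟩ := A.bound
  refine memLp_top_of_bound ((A.cont.mono (openSlab_subset_slab n ρ)).aestronglyMeasurable hO) M ?_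
  filter_upwards [ae_restrict_mem hO] with p hp using hM p (openSlab_subset_slab n ρ hp)

theorem memLp_top_abs_mul (hF : MemLp F ⊤ (volume.restrict (strip n 1))) {ρ : ℝ}
    (hρ : ρ ∈ Icc (0 : ℝ) 1) :
    MemLp (fun p => |p.2| * F p) ⊤ (volume.restrict (openSlab n ρ)) := by
  have hO := (isOpen_openSlab n ρ).measurableSet
  have h1 : MemLp (fun p : SpaceTime n => |p.2|) ⊤ (volume.restrict (openSlab n ρ)) := by
    have hc : Continuous fun p : SpaceTime n => |p.2| := by fun_prop
    refine memLp_top_of_bound hc.aestronglyMeasurable 1 ?_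
    filter_upwards [ae_restrict_mem hO] with p hp
    rw [Real.norm_eq_abs, abs_abs, abs_of_neg hp.2.2]
    nlinarith [hp.2.1, hρ.1, hρ.2]
  exact (hF.mono_measure (Measure.restrict_mono ((openSlab_subset_openStrip n hρ).trans
    (openStrip_subset_strip n)) le_rfl)).mul' h1

theorem integrableOn_heightIntegrand (ha : -1 < a) (hU : IsSolution a F U) {ρ : ℝ}
    (hρ : ρ ∈ Ico (0 : ℝ) 1) : IntegrableOn (heightIntegrand a U) (strip n ρ) := by
  have h := memLp_top_solution hU hρ
  refine (integrableOn_mul_weight_of_memLp_top ha (h.mul' h)).congr (ae_of_all _ fun p => ?_)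
  simp only [heightIntegrand_eq]; ring

theorem integrableOn_energyIntegrand (ha : -1 < a) (ha' : a < 1) (hU : IsSolution a F U) {ρ : ℝ}
    (hρ : ρ ∈ Ico (0 : ℝ) 1) : IntegrableOn (energyIntegrand a U) (strip n ρ) :=
  (integrableOn_grad_mul_grad ha ha' (Ico_subset_Icc_self hρ) (hU.adm hρ) (hU.adm hρ)).congr
    (ae_of_all _ fun p => by simp only [energyIntegrand_eq])

theorem weissIntegrand_eq (κ : ℝ) (p : SpaceTime n) : weissIntegrand a κ F U p
    = (Zfield U p - κ * U p + |p.2| * F p) ^ 2 * weight a p := by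
  rw [weissIntegrand, weight]; ring

theorem integrableOn_weissIntegrand (ha : -1 < a) (ha' : a < 1) (hU : IsSolution a F U)
    (hF : MemLp F ⊤ (volume.restrict (strip n 1))) (κ : ℝ) {ρ : ℝ}
    (hρ : ρ ∈ Ico (0 : ℝ) 1) : IntegrableOn (weissIntegrand a κ F U) (strip n ρ) := by
  have hρ' := Ico_subset_Icc_self hρ
  have h := ((memLp_top_Zfield ha ha' hU hρ').sub ((memLp_top_solution hU hρ).const_mul κ)).add
    (memLp_top_abs_mul hF hρ')
  refine (integrableOn_mul_weight_of_memLp_top ha (h.mul' h)).congr (ae_of_all _ fun p => ?_)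
  simp only [weissIntegrand_eq, Pi.add_apply, Pi.sub_apply]; ring

theorem thinTerm_self (hU : IsSolution a F U) {ρ : ℝ} (hρ : ρ ∈ Icc (0 : ℝ) 1) :
    thinTerm a ρ U U = 0 := by
  rw [thinTerm]
  refine (setIntegral_congr_fun (measurableSet_thinBox n ρ) fun p hp => ?_).trans
    (integral_zero _ _)
  have := hU.mul_conormal p.1.1 (t := p.2) ⟨by nlinarith [hp.2.1, hρ.1, hρ.2], hp.2.2⟩
  simp only [this, mul_zero]

/-- The energy in terms of the source term. -/
theorem setIntegral_energyIntegrand (ha : -1 < a) (ha' : a < 1) (hU : IsSolution a F U)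
    (hF : MemLp F ⊤ (volume.restrict (strip n 1))) {ρ : ℝ} (hρ : ρ ∈ Ico (0 : ℝ) 1) :
    ∫ p in strip n ρ, energyIntegrand a U p = ∫ p in strip n ρ, source a F U p * U p := by
  simp_rw [energyIntegrand_eq]
  rw [integral_grad_mul_grad ha ha' hU hF hρ (hU.adm hρ),
    thinTerm_self hU (Ico_subset_Icc_self hρ), sub_zero]

/-- An exact identity. The factors `2` from the scaling of the measure cancel against the derivative
of `1 / r²`, leaving `2 ∫ S ZU - κ ∫ U ZU - 2κ ∫ S U + κ² ∫ U²` with `S = ½ ZU + |t|F`, where the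
energy has been replaced by `∫ S U`. -/
theorem hasDerivAt_weiss (ha : -1 < a) (ha' : a < 1) (hU : IsSolution a F U)
    (hF : MemLp F ⊤ (volume.restrict (strip n 1))) (κ : ℝ) {r : ℝ} (hr : r ∈ Ioo (0 : ℝ) 1) :
    HasDerivAt (weiss a κ U) (1 / r ^ (2 * κ + 3) *
      ((∫ p in strip n r, weissIntegrand a κ F U p) -
        ∫ p in strip n r, (|p.2| * F p) ^ 2 * weight a p)) r := by
  have hr0 := hr.1
  have hr1 : r ∈ Ico (0 : ℝ) 1 := Ioo_subset_Ico_self hr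
  have hr2 := Ico_subset_Icc_self hr1
  have hE : HasDerivAt (fun s => ∫ p in strip n s, energyIntegrand a U p) _ r :=
    hasDerivAt_of_mul_right hr0
      (fun l hl => setIntegral_energyIntegrand_mul hl) (hasDerivAt_dilEnergy ha ha' hU hF hr)
  have hH : HasDerivAt (fun s => ∫ p in strip n s, heightIntegrand a U p) _ r :=
    hasDerivAt_of_mul_right hr0
      (fun l hl => setIntegral_heightIntegrand_mul hl) (hasDerivAt_dilHeight ha ha' hU hr)
  have hE1 : dilEnergy a U r 1 = ∫ p in strip n r, source a F U p * U p := by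
    have := setIntegral_energyIntegrand_mul (n := n) (a := a) (U := U) (r := r) one_pos
    rw [one_mul, one_pow, one_mul, setIntegral_energyIntegrand ha ha' hU hF hr1] at this
    exact this.symm
  have hH1 : ∫ p in strip n r, U (dil 1 p) ^ 2 * weight a p
      = ∫ p in strip n r, heightIntegrand a U p := by simp only [dil_one, heightIntegrand_eq]
  have hE0 := setIntegral_energyIntegrand ha ha' hU hF hr1
  rw [hE1] at hE
  rw [hH1] at hH
  have mZ := memLp_top_Zfield ha ha' hU hr2
  have mU := memLp_top_solution hU hr1
  have mF := memLp_top_abs_mul hF hr2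
  have mS := (mZ.const_mul (1 / 2)).add mF
  -- Completion of the square: `(ZU - κU + |t|F)² - (|t|F)² = 2 S ZU - 2κ S U + κ² U² - κ U ZU`,
  -- integrated term by term.
  have key := integral_linear_comb (μ := volume.restrict (strip n r))
    (f := fun p => weissIntegrand a κ F U p - (|p.2| * F p) ^ 2 * weight a p)
    (f₁ := fun p => source a F U p * U p) (f₂ := heightIntegrand a U)
    (f₃ := fun p => source a F U p * Zfield U p)
    (f₄ := fun p => weight a p * (2 * U p * Zfield U p))
    (c₁ := -2 * κ) (c₂ := κ ^ 2) (c₃ := 2) (c₄ := -(κ / 2))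
    ((integrableOn_mul_weight_of_memLp_top ha (mU.mul' mS)).congr (ae_of_all _ fun p => by
      simp only [source, Pi.add_apply]; ring))
    (integrableOn_heightIntegrand ha hU hr1)
    ((integrableOn_mul_weight_of_memLp_top ha (mZ.mul' mS)).congr (ae_of_all _ fun p => by
      simp only [source, Pi.add_apply]; ring))
    ((integrableOn_mul_weight_of_memLp_top ha ((mZ.mul' mU).const_mul 2)).congr
      (ae_of_all _ fun p => by simp only; ring))
    (fun p => by rw [weissIntegrand_eq, heightIntegrand_eq, source]; ring)
  rw [integral_sub (integrableOn_weissIntegrand ha ha' hU hF κ hr1)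
    ((integrableOn_mul_weight_of_memLp_top ha (mF.mul' mF)).congr
      (ae_of_all _ fun p => by simp only; ring))] at key
  rw [key]
  have hsq : HasDerivAt (fun s : ℝ => 1 / s ^ 2) (-2 / r ^ 3) r := by
    have := (hasDerivAt_pow 2 r).inv (by positivity)
    simp only [one_div]
    refine this.congr_deriv ?_
    field_simp; norm_num; ring
  have hpow := Real.hasDerivAt_rpow_const (x := r) (p := -(2 * κ)) (Or.inl hr0.ne')
  have hW := hpow.mul ((hsq.mul hE).sub ((hsq.mul hH).const_mul (κ / 2)))
  refine HasDerivAt.congr_deriv (f := weiss a κ U) hW ?_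
  have p1 : r ^ (-(2 * κ) - 1) = r ^ (-(2 * κ)) / r := by rw [Real.rpow_sub hr0, Real.rpow_one]
  have p2 : 1 / r ^ (2 * κ + 3) = r ^ (-(2 * κ)) / r ^ 3 := by
    rw [Real.rpow_add hr0, Real.rpow_neg hr0.le]
    norm_num
    field_simp
  rw [p1, p2, hE0]
  simp only [Pi.sub_apply, Pi.mul_apply, hE0]
  field_simp
  ring

end

/-! ### The contribution of the right-hand side -/

/-- This is `1 + u ≤ exp u` at `u = (1 + s) / (8(m + 1))`, raised to the power `m`. The rate `1/8`
is half of the rate `1/4` in the Gaussian, so polynomial growth is absorbed and Gaussian decay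
remains. -/
theorem one_add_rpow_le_exp {m s : ℝ} (hm : 0 ≤ m) (hs : 0 ≤ s) :
    (1 + s) ^ m ≤ (8 * (m + 1)) ^ m * Real.exp (1 / 8) * Real.exp (s / 8) := by
  have hc : 0 < 8 * (m + 1) := by positivity
  have h1 : 1 + s ≤ 8 * (m + 1) * Real.exp ((1 + s) / (8 * (m + 1))) := by
    have := Real.add_one_le_exp ((1 + s) / (8 * (m + 1)))
    calc 1 + s = 8 * (m + 1) * ((1 + s) / (8 * (m + 1))) := by field_simp
      _ ≤ _ := by gcongr; linarith
  calc (1 + s) ^ m ≤ (8 * (m + 1) * Real.exp ((1 + s) / (8 * (m + 1)))) ^ m := by gcongr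
    _ = (8 * (m + 1)) ^ m * Real.exp ((1 + s) / (8 * (m + 1)) * m) := by
        rw [Real.mul_rpow hc.le (Real.exp_pos _).le, ← Real.exp_mul]
    _ ≤ (8 * (m + 1)) ^ m * Real.exp (1 / 8 + s / 8) := by
        gcongr
        rw [div_mul_eq_mul_div, div_le_iff₀ hc]
        nlinarith
    _ = _ := by rw [Real.exp_add]; ring

/-- The contribution of a right-hand side of order `ℓ - 2`. -/
theorem exists_setIntegral_sq_le (n : ℕ) {a ℓ : ℝ} (Cℓ : ℝ) (ha : -1 < a) (hℓ : 2 ≤ ℓ) :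
    ∃ K : ℝ, 0 ≤ K ∧ ∀ F : SpaceTime n → ℝ,
      (∀ᵐ p ∂(volume.restrict (strip n 1)), |F p| ≤ Cℓ * parNorm p ^ (ℓ - 2)) →
      ∀ r ∈ Ioo (0 : ℝ) 1,
        ∫ p in strip n r, (|p.2| * F p) ^ 2 * weight a p ≤ K * r ^ (2 * ℓ + 2) := by
  set m := ℓ - 2 with hm
  have hm0 : 0 ≤ m := by linarith
  set e := -((n : ℝ) + a + 1) / 2 with he
  have hg := gaussConst_pos n ha
  set c := Cℓ ^ 2 * ((8 * (m + 1)) ^ m * Real.exp (1 / 8)) * gaussConst n a with hc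
  have hc0 : 0 ≤ c := by positivity
  refine ⟨c * ∫ p in strip n 1, profile (n := n) (e + m + 2) a (1 / 8) p, ?_, fun F hF r hr => ?_⟩
  · refine mul_nonneg hc0 (setIntegral_nonneg (measurableSet_strip n 1) fun p hp => ?_)
    have := hp.1
    unfold profile; positivity
  -- Homogeneity of the dominating profile: the dependence on `r` is a pure power, so the constant
  -- is the integral over the unit strip and is independent of `F` and `r`.
  have h1 : c * (∫ p in strip n 1, profile (n := n) (e + m + 2) a (1 / 8) p) * r ^ (2 * ℓ + 2)
      = ∫ p in strip n r, c * profile (n := n) (e + m + 2) a (1 / 8) p := by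
    rw [integral_const_mul, setIntegral_profile _ _ _ hr.1,
      show 2 * (e + m + 2) + a + n + 3 = 2 * ℓ + 2 by rw [he, hm]; ring]
    ring
  have hint : IntegrableOn (fun p : SpaceTime n => c * profile (e + m + 2) a (1 / 8) p)
      (strip n r) :=
    (integrableOn_profile ha (by norm_num) (by rw [he]; ring_nf; linarith) r).const_mul c
  have hsub : strip n r ⊆ strip n 1 := fun p hp =>
    ⟨hp.1, by nlinarith [hp.2.1, hr.1, hr.2], hp.2.2⟩
  rw [h1, ← setIntegral_congr_set (openSlab_ae_eq_strip n r),
    ← setIntegral_congr_set (openSlab_ae_eq_strip n r)]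
  have hO := (isOpen_openSlab n r).measurableSet
  have hs' := openSlab_subset_strip n r
  refine integral_mono_of_nonneg ?_ (hint.mono_set hs') ?_
  · filter_upwards [ae_restrict_mem hO] with p hp
    exact mul_nonneg (sq_nonneg _) (weight_nonneg ha hp.1)
  filter_upwards [ae_restrict_mem hO, ae_restrict_of_ae_restrict_of_subset (hs'.trans hsub) hF]
    with p hp hFp
  have ht : 0 < |p.2| := abs_pos.2 hp.2.2.ne
  have hN : 0 ≤ normSqX p.1 := normSqX_nonneg p.1
  -- Writing the squared parabolic norm as `|t| (1 + |X|²/|t|)` separates the power of `|t|` from a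
  -- function of the Gaussian variable.
  have hpar : (parNorm p ^ m) ^ 2 = |p.2| ^ m * (1 + normSqX p.1 / |p.2|) ^ m := by
    rw [← Real.mul_rpow ht.le (by positivity), mul_add, mul_one, mul_div_cancel₀ _ ht.ne', parNorm,
      ← Real.rpow_natCast, ← Real.rpow_mul (Real.sqrt_nonneg _), mul_comm m, Real.rpow_mul
      (Real.sqrt_nonneg _), Real.rpow_natCast, Real.sq_sqrt (by positivity), add_comm]
  have h2 : F p ^ 2 ≤ Cℓ ^ 2 * (|p.2| ^ m *
      ((8 * (m + 1)) ^ m * Real.exp (1 / 8) * Real.exp (normSqX p.1 / |p.2| / 8))) := by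
    calc F p ^ 2 = |F p| ^ 2 := (sq_abs _).symm
      _ ≤ (Cℓ * parNorm p ^ m) ^ 2 := pow_le_pow_left₀ (abs_nonneg _) hFp 2
      _ = Cℓ ^ 2 * (|p.2| ^ m * (1 + normSqX p.1 / |p.2|) ^ m) := by rw [mul_pow, hpar]
      _ ≤ _ := by
        gcongr
        exact one_add_rpow_le_exp hm0 (by positivity)
  have hw := weight_nonneg ha hp.1
  have hexp : Real.exp (normSqX p.1 / |p.2| / 8) * Real.exp (-(1 / 4 * normSqX p.1) / |p.2|)
      = Real.exp (-(1 / 8 * normSqX p.1) / |p.2|) := by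
    rw [← Real.exp_add]; congr 1; field_simp; norm_num
  calc (|p.2| * F p) ^ 2 * weight a p = |p.2| ^ 2 * F p ^ 2 * weight a p := by ring
    _ ≤ |p.2| ^ 2 * (Cℓ ^ 2 * (|p.2| ^ m *
      ((8 * (m + 1)) ^ m * Real.exp (1 / 8) * Real.exp (normSqX p.1 / |p.2| / 8)))) * weight a p := by
        gcongr
    _ = c * (|p.2| ^ e * |p.2| ^ m * |p.2| ^ 2) * p.1.2 ^ a *
        (Real.exp (normSqX p.1 / |p.2| / 8) * Real.exp (-(1 / 4 * normSqX p.1) / |p.2|)) := by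
        rw [weight_eq_profile, profile, hc]; ring
    _ = _ := by
        rw [hexp, profile, Real.rpow_add ht, Real.rpow_add ht, Real.rpow_two]; ring

/-- A function differing from a monotone one by a vanishing correction has a one-sided limit. -/
theorem exists_tendsto_of_monotoneOn_add {W g : ℝ → ℝ}
    (hm : MonotoneOn (fun r => W r + g r) (Ioo 0 1)) (hg : Tendsto g (𝓝[>] 0) (𝓝 0)) :
    ∃ L : EReal, L ≠ ⊤ ∧ Tendsto (fun r : ℝ => (W r : EReal)) (𝓝[>] 0) (𝓝 L) := by
  -- In the extended reals the monotone limit is the infimum. It may be `⊥`, but it lies below the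
  -- finite value at `1/2`, so it is not `⊤`, and subtracting the vanishing correction does not
  -- change it.
  have hm' : MonotoneOn (fun r : ℝ => ((W r + g r : ℝ) : EReal)) (Ioo 0 1) := fun x hx y hy h =>
    EReal.coe_le_coe_iff.2 (hm hx hy h)
  have h1 := hm'.tendsto_nhdsWithin_Ioo_right (nonempty_Ioo.2 one_pos) (OrderBot.bddBelow _)
  set L := sInf ((fun r : ℝ => ((W r + g r : ℝ) : EReal)) '' Ioo 0 1)
  have hL : L ≠ ⊤ := ne_of_lt ((sInf_le (mem_image_of_mem _
    (show (1 / 2 : ℝ) ∈ Ioo (0 : ℝ) 1 by norm_num))).trans_lt (EReal.coe_lt_top _))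
  refine ⟨L, hL, ?_⟩
  have h2 : Tendsto (fun r : ℝ => ((-g r : ℝ) : EReal)) (𝓝[>] 0) (𝓝 ((0 : ℝ) : EReal)) := by
    have := hg.neg
    rw [neg_zero] at this
    exact EReal.tendsto_coe.2 this
  have h3 := (EReal.continuousAt_add (p := (L, ((0 : ℝ) : EReal))) (Or.inl hL)
    (Or.inr (EReal.coe_ne_top 0))).tendsto.comp (h1.prodMk_nhds h2)
  rw [EReal.coe_zero, add_zero] at h3
  refine h3.congr fun r => ?_
  simp only [Function.comp_apply]
  rw [← EReal.coe_add, add_neg_cancel_right]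

end ThinObstacle

/-! ### The monotonicity formula -/

theorem mainTheorem4 (n : ℕ) (a ℓ Cℓ : ℝ) (ha : -1 < a) (ha' : a < 1) (hℓ : 2 ≤ ℓ) :
    ∃ C' : ℝ, 0 < C' ∧
      ∀ F U : ThinObstacle.SpaceTime n → ℝ,
        MemLp F ⊤ (volume.restrict (ThinObstacle.strip n 1)) →
        (∀ᵐ p ∂(volume.restrict (ThinObstacle.strip n 1)),
          |F p| ≤ Cℓ * ThinObstacle.parNorm p ^ (ℓ - 2)) →
        ThinObstacle.IsSolution a F U →
        ∀ κ σ : ℝ, 0 < κ → κ < ℓ → 0 < σ → σ < 1 → κ ≤ ℓ - 1 + σ →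
          (∀ r ∈ Ioo (0 : ℝ) 1,
            IntegrableOn (ThinObstacle.heightIntegrand a U) (ThinObstacle.strip n r) ∧
            IntegrableOn (ThinObstacle.energyIntegrand a U) (ThinObstacle.strip n r) ∧
            IntegrableOn (ThinObstacle.weissIntegrand a κ F U) (ThinObstacle.strip n r) ∧
            DifferentiableAt ℝ (ThinObstacle.weiss a κ U) r ∧
            1 / r ^ (2 * κ + 3) *
                (∫ p in ThinObstacle.strip n r, ThinObstacle.weissIntegrand a κ F U p)
              - C' * r ^ (1 - 2 * σ) ≤ deriv (ThinObstacle.weiss a κ U) r) ∧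
          MonotoneOn
            (fun r : ℝ => ThinObstacle.weiss a κ U r + C' / (2 - 2 * σ) * r ^ (2 - 2 * σ))
            (Ioo 0 1) ∧
          ∃ L : EReal, L ≠ ⊤ ∧
            Tendsto (fun r : ℝ => (ThinObstacle.weiss a κ U r : EReal)) (𝓝[>] 0) (𝓝 L) := by
  obtain ⟨K, hK0, hK⟩ := ThinObstacle.exists_setIntegral_sq_le n Cℓ ha hℓ
  -- Adding `1` secures strict positivity, since `K` may vanish.
  refine ⟨K + 1, by positivity, fun F U hF hFb hU κ σ _ _ _ hσ hκσ => ?_⟩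
  have hder := fun r (hr : r ∈ Ioo (0 : ℝ) 1) =>
    ThinObstacle.hasDerivAt_weiss ha ha' hU hF κ hr
  have hineq : ∀ r ∈ Ioo (0 : ℝ) 1, 1 / r ^ (2 * κ + 3) *
      (∫ p in ThinObstacle.strip n r, ThinObstacle.weissIntegrand a κ F U p)
        - (K + 1) * r ^ (1 - 2 * σ) ≤ deriv (ThinObstacle.weiss a κ U) r := fun r hr => by
    have hr0 : 0 < r := hr.1
    have h1 := hK F hFb r hr
    have h2 : 1 / r ^ (2 * κ + 3) * (K * r ^ (2 * ℓ + 2)) = K * r ^ (2 * ℓ - 2 * κ - 1) := by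
      rw [show 2 * ℓ - 2 * κ - 1 = (2 * ℓ + 2) - (2 * κ + 3) by ring, Real.rpow_sub hr0]; ring
    -- For `r < 1` the larger exponent gives the smaller power, and `2ℓ - 2κ - 1 ≥ 1 - 2σ` is
    -- exactly `κ ≤ ℓ - 1 + σ`.
    have h3 : r ^ (2 * ℓ - 2 * κ - 1) ≤ r ^ (1 - 2 * σ) :=
      Real.rpow_le_rpow_of_exponent_ge hr0 hr.2.le (by linarith)
    have h4 : 0 < r ^ (1 - 2 * σ) := Real.rpow_pos_of_pos hr0 _
    have h5 := mul_le_mul_of_nonneg_left h1 (show 0 ≤ 1 / r ^ (2 * κ + 3) by positivity)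
    have h6 := mul_le_mul_of_nonneg_left h3 hK0
    rw [(hder r hr).deriv, mul_sub]
    linarith
  have hmono : MonotoneOn (fun r : ℝ =>
      ThinObstacle.weiss a κ U r + (K + 1) / (2 - 2 * σ) * r ^ (2 - 2 * σ)) (Ioo 0 1) := by
    have hd : ∀ r ∈ Ioo (0 : ℝ) 1, HasDerivAt (fun r : ℝ =>
        ThinObstacle.weiss a κ U r + (K + 1) / (2 - 2 * σ) * r ^ (2 - 2 * σ))
        (deriv (ThinObstacle.weiss a κ U) r + (K + 1) * r ^ (1 - 2 * σ)) r := fun r hr => by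
      have h1 := (Real.hasDerivAt_rpow_const (x := r) (p := 2 - 2 * σ)
        (Or.inl hr.1.ne')).const_mul ((K + 1) / (2 - 2 * σ))
      refine ((hder r hr).differentiableAt.hasDerivAt.add h1).congr_deriv ?_
      have : 2 - 2 * σ ≠ 0 := by linarith
      rw [← mul_assoc, div_mul_cancel₀ _ this, show 2 - 2 * σ - 1 = 1 - 2 * σ by ring]
    refine monotoneOn_of_deriv_nonneg (convex_Ioo 0 1)
      (fun r hr => (hd r hr).continuousAt.continuousWithinAt) ?_ ?_ <;> rw [interior_Ioo]
    · exact fun r hr => (hd r hr).differentiableAt.differentiableWithinAt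
    · intro r hr
      rw [(hd r hr).deriv]
      have h1 := hineq r hr
      have h2 : 0 ≤ 1 / r ^ (2 * κ + 3) *
          (∫ p in ThinObstacle.strip n r, ThinObstacle.weissIntegrand a κ F U p) := by
        have hr0 := hr.1
        refine mul_nonneg (by positivity)
          (setIntegral_nonneg (ThinObstacle.measurableSet_strip n r) fun p hp => ?_)
        rw [ThinObstacle.weissIntegrand_eq]
        exact mul_nonneg (sq_nonneg _) (ThinObstacle.weight_nonneg ha hp.1)
      linarith
  refine ⟨fun r hr => ⟨ThinObstacle.integrableOn_heightIntegrand ha hU (Ioo_subset_Ico_self hr),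
    ThinObstacle.integrableOn_energyIntegrand ha ha' hU (Ioo_subset_Ico_self hr),
    ThinObstacle.integrableOn_weissIntegrand ha ha' hU hF κ (Ioo_subset_Ico_self hr),
    (hder r hr).differentiableAt, hineq r hr⟩, hmono,
    ThinObstacle.exists_tendsto_of_monotoneOn_add hmono ?_⟩
  have hp : 0 < 2 - 2 * σ := by linarith
  have h1 : ContinuousAt (fun r : ℝ => (K + 1) / (2 - 2 * σ) * r ^ (2 - 2 * σ)) 0 :=
    continuousAt_const.mul (Real.continuousAt_rpow_const _ _ (Or.inr hp.le))
  have h2 := h1.tendsto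
  rw [Real.zero_rpow hp.ne', mul_zero] at h2
  exact h2.mono_left nhdsWithin_le_nhds
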